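/- **Setting.** Let $R$ be a reduced irreducible (crystallographic) root system in a real vector space $\mathfrak h_{\mathbb R}^*$, with a fixed choice of simple roots $\alpha_1,\dots,\alpha_n$ and corresponding positive roots $R^+$, Weyl group $W$, simple reflections $s_i=s_{\alpha_i}$, and length $\ell(w)=\mathrm{Card}\{\alpha\in R^+ : w\alpha\in -R^+\}$. Let $$P=\{\lambda:\langle\lambda,\alpha^\vee\rangle\in\mathbb Z\ \forall\alpha\in R\},\quad P^+=\{\lambda\in P:\langle\lambda,\alpha^\vee\rangle\ge 0\ \forall\alpha\in R^+\},\quad P^{++}=\{\lambda\in P:\langle\lambda,\alpha^\vee\rangle> 0\ \forall\alpha\in R^+\}.$$ Let $\mathbb K=\mathbb Z[q,q^{-1}]$. The affine Hecke algebra $\tilde H$ is the unital associative $\mathbb K$-algebra with generators $T_i$ ($1\le i\le n$) and $x^\lambda$ ($\lambda\in P$) and relations $$\underbrace{T_iT_jT_i\cdots}_{m_{ij}}=\underbrace{T_jT_iT_j\cdots}_{m_{ij}}\ (i\neq j),\qquad T_i^2=(q-q^{-1})T_i+1,\qquad x^0=1,\quad x^\lambda x^\mu=x^{\lambda+\mu},$$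 $$x^\lambda T_i=T_ix^{s_i\lambda}+(q-q^{-1})\frac{x^\lambda-x^{s_i\lambda}}{1-x^{-\alpha_i}},$$ where $m_{ij}$ is the order of $s_is_j$ in $W$ and the last fraction stands for the quotient in the group algebra $\mathbb K[P]$ (a $\mathbb K$-combination of elements $x^\mu$). For $w\in W$ put $T_w=T_{i_1}\cdots T_{i_p}$ for a reduced word $w=s_{i_1}\cdots s_{i_p}$. With $W_0(t)=\sum_{w\in W}t^{\ell(w)}$, let $\mathbb K'=\mathbb K[W_0(q^2)^{-1}]$ (in which $W_0(q^{-2})$ is invertible too), $\tilde H'=\mathbb K'\otimes_{\mathbb K}\tilde H$, and in $\tilde H'$ put $$\mathbf 1_0=\frac1{W_0(q^2)}\sum_{w\in W}q^{\ell(w)}T_w,\qquad \varepsilon_0=\frac1{W_0(q^{-2})}\sum_{w\in W}(-q)^{-\ell(w)}T_w .$$ The group $W$ acts on $\mathbb K[P]$ by $w x^\mu=x^{w\mu}$; let $$\mathbb K[P]^W=\{f: wf=f\ \forall w\in W\},\qquad \mathcal A=\{f\in\mathbb K[P]: wf=(-1)^{\ell(w)}f\ \forall w\in W\},$$ and for $\mu\in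 P$ $$m_\mu=\sum_{\gamma\in W\mu}x^\gamma,\qquad a_\mu=\sum_{w\in W}(-1)^{\ell(w)}x^{w\mu},\qquad M_\mu=\mathbf 1_0x^\mu\mathbf 1_0,\qquad A_\mu=\varepsilon_0x^\mu\mathbf 1_0 .$$ **Theorem.** The following are free $\mathbb K$-modules with the indicated $\mathbb K$-bases: 1. $\mathbb K[P]^W$ has basis $\{m_\lambda:\lambda\in P^+\}$; 2. $\mathbf 1_0\tilde H\mathbf 1_0=\{\mathbf 1_0h\mathbf 1_0:h\in\tilde H\}\subseteq\tilde H'$ has basis $\{M_\lambda:\lambda\in P^+\}$; 3. $\mathcal A$ has basis $\{a_\mu:\mu\in P^{++}\}$; 4. $\varepsilon_0\tilde H\mathbf 1_0=\{\varepsilon_0h\mathbf 1_0:h\in\tilde H\}\subseteq\tilde H'$ has basis $\{A_\mu:\mu\in P^{++}\}$. Moreover the same families are $\mathbb K'$-bases of the $\mathbb K'$-modules $\mathbf 1_0\tilde H'\mathbf 1_0$ and $\varepsilon_0\tilde H'\mathbf 1_0$, respectively. -/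

import Mathlib

namespace AffineHecke

open scoped TensorProduct

noncomputable section

section Generic

/-- The alternating product `a * b * a * ⋯` with `m` factors. -/
def altProd {A : Type*} [Monoid A] : ℕ → A → A → A
  | 0, _, _ => 1
  | m + 1, a, b => a * altProd m b a

/-- The submodule `S` is free over `A`, and the family `v` of elements of the ambient module is
a basis of it. -/
def IsBasisOf {A V κ : Type*} [CommRing A] [AddCommGroup V] [Module A V]
    (S : Submodule A V) (v : κ → V) : Prop :=
  ∃ B : Module.Basis κ A S, ∀ k, (B k : V) = v k

/-- The base ring `𝕂 = ℤ[q, q⁻¹]`. -/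
abbrev K : Type := LaurentPolynomial ℤ

/-- The power `q ^ n` in `𝕂`, for an integer `n`. -/
abbrev q (n : ℤ) : K := LaurentPolynomial.T n

end Generic

variable {ι M N : Type*} [AddCommGroup M] [Module ℝ M] [AddCommGroup N] [Module ℝ N]

section Lattice

variable (P : RootPairing ι ℝ M N)

/-- The weight lattice: the vectors that pair integrally with all coroots. -/
def weightLattice : AddSubgroup M where
  carrier := {x | ∀ i, ∃ n : ℤ, P.coroot' i x = n}
  zero_mem' := fun i => ⟨0, by simp⟩
  add_mem' := by
    intro x y hx hy i
    obtain ⟨a, ha⟩ := hx i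
    obtain ⟨c, hc⟩ := hy i
    exact ⟨a + c, by rw [map_add, ha, hc]; push_cast; rfl⟩
  neg_mem' := by
    intro x hx i
    obtain ⟨a, ha⟩ := hx i
    exact ⟨-a, by rw [map_neg, ha]; push_cast; rfl⟩

variable {P}

/-- The integer `⟨x, αᵢ^∨⟩` for a weight `x`. -/
def wt (x : weightLattice P) (i : ι) : ℤ := (x.2 i).choose

theorem wt_spec (x : weightLattice P) (i : ι) : P.coroot' i (x : M) = (wt x i : ℝ) :=
  (x.2 i).choose_spec

variable (P)

/-- A root, as an element of the weight lattice. -/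
def rootWt [P.IsCrystallographic] (i : ι) : weightLattice P :=
  ⟨P.root i, fun j => by
    obtain ⟨n, hn⟩ := P.exists_value (S := ℤ) i j
    exact ⟨n, by rw [P.root_coroot'_eq_pairing, ← hn]; simp⟩⟩

theorem reflection_mem (i : ι) {x : M} (hx : x ∈ weightLattice P) :
    P.reflection i x ∈ weightLattice P := by
  intro j
  obtain ⟨n, hn⟩ := hx (P.reflectionPerm i j)
  refine ⟨n, ?_⟩
  rw [← hn, P.reflection_apply, map_sub, map_smul, P.root_coroot'_eq_pairing, smul_eq_mul]
  have h := congrArg (P.toLinearMap x) (P.reflectionPerm_coroot i j)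
  rw [map_sub, map_smul, smul_eq_mul, P.root_coroot_eq_pairing] at h
  change P.toLinearMap x (P.coroot j) - P.toLinearMap x (P.coroot i) * P.pairing i j =
    P.toLinearMap x (P.coroot (P.reflectionPerm i j))
  rw [← h, mul_comm]

theorem weyl_smul_mem (w : P.weylGroup) {x : M} (hx : x ∈ weightLattice P) :
    w • x ∈ weightLattice P := by
  obtain ⟨g, hg⟩ := w
  induction hg using RootPairing.weylGroup.induction generalizing x with
  | mem i => exact reflection_mem P i hx
  | one => exact hx
  | mul g₁ g₂ h₁ h₂ ih₁ ih₂ => exact ih₁ (ih₂ hx)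

/-- The action of the Weyl group on the weight lattice. -/
instance : DistribMulAction P.weylGroup (weightLattice P) where
  smul w x := ⟨w • (x : M), weyl_smul_mem P w x.2⟩
  one_smul x := Subtype.ext (one_smul _ (x : M))
  mul_smul w v x := Subtype.ext (mul_smul w v (x : M))
  smul_zero w := Subtype.ext (smul_zero w)
  smul_add w x y := Subtype.ext (smul_add w (x : M) (y : M))

@[simp]
theorem coe_weyl_smul (w : P.weylGroup) (x : weightLattice P) :
    ((w • x : weightLattice P) : M) = w • (x : M) := rfl

/-- The reflection `s_α` in the root with index `i`, as an element of the Weyl group. -/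
abbrev sRefl (i : ι) : P.weylGroup := RootPairing.weylGroup.ofIdx P i

theorem sRefl_smul [P.IsCrystallographic] (i : ι) (x : weightLattice P) :
    sRefl P i • x = x - wt x i • rootWt P i := by
  apply Subtype.ext
  change P.reflection i (x : M) = (x : M) - wt x i • P.root i
  rw [P.reflection_apply, wt_spec, Int.cast_smul_eq_zsmul]

/-- The Weyl group is finite. -/
instance [Finite ι] [P.IsRootSystem] : Finite P.weylGroup := by
  have h : Function.Injective (fun (w : P.weylGroup) (i : ι) => w • i) := by
    intro w v hwv
    apply Subtype.ext
    apply RootPairing.Equiv.weightHom_injective P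
    apply LinearEquiv.toLinearMap_injective
    refine LinearMap.ext_on (s := Set.range P.root)
      (RootPairing.IsRootSystem.span_root_eq_top (P := P)) ?_
    rintro _ ⟨i, rfl⟩
    have e : ∀ u : P.weylGroup, u • P.root i = P.root (u • i) :=
      fun u => P.weylGroup_apply_root u i
    change w • P.root i = v • P.root i
    rw [e, e, show w • i = v • i from congrFun hwv i]
  exact Finite.of_injective _ h

instance [Finite ι] [P.IsRootSystem] : Fintype P.weylGroup := Fintype.ofFinite _

end Lattice

section Length

variable {P : RootPairing ι ℝ M N} (b : P.Base)

/-- The length of `w`: the number of positive roots that `w` makes negative. -/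
def len (w : P.weylGroup) : ℕ := {i : ι | b.IsPos i ∧ ¬ b.IsPos (w • i)}.ncard

/-- The product of a word in the simple reflections. -/
def wordProd (l : List b.support) : P.weylGroup := (l.map fun i : b.support => sRefl P (i : ι)).prod

/-- The word `l` is a reduced word for `w`: its product is `w`, and no shorter word has
product `w`. -/
def IsReducedWord (w : P.weylGroup) (l : List b.support) : Prop :=
  wordProd b l = w ∧ ∀ l' : List b.support, wordProd b l' = w → l.length ≤ l'.length

theorem exists_reducedWord [Finite ι] [P.IsRootSystem] [P.IsCrystallographic] [P.IsReduced]
    (w : P.weylGroup) : ∃ l, IsReducedWord b w l := by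
  have hconj : ∀ i j : ι, sRefl P (P.reflectionPerm j i) = sRefl P j * sRefl P i * sRefl P j := by
    intro i j
    apply Subtype.ext
    apply RootPairing.Equiv.weightHom_injective P
    apply LinearEquiv.toLinearMap_injective
    ext x
    change P.reflection (P.reflectionPerm j i) x
      = P.reflection j (P.reflection i (P.reflection j x))
    rw [P.reflection_reflectionPerm]
    rfl
  have hsimple : ∀ i : ι, ∃ l, wordProd b l = sRefl P i := by
    intro i
    induction i using b.induction_reflect with
    | h₀ i hi =>
      obtain ⟨l, hl⟩ := hi
      refine ⟨l ++ l ++ l, ?_⟩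
      rw [hconj, ← hl]
      simp [wordProd, mul_assoc]
    | h₁ i hi => exact ⟨[⟨i, hi⟩], by simp [wordProd]⟩
    | h₂ i j hi hj =>
      obtain ⟨l, hl⟩ := hi
      refine ⟨[⟨j, hj⟩] ++ l ++ [⟨j, hj⟩], ?_⟩
      rw [hconj, ← hl]
      simp [wordProd, mul_assoc]
  have hw : ∃ l, wordProd b l = w := by
    obtain ⟨g, hg⟩ := w
    induction hg using RootPairing.weylGroup.induction with
    | mem i => exact hsimple i
    | one => exact ⟨[], rfl⟩
    | mul g₁ g₂ h₁ h₂ ih₁ ih₂ =>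
      obtain ⟨l₁, e₁⟩ := ih₁
      obtain ⟨l₂, e₂⟩ := ih₂
      refine ⟨l₁ ++ l₂, ?_⟩
      rw [wordProd, List.map_append, List.prod_append]
      rw [wordProd] at e₁ e₂
      rw [e₁, e₂]
      rfl
  obtain ⟨l, hl, hmin⟩ := exists_minimal_length hw
  exact ⟨l, hl, hmin⟩
where
  exists_minimal_length {p : List b.support → Prop} (h : ∃ l, p l) :
      ∃ l, p l ∧ ∀ l', p l' → l.length ≤ l'.length := by
    classical
    have h' : ∃ n, ∃ l, p l ∧ l.length = n := by
      obtain ⟨l, hl⟩ := h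
      exact ⟨_, l, hl, rfl⟩
    obtain ⟨l, hl, hn⟩ := Nat.find_spec h'
    exact ⟨l, hl, fun l' hl' => hn ▸ Nat.find_min' h' ⟨l', hl', rfl⟩⟩

/-- A chosen reduced word for `w`. -/
def redWord [Finite ι] [P.IsRootSystem] [P.IsCrystallographic] [P.IsReduced]
    (w : P.weylGroup) : List b.support :=
  (exists_reducedWord b w).choose

theorem redWord_spec [Finite ι] [P.IsRootSystem] [P.IsCrystallographic] [P.IsReduced]
    (w : P.weylGroup) : IsReducedWord b w (redWord b w) :=
  (exists_reducedWord b w).choose_spec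

/-- The set `P⁺` of dominant integral weights. -/
def dominant : Set (weightLattice P) := {x | ∀ i, b.IsPos i → 0 ≤ wt x i}

/-- The set `P⁺⁺` of strictly dominant integral weights. -/
def strictlyDominant : Set (weightLattice P) := {x | ∀ i, b.IsPos i → 0 < wt x i}

end Length

section GroupAlgebra

variable (P : RootPairing ι ℝ M N)

/-- The group algebra `𝕂[P]` of the weight lattice. -/
abbrev GroupAlg : Type _ := AddMonoidAlgebra K (weightLattice P)

/-- The action of a Weyl group element on `𝕂[P]`, determined by `w x^μ = x^(wμ)`. -/
def weylAct (w : P.weylGroup) : GroupAlg P →ₐ[K] GroupAlg P :=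
  AddMonoidAlgebra.mapDomainAlgHom K K (DistribSMul.toAddMonoidHom (weightLattice P) w)

variable {P} in
/-- The basis element `x^μ` of `𝕂[P]`. -/
abbrev xP (μ : weightLattice P) : GroupAlg P := AddMonoidAlgebra.single μ 1

theorem weylAct_xP (w : P.weylGroup) (μ : weightLattice P) :
    weylAct P w (xP μ) = xP (w • μ) := by
  simp [weylAct, xP]

/-- The symmetric functions `𝕂[P]^W`. -/
def symmFun : Submodule K (GroupAlg P) where
  carrier := {f | ∀ w, weylAct P w f = f}
  zero_mem' := fun w => map_zero _
  add_mem' := fun hf hg w => by rw [map_add, hf w, hg w]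
  smul_mem' := fun c f hf w => by rw [map_smul, hf w]

variable {P}

/-- The alternating functions `𝒜`. -/
def altFun (b : P.Base) : Submodule K (GroupAlg P) where
  carrier := {f | ∀ w, weylAct P w f = (-1 : K) ^ len b w • f}
  zero_mem' := fun w => by rw [map_zero, smul_zero]
  add_mem' := fun hf hg w => by rw [map_add, hf w, hg w, smul_add]
  smul_mem' := fun c f hf w => by rw [map_smul, hf w, smul_comm]

instance [Finite ι] [P.IsRootSystem] (μ : weightLattice P) :
    Finite (MulAction.orbit P.weylGroup μ) :=
  Set.finite_range fun w : P.weylGroup => w • μ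

/-- The orbit sum `m_μ`. -/
def mSym [Finite ι] [P.IsRootSystem] (μ : weightLattice P) : GroupAlg P :=
  ∑ γ ∈ (Set.toFinite (MulAction.orbit P.weylGroup μ)).toFinset, xP γ

/-- The alternating sum `a_μ`. -/
def aAlt [Finite ι] [P.IsRootSystem] (b : P.Base) (μ : weightLattice P) : GroupAlg P :=
  ∑ w : P.weylGroup, (-1 : K) ^ len b w • weylAct P w (xP μ)

end GroupAlgebra

section Hecke

variable {P : RootPairing ι ℝ M N} [P.IsCrystallographic]

/-- For a family `X` of vectors indexed by weights, the vector written
`(X^x - X^(s x)) / (1 - X^(-α))`, where `s` is the reflection in `α = αᵢ`. With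
`d = ⟨x, α^∨⟩` it is `∑_{0 ≤ j < d} X^(x - jα)` if `d ≥ 0`, and `-∑_{1 ≤ j ≤ -d} X^(x + jα)` if
`d < 0`; see `divDiff_spec`. -/
def divDiff {V : Type*} [AddCommGroup V] (X : weightLattice P → V) (i : ι)
    (x : weightLattice P) : V :=
  if 0 ≤ wt x i then ∑ j ∈ Finset.range (wt x i).toNat, X (x - j • rootWt P i)
  else - ∑ j ∈ Finset.range (-wt x i).toNat, X (x + (j + 1) • rootWt P i)

/-- In the group algebra, `divDiff` is the quotient of `x^λ - x^(s λ)` by `1 - x^(-α)`. -/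
theorem divDiff_spec (i : ι) (x : weightLattice P) :
    (1 - xP (-rootWt P i)) * divDiff xP i x = xP x - xP (sRefl P i • x) := by
  have hmul : ∀ y z : weightLattice P, xP y * xP z = xP (y + z) := by
    intro y z
    rw [xP, xP, xP, AddMonoidAlgebra.single_mul_single, one_mul]
  have key : ∀ (n : ℕ) (y : weightLattice P),
      (1 - xP (-rootWt P i)) * ∑ j ∈ Finset.range n, xP (y - j • rootWt P i)
        = xP y - xP (y - n • rootWt P i) := by
    intro n y
    induction n with
    | zero => simp
    | succ n ih =>
      rw [Finset.sum_range_succ, mul_add, ih, sub_mul, one_mul, hmul,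
        show -rootWt P i + (y - n • rootWt P i) = y - (n + 1) • rootWt P i by
          rw [succ_nsmul]; abel]
      abel
  have key' : ∀ (n : ℕ) (y : weightLattice P),
      (1 - xP (-rootWt P i)) * ∑ j ∈ Finset.range n, xP (y + (j + 1) • rootWt P i)
        = xP (y + n • rootWt P i) - xP y := by
    intro n y
    induction n with
    | zero => simp
    | succ n ih =>
      rw [Finset.sum_range_succ, mul_add, ih, sub_mul, one_mul, hmul,
        show -rootWt P i + (y + (n + 1) • rootWt P i) = y + n • rootWt P i by
          rw [succ_nsmul]; abel]
      abel
  rw [sRefl_smul]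
  by_cases h : 0 ≤ wt x i
  · rw [divDiff, if_pos h, key, ← natCast_zsmul, Int.toNat_of_nonneg h]
  · have h2 := key' (-wt x i).toNat x
    rw [← natCast_zsmul, Int.toNat_of_nonneg (by lia), neg_smul, ← sub_eq_add_neg] at h2
    have h3 : ∀ a c : GroupAlg P, a * -c = -(a * c) := fun a c => mul_neg a c
    rw [divDiff, if_neg h, h3, h2, neg_sub]

variable (b : P.Base)

/-- The free algebra on the generators `T_i` (one for each simple root) and `x^λ` (one for each
weight). -/
abbrev FreeAlg : Type _ := FreeAlgebra K (b.support ⊕ weightLattice P)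

/-- The free generator `T_i`. -/
abbrev freeT (i : b.support) : FreeAlg b := FreeAlgebra.ι K (Sum.inl i)

/-- The free generator `x^λ`. -/
abbrev freeX (x : weightLattice P) : FreeAlg b := FreeAlgebra.ι K (Sum.inr x)

/-- The defining relations of the affine Hecke algebra. In the braid relation `m_ij` is the order
of `s_i s_j`; equivalently, `π / m_ij` is the angle between the hyperplanes of `α_i`
and `α_j`. -/
inductive Rel : FreeAlg b → FreeAlg b → Prop
  | braid (i j : b.support) (h : i ≠ j) :
      Rel (altProd (orderOf (sRefl P (i : ι) * sRefl P (j : ι))) (freeT b i) (freeT b j))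
        (altProd (orderOf (sRefl P (i : ι) * sRefl P (j : ι))) (freeT b j) (freeT b i))
  | quadratic (i : b.support) :
      Rel (freeT b i * freeT b i) ((q 1 - q (-1)) • freeT b i + 1)
  | x_zero : Rel (freeX b 0) 1
  | x_add (x y : weightLattice P) : Rel (freeX b x * freeX b y) (freeX b (x + y))
  | bernstein (i : b.support) (x : weightLattice P) :
      Rel (freeX b x * freeT b i)
        (freeT b i * freeX b (sRefl P (i : ι) • x)
          + (q 1 - q (-1)) • divDiff (freeX b) (i : ι) x)

/-- The affine Hecke algebra `H̃` over `𝕂 = ℤ[q, q⁻¹]`. -/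
abbrev Hecke : Type _ := RingQuot (Rel b)

/-- The generator `T_i` of the affine Hecke algebra. -/
def Tgen (i : b.support) : Hecke b := RingQuot.mkAlgHom K (Rel b) (freeT b i)

/-- The generator `x^λ` of the affine Hecke algebra. -/
def Xgen (x : weightLattice P) : Hecke b := RingQuot.mkAlgHom K (Rel b) (freeX b x)

variable [Finite ι] [P.IsRootSystem]

/-- The element `T_w`, the product of the `T_i` along a reduced word for `w`. -/
def Tw [P.IsReduced] (w : P.weylGroup) : Hecke b := ((redWord b w).map (Tgen b)).prod

/-- The value `W_0(t) = ∑_w t ^ ℓ(w)` at `t = q ^ n`. -/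
def poincare (n : ℤ) : K := ∑ w : P.weylGroup, q n ^ len b w

/-- The ring `𝕂'` obtained by adjoining `W_0(q²)⁻¹` to `𝕂`. -/
abbrev K' : Type := Localization.Away (poincare b 2)

theorem exists_longest [P.IsReduced] :
    ∃ w : P.weylGroup, ∀ i, b.IsPos i → ¬ b.IsPos (w • i) := by
  let _ := P.indexNeg
  obtain ⟨w, hw⟩ := Finite.exists_max (len b)
  have hroot : ∀ (u : P.weylGroup) (i : ι), P.root (u • i) = u • P.root i :=
    fun u i => (P.weylGroup_apply_root u i).symm
  have hneg : ∀ (u : P.weylGroup) (i : ι), u • (-i) = -(u • i) := by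
    intro u i
    apply P.root.injective
    rw [hroot, RootPairing.indexNeg_neg, RootPairing.indexNeg_neg, P.root_reflectionPerm,
      P.root_reflectionPerm, P.reflection_apply_self, P.reflection_apply_self, hroot, smul_neg]
  have hs : ∀ i ∈ b.support, ¬ b.IsPos (w • i) := by
    intro i hi hwi
    have hipos := b.isPos_of_mem_support hi
    have hsi : sRefl P i • i = -i := rfl
    have hss : ∀ j, sRefl P i • sRefl P i • j = j := fun j => P.reflectionPerm_self i j
    refine absurd (hw (w * sRefl P i)) (not_le.mpr ?_)
    unfold len
    have hfin : {j : ι | b.IsPos j ∧ ¬ b.IsPos ((w * sRefl P i) • j)}.Finite := Set.toFinite _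
    have hinj : Function.Injective (fun j : ι => sRefl P i • j) := MulAction.injective _
    rw [← Set.ncard_image_of_injective _ hinj]
    apply Set.ncard_lt_ncard _ hfin
    refine ⟨?_, fun hsub => ?_⟩
    · rintro _ ⟨j, ⟨hj, hwj⟩, rfl⟩
      have hji : j ≠ i := by rintro rfl; exact hwj hwi
      refine ⟨hj.reflectionPerm hi hji, ?_⟩
      change ¬ b.IsPos ((w * sRefl P i) • sRefl P i • j)
      rwa [mul_smul, hss]
    · obtain ⟨j, ⟨hj, -⟩, hji⟩ := hsub (show i ∈ _ from ⟨hipos, by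
        rw [mul_smul, hsi, hneg, RootPairing.Base.IsPos.neg_iff_not]
        exact not_not.mpr hwi⟩)
      have : j = -i := by
        have h : sRefl P i • j = i := hji
        have h' := hss j
        rw [h, hsi] at h'
        exact h'.symm
      rw [this, RootPairing.Base.IsPos.neg_iff_not] at hj
      exact hj hipos
  refine ⟨w, fun i hi => ?_⟩
  refine RootPairing.Base.IsPos.induction_on_add (p := fun i => ¬ b.IsPos (w • i)) hi hs ?_
  · intro i j k hk hi hj
    have h1 := hs j hj
    have h2 : P.root (w • k) = P.root (w • i) + P.root (w • j) := by
      rw [hroot, hroot, hroot, hk, smul_add]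
    rw [RootPairing.Base.isPos_iff'] at *
    rw [b.height_add h2]
    lia

theorem isUnit_poincare_neg_two [P.IsReduced] :
    IsUnit (algebraMap K (K' b) (poincare b (-2))) := by
  let _ := P.indexNeg
  obtain ⟨w, hw⟩ := exists_longest b
  have hneg : ∀ i, ¬ b.IsPos i → b.IsPos (w • i) := by
    intro i hi
    have hroot : ∀ j : ι, P.root (w • j) = w • P.root j :=
      fun j => (P.weylGroup_apply_root w j).symm
    have h := hw (-i) ((RootPairing.Base.IsPos.neg_iff_not b i).mpr hi)
    have e : w • (-i) = -(w • i) := by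
      apply P.root.injective
      rw [hroot, RootPairing.indexNeg_neg, RootPairing.indexNeg_neg, P.root_reflectionPerm,
      P.root_reflectionPerm, P.reflection_apply_self, P.reflection_apply_self, hroot, smul_neg]
    rw [e, RootPairing.Base.IsPos.neg_iff_not, not_not] at h
    exact h
  have hlen : ∀ v : P.weylGroup, len b (w * v) + len b v = {i : ι | b.IsPos i}.ncard := by
    intro v
    unfold len
    rw [← Set.ncard_union_eq _ (Set.toFinite _) (Set.toFinite _)]
    · congr 1
      ext i
      simp only [Set.mem_union, Set.mem_ofPred_eq, mul_smul]
      have h1 := hw (v • i)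
      have h2 := hneg (v • i)
      tauto
    · rw [Set.disjoint_left]
      rintro i ⟨-, h1⟩ ⟨-, h2⟩
      rw [mul_smul] at h1
      exact h1 (hneg _ h2)
  have key : q (2 * {i : ι | b.IsPos i}.ncard) * poincare b (-2) = poincare b 2 := by
    unfold poincare
    rw [Finset.mul_sum, ← Equiv.sum_comp (Equiv.mulLeft w)]
    refine Finset.sum_congr rfl fun v _ => ?_
    rw [Equiv.coe_mulLeft, q, q, q, LaurentPolynomial.T_pow, LaurentPolynomial.T_pow,
      ← LaurentPolynomial.T_add, ← hlen v]
    congr 1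
    push_cast
    ring
  have h : IsUnit (algebraMap K (K' b) (poincare b 2)) :=
    IsLocalization.Away.algebraMap_isUnit _
  have h' := congrArg (algebraMap K (K' b)) key
  rw [map_mul] at h'
  exact isUnit_of_mul_isUnit_right (h' ▸ h : IsUnit (_ * _))

/-- The affine Hecke algebra with scalars extended to `𝕂'`. -/
abbrev Hecke' : Type _ := K' b ⊗[K] Hecke b

/-- The image in the extended algebra of an element of the affine Hecke algebra. -/
abbrev incl : Hecke b →ₐ[K] Hecke' b := Algebra.TensorProduct.includeRight

variable [P.IsReduced]

/-- The idempotent `𝟏₀ = W_0(q²)⁻¹ ∑_w q^ℓ(w) T_w`. -/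
def one₀ : Hecke' b :=
  Ring.inverse (algebraMap K (K' b) (poincare b 2)) •
    incl b (∑ w : P.weylGroup, q (len b w) • Tw b w)

/-- The idempotent `ε₀ = W_0(q⁻²)⁻¹ ∑_w (-q)^(-ℓ(w)) T_w`. The inverse exists in `𝕂'`: see
`isUnit_poincare_neg_two`. -/
def eps₀ : Hecke' b :=
  Ring.inverse (algebraMap K (K' b) (poincare b (-2))) •
    incl b (∑ w : P.weylGroup, ((-1 : K) ^ len b w * q (-len b w)) • Tw b w)

/-- The element `M_μ = 𝟏₀ x^μ 𝟏₀`. -/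
def MHecke (μ : weightLattice P) : Hecke' b := one₀ b * incl b (Xgen b μ) * one₀ b

/-- The element `A_μ = ε₀ x^μ 𝟏₀`. -/
def AHecke (μ : weightLattice P) : Hecke' b := eps₀ b * incl b (Xgen b μ) * one₀ b

/-- The `𝕂`-module `e H̃ f`, that is, the set of all `e h f` with `h` in the affine Hecke algebra
over `𝕂`. -/
def sandwich (e f : Hecke' b) : Submodule K (Hecke' b) :=
  LinearMap.range ((LinearMap.mulLeftRight K (e, f)).comp (incl b).toLinearMap)

/-- The `𝕂'`-module of all `e h f` with `h` in the affine Hecke algebra over `𝕂'`. -/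
def sandwich' (e f : Hecke' b) : Submodule (K' b) (Hecke' b) :=
  LinearMap.range (LinearMap.mulLeftRight (K' b) (e, f))

end Hecke

end

end AffineHecke

/-! Symmetric and alternating functions are determined by their coefficients at dominant weights:
each `W`-orbit in `P` contains exactly one dominant weight, and strictly dominant weights have
trivial stabilizer. An alternating function has coefficient zero at a dominant weight on a wall,
because a simple reflection fixes the weight and negates the coefficient.

For the Hecke algebra, spanning comes from straightening. Since `T_i 𝟏₀ = q 𝟏₀`, the Bernstein
relation shows that the span of the `x^μ 𝟏₀` is stable under `H̃`. Let `e` be `𝟏₀` or `ε₀`, so `e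
T_i = r e` with `r = q` or `r = -q⁻¹`, and put `E_μ = e x^μ 𝟏₀`. Sandwiching the Bernstein relation
between `e` and `𝟏₀` expresses `q E_μ` as `r E_(s_i μ)` plus `q - q⁻¹` times a sum over a root
string. As `r` is a unit of `𝕂`, `mem_of_straightening` reduces every `E_μ` to dominant ones:
interior points of the string are shorter, and reflecting lowers the number of positive roots that
pair negatively. For `ε₀` and `μ` on a wall the relation says `(1 + q²) A_μ = 0`, and `1 + q²`
divides the invertible `W_0(q²)`.

Independence comes from the polynomial representation on `𝕂[P]` by Demazure-Lusztig operators. There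
`T_w · 1 = q^ℓ(w)`, so multiplying `h x^μ` on the right by the symmetrizer and applying the result
to `1` gives `W_0(q²) (h · x^μ)`. Take `h` to be the symmetrizer or the antisymmetrizer and consider
the coefficients of `x^ν` in `h · x^μ`. At `q = 1` the element `T_w` acts as `w`, so this matrix
becomes diagonal on dominant (respectively strictly dominant) weights, with nonzero diagonal. Its
finite principal minors are therefore nonzero, which gives independence over `𝕂'` and hence over
`𝕂`.

Two supports remain. The eigenvalue relations of the symmetrizers need `T_w` to be independent of
the reduced word (`prod_map_eq_of_isReducedWord`). The representation needs the braid relations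
(`dlOp_braid`): over the fraction field `T_i + q⁻¹` is `f ↦ c f + s(c f)`, and in each rank two case
the Kazhdan-Lusztig product of full length in two such operators is symmetric in them. In the
non-commuting cases this is because it sends `f` to the sum over the dihedral group of the
translates of `(∏ c) f`. The terms below the longest alternating product are symmetric too, so the
braid relation follows. -/

namespace AffineHecke

open scoped TensorProduct

noncomputable section

set_option linter.unusedSectionVars false

/-! ### Weyl group combinatorics: length, exchange, rank two parabolic subgroups. -/

section WeylCombinatorics

variable {ι M N : Type*} [AddCommGroup M] [Module ℝ M] [AddCommGroup N] [Module ℝ N]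
variable {P : RootPairing ι ℝ M N}

variable (P) in
/-- The index of the negative of the root with index `k`. -/
def negRoot (k : ι) : ι := P.reflectionPerm k k

theorem root_weyl_smul (w : P.weylGroup) (k : ι) : P.root (w • k) = w • P.root k :=
  (P.weylGroup_apply_root w k).symm

theorem weyl_smul_add (w : P.weylGroup) (x y : M) : w • (x + y) = w • x + w • y :=
  smul_add w x y

theorem weyl_smul_smul (w : P.weylGroup) (c : ℝ) (x : M) : w • (c • x) = c • w • x :=
  ((RootPairing.Equiv.weightHom P w.1 : M →ₗ[ℝ] M)).map_smul c x

theorem root_neg (k : ι) : P.root (negRoot P k) = -P.root k := by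
  rw [negRoot, P.root_reflectionPerm, P.reflection_apply_self]

theorem negRoot_negRoot (k : ι) : negRoot P (negRoot P k) = k := by
  apply P.root.injective
  rw [root_neg, root_neg, neg_neg]

theorem weyl_smul_neg (w : P.weylGroup) (k : ι) : w • negRoot P k = negRoot P (w • k) := by
  apply P.root.injective
  rw [root_weyl_smul, root_neg, root_neg, root_weyl_smul, smul_neg]

theorem sRefl_smul_self (k : ι) : sRefl P k • k = negRoot P k := rfl

theorem sRefl_smul_root (i : ι) (x : M) :
    sRefl P i • x = x - P.coroot' i x • P.root i := by
  change P.reflection i x = _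
  rw [P.reflection_apply]

theorem weyl_ext {w v : P.weylGroup} (h : ∀ x : M, w • x = v • x) : w = v := by
  apply Subtype.ext
  apply RootPairing.Equiv.weightHom_injective P
  apply LinearEquiv.toLinearMap_injective
  exact LinearMap.ext h

theorem sRefl_mul_self (i : ι) : sRefl P i * sRefl P i = 1 := by
  apply weyl_ext
  intro x
  change P.reflection i (P.reflection i x) = x
  simp

theorem sRefl_smul_sRefl_smul (i k : ι) : sRefl P i • sRefl P i • k = k := by
  rw [← mul_smul, sRefl_mul_self, one_smul]

theorem sRefl_inv (i : ι) : (sRefl P i)⁻¹ = sRefl P i :=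
  inv_eq_of_mul_eq_one_left (sRefl_mul_self i)

theorem sRefl_weyl_smul (w : P.weylGroup) (i : ι) :
    sRefl P (w • i) = w * sRefl P i * w⁻¹ := by
  have hconj : ∀ i j : ι, sRefl P (sRefl P j • i) = sRefl P j * sRefl P i * sRefl P j := by
    intro i j
    apply weyl_ext
    intro x
    change P.reflection (P.reflectionPerm j i) x
      = P.reflection j (P.reflection i (P.reflection j x))
    rw [P.reflection_reflectionPerm]
    rfl
  obtain ⟨g, hg⟩ := w
  induction hg using RootPairing.weylGroup.induction generalizing i with
  | mem j =>
    change sRefl P (sRefl P j • i) = sRefl P j * sRefl P i * (sRefl P j)⁻¹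
    rw [sRefl_inv, hconj]
  | one => simp [show (⟨1, one_mem _⟩ : P.weylGroup) = 1 from rfl]
  | mul g₁ g₂ h₁ h₂ ih₁ ih₂ =>
    rw [show (⟨g₁ * g₂, mul_mem h₁ h₂⟩ : P.weylGroup) = ⟨g₁, h₁⟩ * ⟨g₂, h₂⟩ from rfl,
      mul_smul, ih₁, ih₂]
    group

variable [Finite ι] [P.IsRootSystem] [P.IsCrystallographic] [P.IsReduced] (b : P.Base)

theorem isPos_neg_iff (k : ι) : b.IsPos (negRoot P k) ↔ ¬ b.IsPos k :=
  letI := P.indexNeg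
  RootPairing.Base.IsPos.neg_iff_not b k

variable {b} in
theorem isPos_sRefl_smul {i k : ι} (hi : i ∈ b.support) (hk : b.IsPos k) (hki : k ≠ i) :
    b.IsPos (sRefl P i • k) :=
  hk.reflectionPerm hi hki

variable {b} in
theorem eq_of_isPos_of_not_isPos_sRefl_smul {i k : ι} (hi : i ∈ b.support) (hk : b.IsPos k)
    (h : ¬ b.IsPos (sRefl P i • k)) : k = i :=
  of_not_not fun hki => h (isPos_sRefl_smul hi hk hki)

/-- The map `α ↦ -wα` is a bijection from the inversions of `w` to those of `w⁻¹`. -/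
theorem len_inv (w : P.weylGroup) : len b w⁻¹ = len b w := by
  unfold len
  refine (Set.ncard_congr (fun k _ => negRoot P (w • k)) ?_ ?_ ?_).symm
  · rintro k ⟨h1, h2⟩
    refine ⟨(isPos_neg_iff b _).2 h2, ?_⟩
    rw [weyl_smul_neg, isPos_neg_iff, not_not, inv_smul_smul]
    exact h1
  · rintro k l - - h
    have := congrArg (negRoot P) h
    rw [negRoot_negRoot, negRoot_negRoot] at this
    exact MulAction.injective w this
  · rintro k ⟨h1, h2⟩
    refine ⟨negRoot P (w⁻¹ • k), ⟨(isPos_neg_iff b _).2 h2, ?_⟩, ?_⟩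
    · rw [weyl_smul_neg, isPos_neg_iff, not_not, smul_inv_smul]
      exact h1
    · rw [weyl_smul_neg, smul_inv_smul, negRoot_negRoot]

theorem len_one : len b (1 : P.weylGroup) = 0 := by
  unfold len
  convert Set.ncard_empty ι
  ext k
  simp

variable {b}

/-- `s_i` permutes the positive roots other than `α_i`, so the inversions of `w s_i` are the
`s_i`-images of those of `w`, together with `α_i`. -/
theorem len_mul_sRefl_of_isPos {w : P.weylGroup} {i : ι} (hi : i ∈ b.support)
    (h : b.IsPos (w • i)) : len b (w * sRefl P i) = len b w + 1 := by
  unfold len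
  have hinj : Function.Injective (fun j : ι => sRefl P i • j) := MulAction.injective _
  have hpos := b.isPos_of_mem_support hi
  have key : {k : ι | b.IsPos k ∧ ¬ b.IsPos ((w * sRefl P i) • k)} =
      insert i ((fun j : ι => sRefl P i • j) '' {k : ι | b.IsPos k ∧ ¬ b.IsPos (w • k)}) := by
    ext k
    simp only [Set.mem_ofPred_eq, Set.mem_insert_iff, Set.mem_image]
    constructor
    · rintro ⟨h1, h2⟩
      by_cases hk : k = i
      · exact Or.inl hk
      · exact Or.inr ⟨sRefl P i • k, ⟨isPos_sRefl_smul hi h1 hk, by rwa [← mul_smul]⟩,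
          sRefl_smul_sRefl_smul i k⟩
    · rintro (rfl | ⟨l, ⟨h1, h2⟩, rfl⟩)
      · refine ⟨hpos, ?_⟩
        rw [mul_smul, sRefl_smul_self, weyl_smul_neg, isPos_neg_iff, not_not]
        exact h
      · refine ⟨isPos_sRefl_smul hi h1 (fun e => h2 (e ▸ h)), ?_⟩
        rwa [mul_smul, sRefl_smul_sRefl_smul]
  rw [key, Set.ncard_insert_of_notMem _ (Set.toFinite _), Set.ncard_image_of_injective _ hinj]
  rintro ⟨l, ⟨h1, h2⟩, hl⟩
  have : l = negRoot P i := by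
    rw [← sRefl_smul_sRefl_smul (P := P) i l, show sRefl P i • l = i from hl, sRefl_smul_self]
  rw [this, isPos_neg_iff] at h1
  exact h1 hpos

theorem len_mul_sRefl_of_not_isPos {w : P.weylGroup} {i : ι} (hi : i ∈ b.support)
    (h : ¬ b.IsPos (w • i)) : len b (w * sRefl P i) + 1 = len b w := by
  have h' : b.IsPos ((w * sRefl P i) • i) := by
    rw [mul_smul, sRefl_smul_self, weyl_smul_neg, isPos_neg_iff]
    exact h
  have := len_mul_sRefl_of_isPos hi h'
  rw [mul_assoc, sRefl_mul_self, mul_one] at this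
  exact this.symm

theorem len_sRefl_mul_of_isPos {w : P.weylGroup} {i : ι} (hi : i ∈ b.support)
    (h : b.IsPos (w⁻¹ • i)) : len b (sRefl P i * w) = len b w + 1 := by
  rw [← len_inv, mul_inv_rev, sRefl_inv, len_mul_sRefl_of_isPos hi h, len_inv]

theorem len_sRefl_mul_of_not_isPos {w : P.weylGroup} {i : ι} (hi : i ∈ b.support)
    (h : ¬ b.IsPos (w⁻¹ • i)) : len b (sRefl P i * w) + 1 = len b w := by
  rw [← len_inv, mul_inv_rev, sRefl_inv, len_mul_sRefl_of_not_isPos hi h, len_inv]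

theorem neg_one_pow_len_mul_sRefl {A : Type*} [CommRing A] (w : P.weylGroup) {i : ι}
    (hi : i ∈ b.support) : (-1 : A) ^ len b (w * sRefl P i) = -(-1) ^ len b w := by
  by_cases h : b.IsPos (w • i)
  · rw [len_mul_sRefl_of_isPos hi h, pow_succ]; ring
  · rw [← len_mul_sRefl_of_not_isPos hi h, pow_succ]; ring

variable (b) in
theorem wordProd_cons (i : b.support) (l : List b.support) :
    wordProd b (i :: l) = sRefl P (i : ι) * wordProd b l := by simp [wordProd]

variable (b) in
theorem wordProd_nil : wordProd b [] = 1 := rfl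

variable (b) in
theorem wordProd_append (l l' : List b.support) :
    wordProd b (l ++ l') = wordProd b l * wordProd b l' := by simp [wordProd]

variable (b) in
theorem len_wordProd_le (l : List b.support) : len b (wordProd b l) ≤ l.length := by
  induction l with
  | nil => simp [wordProd_nil, len_one]
  | cons i l ih =>
    rw [wordProd_cons, List.length_cons]
    by_cases h : b.IsPos ((wordProd b l)⁻¹ • (i : ι))
    · rw [len_sRefl_mul_of_isPos i.2 h]; lia
    · have := len_sRefl_mul_of_not_isPos i.2 h; lia

/-- The exchange property. -/
theorem exists_wordProd_mul_sRefl (l : List b.support) (i : b.support)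
    (h : ¬ b.IsPos (wordProd b l • (i : ι))) :
    ∃ l' : List b.support, l'.length + 1 = l.length ∧
      wordProd b l' = wordProd b l * sRefl P (i : ι) := by
  induction l with
  | nil =>
    rw [wordProd_nil, one_smul] at h
    exact absurd (b.isPos_of_mem_support i.2) h
  | cons j l ih =>
    by_cases h' : b.IsPos (wordProd b l • (i : ι))
    · rw [wordProd_cons, mul_smul] at h
      -- `s_j` turns a positive root negative, so that root is `α_j`; conjugation then carries `s_i`
      -- to the front of the word, where it cancels `s_j`.
      have e := eq_of_isPos_of_not_isPos_sRefl_smul j.2 h' h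
      refine ⟨l, rfl, ?_⟩
      rw [wordProd_cons, ← e, sRefl_weyl_smul]
      simp [mul_assoc, sRefl_mul_self]
    · obtain ⟨l', h1, h2⟩ := ih h'
      exact ⟨j :: l', by simp [h1], by rw [wordProd_cons, wordProd_cons, h2, mul_assoc]⟩

/-- If appending the last letter did not raise the length, the exchange property would produce a
shorter word. -/
theorem IsReducedWord.length_eq {w : P.weylGroup} {l : List b.support}
    (h : IsReducedWord b w l) : l.length = len b w := by
  induction l using List.reverseRecOn generalizing w with
  | nil => rw [← h.1, wordProd_nil, len_one]; rfl
  | append_singleton l i ih =>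
    obtain ⟨rfl, hmin⟩ := h
    have hl : IsReducedWord b (wordProd b l) l := by
      refine ⟨rfl, fun l' hl' => ?_⟩
      have := hmin (l' ++ [i]) (by rw [wordProd_append, wordProd_append, hl'])
      simpa using this
    have hpos : b.IsPos (wordProd b l • (i : ι)) := by
      by_contra hneg
      obtain ⟨l', h1, h2⟩ := exists_wordProd_mul_sRefl l i hneg
      have := hmin l' (by rw [h2, wordProd_append]; simp [wordProd])
      rw [List.length_append] at this
      simp only [List.length_singleton] at this
      lia
    rw [wordProd_append, show wordProd b [i] = sRefl P (i : ι) by simp [wordProd],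
      len_mul_sRefl_of_isPos i.2 hpos, List.length_append, ih hl]
    rfl

theorem isReducedWord_iff {w : P.weylGroup} {l : List b.support} :
    IsReducedWord b w l ↔ wordProd b l = w ∧ l.length = len b w := by
  refine ⟨fun h => ⟨h.1, h.length_eq⟩, fun ⟨h1, h2⟩ => ⟨h1, fun l' hl' => ?_⟩⟩
  rw [h2, ← hl']
  exact len_wordProd_le b l'

theorem eq_one_of_len_eq_zero {w : P.weylGroup} (h : len b w = 0) : w = 1 := by
  have h1 := redWord_spec b w
  have h2 := h1.length_eq
  rw [h, List.length_eq_zero_iff] at h2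
  rw [← h1.1, h2, wordProd_nil]

theorem len_sRefl {i : ι} (hi : i ∈ b.support) : len b (sRefl P i) = 1 := by
  have := len_mul_sRefl_of_isPos (w := 1) hi (by rw [one_smul]; exact b.isPos_of_mem_support hi)
  rwa [one_mul, len_one] at this

variable (b) in
theorem weyl_induction {p : P.weylGroup → Prop} (one : p 1)
    (mul : ∀ i ∈ b.support, ∀ w, p w → p (sRefl P i * w)) (w : P.weylGroup) : p w := by
  rw [← (redWord_spec b w).1]
  induction redWord b w with
  | nil => exact one
  | cons i l ih => rw [wordProd_cons]; exact mul i i.2 _ ih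

variable (b) in
/-- The sum of the coordinates with respect to the simple roots. -/
def heightFun : M →ₗ[ℝ] ℝ := b.toWeightBasis.constr ℝ (fun _ => (1 : ℝ))

theorem heightFun_root_simple (i : b.support) : heightFun b (P.root i) = 1 := by
  rw [← b.toWeightBasis_apply, heightFun, Module.Basis.constr_basis]

theorem heightFun_root (k : ι) : heightFun b (P.root k) = b.height k := by
  obtain ⟨f, -, -, hf⟩ := b.exists_root_eq_sum_int k
  rw [b.height_eq_sum hf, hf, map_sum]
  push_cast
  refine Finset.sum_congr rfl fun j hj => ?_
  rw [map_zsmul, heightFun_root_simple ⟨j, hj⟩]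
  simp

theorem isPos_iff_heightFun {k : ι} : b.IsPos k ↔ 0 < heightFun b (P.root k) := by
  rw [heightFun_root, RootPairing.Base.isPos_iff]
  simp

theorem IsPos.repr_nonneg {k : ι} (h : b.IsPos k) (i : b.support) :
    0 ≤ b.toWeightBasis.repr (P.root k) i := by
  obtain ⟨f, -, hf⟩ := b.exists_root_eq_sum_nat_or_neg k
  have e : ∀ g : ι → ℕ, b.toWeightBasis.repr (∑ j ∈ b.support, g j • P.root j) i = g i := by
    intro g
    rw [← Finset.sum_coe_sort, map_sum, Finsupp.finsetSum_apply, Finset.sum_eq_single i]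
    · rw [map_nsmul, b.toWeightBasis_repr_root]; simp
    · intro j _ hj
      rw [map_nsmul, b.toWeightBasis_repr_root]; simp [hj]
    · simp
  rcases hf with hf | hf
  · rw [hf, e]; positivity
  · exfalso
    rw [isPos_iff_heightFun, hf, map_neg, map_sum] at h
    have : 0 ≤ ∑ j ∈ b.support, heightFun b (f j • P.root j) := by
      refine Finset.sum_nonneg fun j hj => ?_
      rw [map_nsmul, heightFun_root_simple ⟨j, hj⟩]
      positivity
    linarith

theorem exists_nonneg_of_mem_span_pair {i j : b.support} (hij : i ≠ j) {k : ι} (hk : b.IsPos k)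
    (h : P.root k ∈ Submodule.span ℝ {P.root (i : ι), P.root (j : ι)}) :
    ∃ c d : ℝ, 0 ≤ c ∧ 0 ≤ d ∧ P.root k = c • P.root (i : ι) + d • P.root (j : ι) := by
  obtain ⟨c, d, hcd⟩ := Submodule.mem_span_pair.1 h
  refine ⟨c, d, ?_, ?_, hcd.symm⟩
  · have := IsPos.repr_nonneg hk i
    rw [← hcd, map_add, map_smul, map_smul, b.toWeightBasis_repr_root,
      b.toWeightBasis_repr_root] at this
    simpa [hij] using this
  · have := IsPos.repr_nonneg hk j
    rw [← hcd, map_add, map_smul, map_smul, b.toWeightBasis_repr_root,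
      b.toWeightBasis_repr_root] at this
    simpa [hij, hij.symm] using this

theorem isPos_smul_of_mem_span_pair {i j : b.support} (hij : i ≠ j) {k : ι} (hk : b.IsPos k)
    (h : P.root k ∈ Submodule.span ℝ {P.root (i : ι), P.root (j : ι)}) {y : P.weylGroup}
    (hi : b.IsPos (y • (i : ι))) (hj : b.IsPos (y • (j : ι))) : b.IsPos (y • k) := by
  obtain ⟨c, d, hc, hd, e⟩ := exists_nonneg_of_mem_span_pair hij hk h
  rw [isPos_iff_heightFun] at *
  rw [root_weyl_smul] at hi hj ⊢
  rw [e, weyl_smul_add, weyl_smul_smul, weyl_smul_smul, map_add, LinearMap.map_smul, LinearMap.map_smul]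
  rw [e, map_add, map_smul, map_smul, heightFun_root_simple, heightFun_root_simple] at hk
  simp only [smul_eq_mul, mul_one] at hk ⊢
  rcases hc.eq_or_lt with rfl | hc
  · have : 0 < d := by linarith
    simp only [zero_mul, zero_add]
    positivity
  · positivity

/-- A simple reflection changes the sign of no root but its own and its negative, so the dihedral
subgroup changes signs only inside the plane of the two simple roots. -/
theorem closure_pair_smul {i j : b.support} {x : P.weylGroup}
    (hx : x ∈ Subgroup.closure {sRefl P (i : ι), sRefl P (j : ι)}) (k : ι) :
    (P.root (x • k) ∈ Submodule.span ℝ {P.root (i : ι), P.root (j : ι)} ↔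
      P.root k ∈ Submodule.span ℝ {P.root (i : ι), P.root (j : ι)}) ∧
    (P.root k ∉ Submodule.span ℝ {P.root (i : ι), P.root (j : ι)} →
      (b.IsPos (x • k) ↔ b.IsPos k)) := by
  set S := Submodule.span ℝ {P.root (i : ι), P.root (j : ι)} with hS
  induction hx using Subgroup.closure_induction generalizing k with
  | mem y hy =>
    have key : ∀ l : b.support, P.root (l : ι) ∈ S →
        (P.root (sRefl P (l : ι) • k) ∈ S ↔ P.root k ∈ S) ∧
        (P.root k ∉ S → (b.IsPos (sRefl P (l : ι) • k) ↔ b.IsPos k)) := by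
      intro l hl
      refine ⟨?_, fun hk => ⟨fun h => ?_, fun h => isPos_sRefl_smul l.2 h ?_⟩⟩
      · rw [root_weyl_smul, sRefl_smul_root]
        exact S.sub_mem_iff_left (S.smul_mem _ hl)
      · by_contra hneg
        rw [← isPos_neg_iff] at hneg
        have := isPos_sRefl_smul l.2 hneg (fun e => hk (by
          rw [← negRoot_negRoot (P := P) k, e, root_neg]; exact S.neg_mem hl))
        rw [weyl_smul_neg, isPos_neg_iff] at this
        exact this h
      · rintro rfl
        exact hk hl
    rcases hy with rfl | rfl
    · exact key i (Submodule.subset_span (by simp))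
    · exact key j (Submodule.subset_span (by simp))
  | one => simp
  | mul y z _ _ ihy ihz =>
    rw [mul_smul]
    refine ⟨(ihy _).1.trans (ihz _).1, fun h => ?_⟩
    rw [(ihy (z • k)).2 (mt (ihz k).1.1 h), (ihz k).2 h]
  | inv y _ ih =>
    have h := ih (y⁻¹ • k)
    rw [smul_inv_smul] at h
    exact ⟨h.1.symm, fun hk => (h.2 (mt h.1.2 hk)).symm⟩

/-- Minimal coset representatives for a rank two parabolic subgroup are unique. -/
theorem minimal_coset_unique {i j : b.support} (hij : i ≠ j) {x u : P.weylGroup}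
    (hx : x ∈ Subgroup.closure {sRefl P (i : ι), sRefl P (j : ι)})
    (hui : b.IsPos (u⁻¹ • (i : ι))) (huj : b.IsPos (u⁻¹ • (j : ι)))
    (hxi : b.IsPos ((x * u)⁻¹ • (i : ι))) (hxj : b.IsPos ((x * u)⁻¹ • (j : ι))) : x = 1 := by
  by_contra hne
  have hx' := Subgroup.inv_mem _ hx
  -- If `x⁻¹` made `α_l` negative, then `-x⁻¹α_l` would be a positive root in the plane, which `u⁻¹`
  -- keeps positive; this contradicts the positivity of `(xu)⁻¹α_l`.
  have key : ∀ l : b.support, P.root (l : ι) ∈ Submodule.span ℝ {P.root (i : ι), P.root (j : ι)} →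
      b.IsPos ((x * u)⁻¹ • (l : ι)) → b.IsPos (x⁻¹ • (l : ι)) := by
    intro l hl h
    by_contra hneg
    rw [← isPos_neg_iff] at hneg
    have := isPos_smul_of_mem_span_pair hij hneg (by
      rw [root_neg]
      exact Submodule.neg_mem _ ((closure_pair_smul hx' l).1.2 hl)) hui huj
    rw [weyl_smul_neg, isPos_neg_iff, ← mul_smul, ← mul_inv_rev] at this
    exact this h
  have hi := key i (Submodule.subset_span (by simp)) hxi
  have hj := key j (Submodule.subset_span (by simp)) hxj
  apply hne
  rw [← inv_eq_one]
  apply eq_one_of_len_eq_zero (b := b)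
  unfold len
  rw [Set.ncard_eq_zero (Set.toFinite _), Set.eq_empty_iff_forall_notMem]
  rintro k ⟨h1, h2⟩
  by_cases hk : P.root k ∈ Submodule.span ℝ {P.root (i : ι), P.root (j : ι)}
  · exact h2 (isPos_smul_of_mem_span_pair hij h1 hk hi hj)
  · exact h2 (((closure_pair_smul hx' k).2 hk).2 h1)

/-! ### Alternating products and Matsumoto's theorem. -/

section AltProd

variable {A : Type*} [Monoid A]

theorem altProd_two_mul (n : ℕ) (x y : A) : altProd (2 * n) x y = (x * y) ^ n := by
  induction n with
  | zero => simp [altProd]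
  | succ n ih => rw [mul_add_one, altProd, altProd, ih, pow_succ', mul_assoc]

theorem altProd_add (m n : ℕ) (x y : A) : altProd (m + n) x y =
    altProd m x y * if Even m then altProd n x y else altProd n y x := by
  induction m generalizing x y with
  | zero => simp [altProd]
  | succ m ih =>
    rw [add_right_comm, altProd, ih, altProd, mul_assoc]
    simp only [Nat.even_add_one]
    split_ifs <;> simp_all

theorem altProd_mul_comm {m : ℕ} {x y : A} (h : altProd m x y = altProd m y x) (k : ℕ) :
    altProd (m * k) x y = altProd (m * k) y x := by
  induction k with
  | zero => rfl
  | succ k ih => rw [mul_add_one, add_comm, altProd_add, altProd_add, h, ih]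

theorem map_altProd {B F : Type*} [Monoid B] [FunLike F A B] [MonoidHomClass F A B] (f : F)
    (n : ℕ) (x y : A) : f (altProd n x y) = altProd n (f x) (f y) := by
  induction n generalizing x y with
  | zero => exact map_one f
  | succ n ih => rw [altProd, altProd, map_mul, ih]

/-- An alternating product of involutions is inverted by reading it backwards; the parity of `n`
decides which letter comes last. -/
theorem mul_pow_eq_one_of_altProd_comm {G : Type*} [Group G] {x y : G} (hx : x * x = 1)
    (hy : y * y = 1) {n : ℕ} (h : altProd n x y = altProd n y x) : (x * y) ^ n = 1 := by
  have inv : ∀ (n : ℕ) (x y : G), x * x = 1 → y * y = 1 →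
      altProd n x y * (if Even n then altProd n y x else altProd n x y) = 1 := by
    intro n
    induction n with
    | zero => intros; simp [altProd]
    | succ n ih =>
      intro x y hx hy
      have e : ∀ x y : G, altProd (n + 1) x y = altProd n x y * if Even n then x else y := by
        intro x y
        rw [altProd_add]
        simp [altProd]
      have h1 := ih y x hy hx
      simp only [Nat.even_add_one]
      split_ifs at h1 ⊢ with hn
      · nth_rewrite 2 [e]
        rw [altProd, if_pos hn, mul_assoc, ← mul_assoc _ _ x, h1, one_mul, hx]
      · rw [e y x, altProd, if_neg hn, mul_assoc, ← mul_assoc _ _ x, h1, one_mul, hx]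
  rw [← altProd_two_mul, two_mul, altProd_add]
  have := inv n x y hx hy
  split_ifs at this ⊢ with hn
  · rwa [← h] at this
  · rwa [← h]

end AltProd

variable (b) in
/-- The word `i, j, i, …` with `n` letters. -/
def altWord : ℕ → b.support → b.support → List b.support
  | 0, _, _ => []
  | n + 1, i, j => i :: altWord n j i

theorem length_altWord (n : ℕ) (i j : b.support) : (altWord b n i j).length = n := by
  induction n generalizing i j with
  | zero => rfl
  | succ n ih => simp [altWord, ih]

theorem prod_map_altWord {A : Type*} [Monoid A] (f : b.support → A) (n : ℕ) (i j : b.support) :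
    ((altWord b n i j).map f).prod = altProd n (f i) (f j) := by
  induction n generalizing i j with
  | zero => rfl
  | succ n ih => simp [altWord, altProd, ih]

/-- Once `s_i` has been stripped from the left it is no longer a descent, so only `s_j` can be
stripped next: the removed letters alternate until a minimal coset representative is left. -/
theorem exists_altProd_mul_minimal (n : ℕ) {w : P.weylGroup} (hw : len b w = n)
    (i j : b.support) (hj : b.IsPos (w⁻¹ • (j : ι))) :
    ∃ (m : ℕ) (u : P.weylGroup), w = altProd m (sRefl P (i : ι)) (sRefl P (j : ι)) * u ∧
      len b w = m + len b u ∧ b.IsPos (u⁻¹ • (i : ι)) ∧ b.IsPos (u⁻¹ • (j : ι)) := by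
  induction n generalizing w i j with
  | zero =>
    obtain rfl := eq_one_of_len_eq_zero hw
    refine ⟨0, 1, by simp [altProd], by simp, ?_, ?_⟩
    · simpa using b.isPos_of_mem_support i.2
    · simpa using b.isPos_of_mem_support j.2
  | succ n ih =>
    by_cases hi : b.IsPos (w⁻¹ • (i : ι))
    · exact ⟨0, w, by simp [altProd], by simp, hi, hj⟩
    · have hlen := len_sRefl_mul_of_not_isPos i.2 hi
      have hi' : b.IsPos ((sRefl P (i : ι) * w)⁻¹ • (i : ι)) := by
        rw [mul_inv_rev, sRefl_inv, mul_smul, sRefl_smul_self, weyl_smul_neg, isPos_neg_iff]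
        exact hi
      obtain ⟨m, u, h1, h2, h3, h4⟩ := ih (by lia) j i hi'
      refine ⟨m + 1, u, ?_, by lia, h4, h3⟩
      rw [altProd, mul_assoc, ← h1, ← mul_assoc, sRefl_mul_self, one_mul]

/-- Stripping letters starting with either `i` or `j` ends at a minimal representative of the same
coset, hence at the same `u`. The two alternating products then agree in `W`, so their common length
is a multiple of the order of `s_i s_j`. -/
theorem exists_altProd_mul_of_descents {w : P.weylGroup} {i j : b.support} (hij : i ≠ j)
    (hi : ¬ b.IsPos (w⁻¹ • (i : ι))) (hj : ¬ b.IsPos (w⁻¹ • (j : ι))) :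
    ∃ (n : ℕ) (u : P.weylGroup),
      w = altProd (n + 1) (sRefl P (i : ι)) (sRefl P (j : ι)) * u ∧
      w = altProd (n + 1) (sRefl P (j : ι)) (sRefl P (i : ι)) * u ∧
      len b w = n + 1 + len b u ∧
      orderOf (sRefl P (i : ι) * sRefl P (j : ι)) ∣ n + 1 := by
  have step : ∀ i j : b.support, ¬ b.IsPos (w⁻¹ • (i : ι)) → ∃ (n : ℕ) (u : P.weylGroup),
      w = altProd (n + 1) (sRefl P (i : ι)) (sRefl P (j : ι)) * u ∧
      len b w = n + 1 + len b u ∧ b.IsPos (u⁻¹ • (i : ι)) ∧ b.IsPos (u⁻¹ • (j : ι)) := by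
    intro i j hi
    have hlen := len_sRefl_mul_of_not_isPos i.2 hi
    have hi' : b.IsPos ((sRefl P (i : ι) * w)⁻¹ • (i : ι)) := by
      rw [mul_inv_rev, sRefl_inv, mul_smul, sRefl_smul_self, weyl_smul_neg, isPos_neg_iff]
      exact hi
    obtain ⟨m, u, h1, h2, h3, h4⟩ := exists_altProd_mul_minimal _ rfl j i hi'
    refine ⟨m, u, ?_, by lia, h4, h3⟩
    rw [altProd, mul_assoc, ← h1, ← mul_assoc, sRefl_mul_self, one_mul]
  obtain ⟨n, u, h1, h2, h3, h4⟩ := step i j hi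
  obtain ⟨n', u', h1', h2', h3', h4'⟩ := step j i hj
  have hmem : ∀ (n : ℕ) (x y : P.weylGroup), altProd n x y ∈ Subgroup.closure {x, y} := by
    intro n
    induction n with
    | zero => intro x y; exact one_mem _
    | succ n ih =>
      intro x y
      refine mul_mem (Subgroup.subset_closure (by simp)) ?_
      rw [Set.pair_comm]
      exact ih y x
  set v := altProd (n + 1) (sRefl P (i : ι)) (sRefl P (j : ι)) with hv
  set v' := altProd (n' + 1) (sRefl P (j : ι)) (sRefl P (i : ι)) with hv'
  have hu : (v'⁻¹ * v) * u = u' := by rw [mul_assoc, ← h1, h1', inv_mul_cancel_left]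
  have hx : v'⁻¹ * v = 1 := by
    refine minimal_coset_unique hij (u := u) (mul_mem (inv_mem ?_) (hmem _ _ _)) h3 h4 ?_ ?_
    · rw [Set.pair_comm]; exact hmem _ _ _
    · rw [hu]; exact h4'
    · rw [hu]; exact h3'
  rw [hx, one_mul] at hu
  subst hu
  obtain rfl : n = n' := by lia
  refine ⟨n, u, h1, h1', h2, orderOf_dvd_of_pow_eq_one ?_⟩
  refine mul_pow_eq_one_of_altProd_comm (sRefl_mul_self _) (sRefl_mul_self _) ?_
  rw [← hv, ← hv']
  exact (inv_mul_eq_one.1 hx).symm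

/-- Matsumoto's theorem: a family satisfying the braid relations has the same product along any
two reduced words of the same element. -/
theorem prod_map_eq_of_isReducedWord {A : Type*} [Monoid A] (f : b.support → A)
    (hf : ∀ i j : b.support, i ≠ j →
      altProd (orderOf (sRefl P (i : ι) * sRefl P (j : ι))) (f i) (f j) =
      altProd (orderOf (sRefl P (i : ι) * sRefl P (j : ι))) (f j) (f i))
    {w : P.weylGroup} {l l' : List b.support} (hl : IsReducedWord b w l)
    (hl' : IsReducedWord b w l') : (l.map f).prod = (l'.map f).prod := by
  simp only [isReducedWord_iff] at hl hl'
  induction hn : len b w generalizing w l l' with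
  | zero =>
    rw [hn, List.length_eq_zero_iff] at hl hl'
    rw [hl.2, hl'.2]
  | succ n ih =>
    have tail : ∀ {i : b.support} {l : List b.support},
        wordProd b (i :: l) = w ∧ (i :: l).length = len b w →
        wordProd b l = sRefl P (i : ι) * w ∧ l.length = len b (sRefl P (i : ι) * w) ∧
        len b (sRefl P (i : ι) * w) = n ∧ ¬ b.IsPos (w⁻¹ • (i : ι)) := by
      rintro i l ⟨h1, h2⟩
      rw [wordProd_cons] at h1
      have e : wordProd b l = sRefl P (i : ι) * w := by
        rw [← h1, ← mul_assoc, sRefl_mul_self, one_mul]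
      have hle := len_wordProd_le b l
      rw [List.length_cons] at h2
      rw [e] at hle
      by_cases h : b.IsPos (w⁻¹ • (i : ι))
      · have := len_sRefl_mul_of_isPos i.2 h
        lia
      · have := len_sRefl_mul_of_not_isPos i.2 h
        exact ⟨e, by lia, by lia, h⟩
    cases l with
    | nil => simp at hl; lia
    | cons i l =>
    cases l' with
    | nil => simp at hl'; lia
    | cons j l' =>
    obtain ⟨a1, a2, a3, a4⟩ := tail hl
    obtain ⟨c1, c2, c3, c4⟩ := tail hl'
    by_cases hij : i = j
    · subst hij
      rw [List.map_cons, List.map_cons, List.prod_cons, List.prod_cons,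
        ih ⟨a1, a2⟩ ⟨c1, c2⟩ a3]
    · obtain ⟨m, u, h1, h2, h3, k, hk⟩ := exists_altProd_mul_of_descents hij a4 c4
      have hu := (isReducedWord_iff.1 (redWord_spec b u))
      -- The tail of a word starting with `i` may be traded, by induction, for the rest of the
      -- alternating word followed by a reduced word of `u`.
      have side : ∀ (i j : b.support) (l : List b.support),
          wordProd b l = sRefl P (i : ι) * w → l.length = len b (sRefl P (i : ι) * w) →
          len b (sRefl P (i : ι) * w) = n →
          w = altProd (m + 1) (sRefl P (i : ι)) (sRefl P (j : ι)) * u →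
          ((i :: l).map f).prod = altProd (m + 1) (f i) (f j) * ((redWord b u).map f).prod := by
        intro i j l e1 e2 e3 e4
        have hred : wordProd b (altWord b m j i ++ redWord b u) = sRefl P (i : ι) * w ∧
            (altWord b m j i ++ redWord b u).length = len b (sRefl P (i : ι) * w) := by
          constructor
          · rw [wordProd_append, hu.1, wordProd, prod_map_altWord (fun k : b.support =>
              sRefl P (k : ι)), e4, altProd, mul_assoc, ← mul_assoc (sRefl P (i : ι)),
              sRefl_mul_self, one_mul]
          · rw [List.length_append, length_altWord, hu.2]
            lia
        rw [List.map_cons, List.prod_cons, ih ⟨e1, e2⟩ hred e3, List.map_append,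
          List.prod_append, prod_map_altWord, altProd, mul_assoc]
      rw [side i j l a1 a2 a3 h1, side j i l' c1 c2 c3 h2, hk, altProd_mul_comm (hf i j hij) k]

end WeylCombinatorics

end

end AffineHecke

namespace AffineHecke

open scoped TensorProduct

noncomputable section

/-! ### Kazhdan-Lusztig products in two generators. -/

section KazhdanLusztig

/-- The Kazhdan-Lusztig product in two generators of a dihedral Hecke algebra, given by the
recursion `c (n + 2) x y = x * c (n + 1) y x - c n x y`. -/
def klProd {A : Type*} [Ring A] : ℕ → A → A → A
  | 0, _, _ => 0
  | 1, x, _ => x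
  | n + 2, x, y => x * klProd (n + 1) y x - klProd n x y

variable {R A : Type*} [CommRing R] [Ring A] [Algebra R A]

/-- The lower order terms in the expansion of `klProd`, up to sign in degree zero. -/
def klLower (u' : R) (x y : A) : ℕ → A
  -- The two alternating products of length zero are the same element `1`; the `-1` removes the
  -- duplicate in the next degree.
  | 0 => -1
  | n + 1 => u' • (altProd n x y + altProd n y x + klLower u' x y n)

theorem klLower_comm (u' : R) (x y : A) (n : ℕ) : klLower u' x y n = klLower u' y x n := by
  induction n with
  | zero => rfl
  | succ n ih => rw [klLower, klLower, ih, add_comm (altProd n x y)]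

theorem mul_klLower {u u' : R} (hu : u * u' = 1) {x : A} (hx : x * x = (u - u') • x + 1) (y : A)
    (n : ℕ) : x * klLower u' x y (n + 1) =
      u' • altProd (n + 1) x y + altProd n x y + klLower u' x y n := by
  induction n with
  | zero => simp [klLower, altProd]
  | succ n ih =>
    have h : x * altProd (n + 1) x y = (u - u') • altProd (n + 1) x y + altProd n y x := by
      rw [altProd, ← mul_assoc, hx, add_mul, one_mul, smul_mul_assoc]
    rw [klLower, mul_smul_comm, mul_add, mul_add, ih, h, show x * altProd (n + 1) y x =
      altProd (n + 2) x y from rfl, klLower]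
    have e : u' * (u - u') + u' * u' = 1 := by rw [← hu]; ring
    have e' : altProd (n + 1) x y =
        (u' * (u - u')) • altProd (n + 1) x y + (u' * u') • altProd (n + 1) x y := by
      rw [← add_smul, e, one_smul]
    conv_rhs => rw [e']
    module

/-- This is the dihedral Kazhdan-Lusztig expansion: the alternating product of full length, plus
each shorter one weighted by the power of `u'` given by the drop in length. -/
theorem klProd_eq {u u' : R} (hu : u * u' = 1) {x y : A} (hx : x * x = (u - u') • x + 1)
    (hy : y * y = (u - u') • y + 1) (n : ℕ) :
    klProd n (x + u' • (1 : A)) (y + u' • (1 : A)) = altProd n x y + klLower u' x y n := by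
  induction n using Nat.twoStepInduction generalizing x y with
  | zero => simp [klProd, klLower, altProd]
  | one => simp [klProd, klLower, altProd]
  | more n ih1 ih2 =>
    rw [klProd, ih2 hy hx, ih1 hx hy, klLower_comm u' y x, add_mul, mul_add, mul_klLower hu hx,
      show klLower u' x y (n + 2) =
        u' • (altProd (n + 1) x y + altProd (n + 1) y x + klLower u' x y (n + 1)) from rfl,
      smul_mul_assoc, one_mul, show x * altProd (n + 1) y x = altProd (n + 2) x y from rfl]
    module

/-- The lower terms are symmetric in `x` and `y`, so they cancel. -/
theorem altProd_comm_of_klProd_comm {u u' : R} (hu : u * u' = 1) {x y : A}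
    (hx : x * x = (u - u') • x + 1) (hy : y * y = (u - u') • y + 1) {n : ℕ}
    (h : klProd n (x + u' • (1 : A)) (y + u' • (1 : A)) =
      klProd n (y + u' • (1 : A)) (x + u' • (1 : A))) :
    altProd n x y = altProd n y x := by
  rw [klProd_eq hu hx hy, klProd_eq hu hy hx, klLower_comm] at h
  exact add_right_cancel h

end KazhdanLusztig

set_option linter.unusedSimpArgs false

/-! ### Rank two identities for the operators `f ↦ a f + s(a f)`. -/

section RankTwo

variable {F : Type*} [CommRing F]

/-- The operator `f ↦ a f + s (a f)`. -/
def symOp (s : F →+* F) (a : F) : AddMonoid.End F :=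
  AddMonoidHom.mk' (fun f => a * f + s (a * f)) (by intro f g; rw [mul_add, map_add]; abel)

theorem symOp_apply (s : F →+* F) (a f : F) : symOp s a f = a * f + s (a * f) := rfl

variable {s t : F →+* F} {v : F}

theorem klProd_symOp_two (hst : ∀ f, s (t f) = t (s f)) {a c : F} (hsc : s c = c) (hta : t a = a)
    (f : F) : klProd 2 (symOp s a) (symOp t c) f = klProd 2 (symOp t c) (symOp s a) f := by
  change symOp s a (symOp t c f) - 0 = symOp t c (symOp s a f) - 0
  have h1 : t (s a) = s a := by rw [← hst, hta]
  simp only [symOp_apply, map_add, map_mul, hst, hsc, hta, h1]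
  ring

/-- The right side is the sum of `w(a₀ a₁ a₂ f)` over the dihedral group of order six. The innermost
operator produces an `s`-invariant `φ`, so the left side is first rewritten over the coset
representatives `1, t, st`, with `hR` removing the surplus term. The longer cases below follow the
same plan, with a `t`-invariant `φ`. -/
theorem klProd_symOp_three_aux (hs : ∀ f, s (s f) = f) {a₀ a₁ a₂ : F}
    (hv : s v = v) (hv' : t v = v) (hs0 : s a₀ = v - a₀) (hs1 : s a₁ = a₂)
    (hs2 : s a₂ = a₁) (ht2 : t a₂ = v - a₂) (ht0 : t a₀ = a₁) (ht1 : t a₁ = a₀)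
    (hR : a₀ * a₂ + v * a₁ - a₁ * (a₀ + a₂) = 1) (f : F) :
    klProd 3 (symOp s a₀) (symOp t a₂) f =
      let g := a₀ * a₁ * a₂ * f
      g + s g + t g + s (t g) + t (s g) + s (t (s g)) := by
  have hR' := congrArg s hR
  simp only [map_add, map_sub, map_mul, map_one, hv, hs0, hs1, hs2] at hR'
  change symOp s a₀ (symOp t a₂ (symOp s a₀ f) - 0) - symOp s a₀ f = _
  set φ := symOp s a₀ f with hφ
  have hsφ : s φ = φ := by
    rw [hφ, symOp_apply, map_add, hs, add_comm]
  have key : symOp s a₀ (symOp t a₂ φ - 0) - φ =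
      (a₁ * a₂) * φ + t ((a₁ * a₂) * φ) + s (t ((a₁ * a₂) * φ)) := by
    simp only [symOp_apply, map_add, map_sub, map_mul, map_zero, hs, hv, hv', hs0, hs1, hs2, ht2,
      ht0, ht1, hsφ]
    linear_combination φ * hR
  rw [key, hφ]
  simp only [symOp_apply, map_add, map_sub, map_mul, hs, hv, hv', hs0, hs1, hs2, ht2, ht0, ht1]
  ring

theorem klProd_symOp_four_aux (hs : ∀ f, s (s f) = f) (ht : ∀ f, t (t f) = f) {a₀ a₁ a₂ a₃ : F}
    (hv : s v = v) (hv' : t v = v) (hs0 : s a₀ = v - a₀) (hs1 : s a₁ = a₃) (hs2 : s a₂ = a₂)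
    (hs3 : s a₃ = a₁) (ht3 : t a₃ = v - a₃) (ht0 : t a₀ = a₂) (ht1 : t a₁ = a₁)
    (ht2 : t a₂ = a₀)
    (hR : a₀ * a₃ + v * (a₁ + a₂) - (a₀ * a₁ + a₁ * a₂ + a₂ * a₃) = 2) (f : F) :
    klProd 4 (symOp s a₀) (symOp t a₃) f =
      let g := a₀ * a₁ * a₂ * a₃ * f
      g + t g + s g + s (t g) + t (s g) + t (s (t g)) + s (t (s g)) + s (t (s (t g))) := by
  have hR' := congrArg s hR
  simp only [map_add, map_sub, map_mul, map_ofNat, hv, hs0, hs1, hs2, hs3] at hR'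
  change symOp s a₀ (symOp t a₃ (symOp s a₀ (symOp t a₃ f) - 0) - symOp t a₃ f) -
    (symOp s a₀ (symOp t a₃ f) - 0) = _
  set φ := symOp t a₃ f with hφ
  have htφ : t φ = φ := by
    rw [hφ, symOp_apply, map_add, ht, add_comm]
  have key : symOp s a₀ (symOp t a₃ (symOp s a₀ φ - 0) - φ) - (symOp s a₀ φ - 0) =
      (a₀ * a₁ * a₂) * φ + s ((a₀ * a₁ * a₂) * φ) + t (s ((a₀ * a₁ * a₂) * φ)) +
        s (t (s ((a₀ * a₁ * a₂) * φ))) := by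
    simp only [symOp_apply, map_add, map_sub, map_mul, map_zero, hv, hv', hs0, hs1, hs2, hs3,
      ht3, ht0, ht1, ht2, htφ, hs, ht]
    linear_combination a₀ * φ * hR + (v - a₀) * s φ * hR'
  rw [key, hφ]
  simp only [symOp_apply, map_add, map_sub, map_mul, hv, hv', hs0, hs1, hs2, hs3, ht3, ht0, ht1,
    ht2, ht]
  ring

theorem klProd_symOp_six_aux (hs : ∀ f, s (s f) = f) (ht : ∀ f, t (t f) = f) {a₀ a₁ a₂ a₃ a₄ a₅ : F}
    (hv : s v = v) (hv' : t v = v) (hs0 : s a₀ = v - a₀) (hs1 : s a₁ = a₅) (hs2 : s a₂ = a₄)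
    (hs3 : s a₃ = a₃) (hs4 : s a₄ = a₂) (hs5 : s a₅ = a₁) (ht5 : t a₅ = v - a₅)
    (ht0 : t a₀ = a₄) (ht1 : t a₁ = a₃) (ht2 : t a₂ = a₂) (ht3 : t a₃ = a₁) (ht4 : t a₄ = a₀)
    (hR : a₀ * a₅ + v * (a₁ + a₂ + a₃ + a₄) -
      (a₀ * a₁ + a₁ * a₂ + a₂ * a₃ + a₃ * a₄ + a₄ * a₅) = 4)
    (hQ : a₃*a₄*v^2 - a₃*a₄^2*v - a₃*a₄*a₅*v + a₃*a₄^2*a₅ + a₄^2*v^2 - 2*a₄^2*a₅*v + a₄^2*a₅^2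
      + 2*a₀*a₄*a₅*v - 2*a₀*a₄*a₅^2 + a₀^2*a₅^2 + 2*a₀*a₁*a₅*v - 2*a₀^2*a₁*a₅ + a₁*a₄*v^2
      - a₁*a₄*a₅*v - a₀*a₁*a₄*v + a₀*a₁*a₄*a₅ + a₁^2*v^2 - 2*a₀*a₁^2*v + a₀^2*a₁^2 + a₁*a₂*v^2
      - a₁^2*a₂*v - a₀*a₁*a₂*v + a₀*a₁^2*a₂ - 4*a₄*v + 4*a₄*a₅ - 4*a₀*a₅ - 4*a₁*v + 4*a₀*a₁ + 3
      - a₁*a₂*a₃*a₄ = 0) (f : F) :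
    klProd 6 (symOp s a₀) (symOp t a₅) f =
      let g := a₀ * a₁ * a₂ * a₃ * a₄ * a₅ * f
      g + t g + s g + s (t g) + t (s g) + t (s (t g)) + s (t (s g)) + s (t (s (t g)))
        + t (s (t (s g))) + t (s (t (s (t g)))) + s (t (s (t (s g))))
        + s (t (s (t (s (t g))))) := by
  have hR' := congrArg s hR
  have hQ' := congrArg s hQ
  simp only [map_add, map_sub, map_mul, map_pow, map_ofNat, map_zero, hv, hs0, hs1, hs2, hs3, hs4,
    hs5] at hR' hQ'
  change symOp s a₀ (symOp t a₅ (symOp s a₀ (symOp t a₅ (symOp s a₀ (symOp t a₅ f) - 0)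
    - symOp t a₅ f) - (symOp s a₀ (symOp t a₅ f) - 0))
    - (symOp t a₅ (symOp s a₀ (symOp t a₅ f) - 0) - symOp t a₅ f)) -
    (symOp s a₀ (symOp t a₅ (symOp s a₀ (symOp t a₅ f) - 0)
    - symOp t a₅ f) - (symOp s a₀ (symOp t a₅ f) - 0)) = _
  set φ := symOp t a₅ f with hφ
  have htφ : t φ = φ := by
    rw [hφ, symOp_apply, map_add, ht, add_comm]
  have key : symOp s a₀ (symOp t a₅ (symOp s a₀ (symOp t a₅ (symOp s a₀ φ - 0)
    - φ) - (symOp s a₀ φ - 0)) - (symOp t a₅ (symOp s a₀ φ - 0) - φ)) -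
    (symOp s a₀ (symOp t a₅ (symOp s a₀ φ - 0) - φ) - (symOp s a₀ φ - 0)) =
      let g := a₀ * a₁ * a₂ * a₃ * a₄ * φ
      g + s g + t (s g) + s (t (s g)) + t (s (t (s g))) + s (t (s (t (s g)))) := by
    simp only [symOp_apply, map_add, map_sub, map_mul, map_zero, hv, hv', hs0, hs1, hs2, hs3, hs4,
      hs5, ht0, ht1, ht2, ht3, ht4, ht5, htφ, hs, ht]
    -- `hQ` and its `s`-conjugate settle the coefficients of `φ` and `s φ`; `hR` and its
    -- `s`-conjugate settle those of `t s φ` and `s t s φ`.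
    linear_combination a₀ * φ * hQ + (v - a₀) * s φ * hQ' +
      a₀ * (v - a₅) * (v - a₄) * t (s φ) * hR + (v - a₀) * (v - a₁) * (v - a₂) * s (t (s φ)) * hR'
  rw [key, hφ]
  simp only [symOp_apply, map_add, map_sub, map_mul, hv, hv', hs0, hs1, hs2, hs3, hs4, hs5, ht0,
    ht1, ht2, ht3, ht4, ht5, ht]
  ring

end RankTwo

end

end AffineHecke

namespace AffineHecke

open scoped TensorProduct

noncomputable section

set_option linter.unusedSectionVars false

theorem mul_self_of_shift {R A : Type*} [CommRing R] [Ring A] [Algebra R A] {u u' : R}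
    (hu : u * u' = 1) {x : A}
    (h : (x + u' • (1 : A)) * (x + u' • (1 : A)) = (u + u') • (x + u' • (1 : A))) :
    x * x = (u - u') • x + 1 := by
  have e : x * x = (x + u' • (1 : A)) * (x + u' • (1 : A)) - (u' + u') • x - (u' * u') • 1 := by
    simp only [mul_add, add_mul, mul_smul_comm, smul_mul_assoc, mul_one, one_mul]
    module
  have e' : (1 : A) = (u * u') • 1 := by rw [hu, one_smul]
  rw [e, h]
  conv_rhs => rw [e']
  module

/-! ### The group algebra, its fraction field, and the Demazure-Lusztig operators. -/

section PolynomialOperators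

variable {ι M N : Type*} [AddCommGroup M] [Module ℝ M] [AddCommGroup N] [Module ℝ N]

section Basic

variable (P : RootPairing ι ℝ M N)

/-- The basis of `𝕂[P]` consisting of the elements `x^μ`. -/
def xBasis : Module.Basis (weightLattice P) K (GroupAlg P) :=
  Module.Basis.ofRepr
    { AddMonoidAlgebra.coeffAddEquiv with
      map_smul' := fun _ _ => rfl }

variable {P}

theorem xBasis_apply (μ : weightLattice P) : xBasis P μ = xP μ := by
  rw [xBasis, Module.Basis.apply_eq_iff]
  exact AddMonoidAlgebra.coeff_single μ 1

theorem groupAlg_lhom_ext {V : Type*} [AddCommMonoid V] [Module K V]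
    {f g : GroupAlg P →ₗ[K] V} (h : ∀ μ, f (xP μ) = g (xP μ)) : f = g :=
  (xBasis P).ext fun μ => by rw [xBasis_apply, h]

theorem xP_mul_xP (μ ν : weightLattice P) : xP μ * xP ν = xP (μ + ν) := by
  rw [xP, xP, xP, AddMonoidAlgebra.single_mul_single, one_mul]

theorem xP_zero : xP (0 : weightLattice P) = 1 := rfl

theorem xP_injective : Function.Injective (xP : weightLattice P → GroupAlg P) :=
  AddMonoidAlgebra.single_left_injective one_ne_zero

theorem weylAct_mul (w v : P.weylGroup) (f : GroupAlg P) :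
    weylAct P (w * v) f = weylAct P w (weylAct P v f) := by
  change (weylAct P (w * v)).toLinearMap f =
    ((weylAct P w).toLinearMap.comp (weylAct P v).toLinearMap) f
  congr 1
  apply groupAlg_lhom_ext
  intro μ
  simp only [AlgHom.toLinearMap_apply, LinearMap.comp_apply, weylAct_xP, mul_smul]

theorem weylAct_one (f : GroupAlg P) : weylAct P 1 f = f := by
  change (weylAct P 1).toLinearMap f = (LinearMap.id : GroupAlg P →ₗ[K] GroupAlg P) f
  congr 1
  apply groupAlg_lhom_ext
  intro μ
  simp only [AlgHom.toLinearMap_apply, LinearMap.id_apply, weylAct_xP, one_smul]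

theorem weylAct_injective (w : P.weylGroup) : Function.Injective (weylAct P w) := by
  apply Function.LeftInverse.injective (g := weylAct P w⁻¹)
  intro f
  rw [← weylAct_mul, inv_mul_cancel, weylAct_one]

theorem weylAct_coeff (w : P.weylGroup) (f : GroupAlg P) (μ : weightLattice P) :
    (weylAct P w f).coeff (w • μ) = f.coeff μ := by
  have h : (Finsupp.lapply (w • μ)).comp ((xBasis P).repr.toLinearMap.comp
      (weylAct P w).toLinearMap) = (Finsupp.lapply μ).comp (xBasis P).repr.toLinearMap := by
    apply groupAlg_lhom_ext
    intro ν
    change (weylAct P w (xP ν)).coeff (w • μ) = (xP ν).coeff μ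
    rw [weylAct_xP]
    change Finsupp.single (w • ν) (1 : K) (w • μ) = Finsupp.single ν (1 : K) μ
    classical
    rw [Finsupp.single_apply, Finsupp.single_apply]
    simp only [smul_left_cancel_iff]
  exact LinearMap.congr_fun h f

variable (P) in
/-- The fraction field of `𝕂[P]`. -/
abbrev FracAlg : Type _ := FractionRing (GroupAlg P)

/-- The weight lattice embeds in a rational vector space; the resulting unique sums make `𝕂[P]` a
domain, which the fraction field arguments need. -/
instance : TwoUniqueSums (weightLattice P) :=
  letI : Module ℚ M := Module.compHom M (algebraMap ℚ ℝ)
  TwoUniqueSums.of_injective_addHom (weightLattice P).subtype.toAddHom Subtype.val_injective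
    inferInstance

instance : IsDomain (GroupAlg P) := NoZeroDivisors.to_isDomain _

variable (P) in
/-- The extension of the action of `w` to the fraction field of `𝕂[P]`. -/
def fracAct (w : P.weylGroup) : FracAlg P →+* FracAlg P :=
  IsFractionRing.lift (A := GroupAlg P)
    (g := (algebraMap (GroupAlg P) (FracAlg P)).comp (weylAct P w : GroupAlg P →+* GroupAlg P))
    ((IsFractionRing.injective (GroupAlg P) (FracAlg P)).comp (weylAct_injective w))

theorem fracAct_algebraMap (w : P.weylGroup) (f : GroupAlg P) :
    fracAct P w (algebraMap _ _ f) = algebraMap _ _ (weylAct P w f) :=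
  IsFractionRing.lift_algebraMap _ _

theorem fracAct_mul (w v : P.weylGroup) (f : FracAlg P) :
    fracAct P (w * v) f = fracAct P w (fracAct P v f) := by
  change fracAct P (w * v) f = ((fracAct P w).comp (fracAct P v)) f
  congr 1
  apply IsLocalization.ringHom_ext (nonZeroDivisors (GroupAlg P))
  refine RingHom.ext fun f => ?_
  simp only [RingHom.comp_apply, fracAct_algebraMap, weylAct_mul]

theorem fracAct_one (f : FracAlg P) : fracAct P 1 f = f := by
  change fracAct P 1 f = RingHom.id _ f
  congr 1
  apply IsLocalization.ringHom_ext (nonZeroDivisors (GroupAlg P))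
  refine RingHom.ext fun f => ?_
  simp only [RingHom.comp_apply, fracAct_algebraMap, weylAct_one, RingHom.id_apply]

variable (P) in
/-- The constant `q ^ n` in the fraction field of `𝕂[P]`. -/
def qFrac (n : ℤ) : FracAlg P := algebraMap (GroupAlg P) _ (algebraMap K _ (q n))

theorem fracAct_qFrac (w : P.weylGroup) (n : ℤ) : fracAct P w (qFrac P n) = qFrac P n := by
  rw [qFrac, fracAct_algebraMap, AlgHom.commutes]

theorem q_mul_q (m n : ℤ) : q m * q n = q (m + n) := (LaurentPolynomial.T_add m n).symm

theorem qFrac_mul_qFrac (m n : ℤ) : qFrac P m * qFrac P n = qFrac P (m + n) := by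
  rw [qFrac, qFrac, qFrac, ← map_mul, ← map_mul, q_mul_q]

theorem q_zero : q 0 = 1 := LaurentPolynomial.T_zero

theorem q_one_mul : q 1 * q (-1) = 1 := by
  rw [q_mul_q, show (1 : ℤ) + -1 = 0 by norm_num, q_zero]

theorem qFrac_zero : qFrac P 0 = 1 := by rw [qFrac, q_zero, map_one, map_one]

theorem qFrac_one_mul : qFrac P 1 * qFrac P (-1) = 1 := by
  rw [qFrac_mul_qFrac]; exact qFrac_zero

end Basic

variable {P : RootPairing ι ℝ M N} [P.IsCrystallographic]

theorem rootWt_weyl_smul (w : P.weylGroup) (k : ι) : rootWt P (w • k) = w • rootWt P k :=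
  Subtype.ext (root_weyl_smul w k)

theorem rootWt_neg (k : ι) : rootWt P (negRoot P k) = -rootWt P k :=
  Subtype.ext (root_neg k)

theorem rootWt_ne_zero (k : ι) : rootWt P k ≠ 0 := fun h =>
  P.ne_zero k (congrArg Subtype.val h)

variable (P) in
/-- The element `x^(-α)` of the fraction field of `𝕂[P]`. -/
def xFrac (k : ι) : FracAlg P := algebraMap (GroupAlg P) _ (xP (-rootWt P k))

theorem one_sub_xP_ne_zero (k : ι) : (1 - xP (-rootWt P k) : GroupAlg P) ≠ 0 := by
  rw [sub_ne_zero, ← xP_zero]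
  intro h
  exact rootWt_ne_zero k (neg_eq_zero.1 (xP_injective h).symm)

theorem one_sub_xFrac_ne_zero (k : ι) : 1 - xFrac P k ≠ 0 := by
  rw [xFrac, ← map_one (algebraMap (GroupAlg P) (FracAlg P)), ← map_sub]
  exact (map_ne_zero_iff _ (IsFractionRing.injective _ _)).2 (one_sub_xP_ne_zero k)

theorem fracAct_xFrac (w : P.weylGroup) (k : ι) : fracAct P w (xFrac P k) = xFrac P (w • k) := by
  rw [xFrac, fracAct_algebraMap, weylAct_xP, smul_neg, ← rootWt_weyl_smul, xFrac]

theorem xFrac_mul_neg (k : ι) : xFrac P k * xFrac P (negRoot P k) = 1 := by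
  rw [xFrac, xFrac, ← map_mul, xP_mul_xP, rootWt_neg, neg_neg, neg_add_cancel, xP_zero, map_one]

theorem xFrac_add {i j k : ι} (h : P.root k = P.root i + P.root j) :
    xFrac P k = xFrac P i * xFrac P j := by
  have e : rootWt P k = rootWt P i + rootWt P j := Subtype.ext h
  rw [xFrac, xFrac, xFrac, ← map_mul, xP_mul_xP, e, neg_add]

variable (P) in
/-- The function `(q - q⁻¹ x^(-α)) / (1 - x^(-α))`. -/
def cFrac (k : ι) : FracAlg P := (qFrac P 1 - qFrac P (-1) * xFrac P k) / (1 - xFrac P k)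

theorem fracAct_cFrac (w : P.weylGroup) (k : ι) : fracAct P w (cFrac P k) = cFrac P (w • k) := by
  simp only [cFrac, map_div₀, map_sub, map_mul, fracAct_qFrac, fracAct_xFrac, map_one]

theorem cFrac_neg (k : ι) : cFrac P (negRoot P k) = qFrac P 1 + qFrac P (-1) - cFrac P k := by
  have h := xFrac_mul_neg (P := P) k
  have h1 := one_sub_xFrac_ne_zero (P := P) k
  have h2 := one_sub_xFrac_ne_zero (P := P) (negRoot P k)
  rw [cFrac, cFrac, eq_sub_iff_add_eq, div_add_div _ _ h2 h1, div_eq_iff (mul_ne_zero h2 h1)]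
  linear_combination (-qFrac P 1 + qFrac P (-1)) * (h)

/-- Writing `x^(-γ) = x^(-α) x^(-β)` for `γ = α + β` leaves a rational identity in two variables
that reduces to `q q⁻¹ = 1`. All the polynomial relations needed for the rank two braid identities
are combinations of this one. -/
theorem cFrac_add {i j k : ι} (h : P.root k = P.root i + P.root j) :
    cFrac P i * cFrac P j + (qFrac P 1 + qFrac P (-1)) * cFrac P k -
      cFrac P k * (cFrac P i + cFrac P j) = 1 := by
  have h1 := one_sub_xFrac_ne_zero (P := P) i
  have h2 := one_sub_xFrac_ne_zero (P := P) j
  have h3 := one_sub_xFrac_ne_zero (P := P) k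
  have hq := qFrac_one_mul (P := P)
  rw [xFrac_add h] at h3
  simp only [cFrac, xFrac_add h]
  field_simp
  linear_combination (1 - xFrac P i) * (1 - xFrac P j) * (1 - xFrac P i * xFrac P j) * hq

/-- The divided difference operator in the root with index `i`. -/
def divDiffOp (i : ι) : GroupAlg P →ₗ[K] GroupAlg P :=
  (xBasis P).constr K (divDiff xP i)

theorem divDiffOp_xP (i : ι) (μ : weightLattice P) : divDiffOp i (xP μ) = divDiff xP i μ := by
  rw [divDiffOp, ← xBasis_apply, Module.Basis.constr_basis]

theorem one_sub_mul_divDiffOp (i : ι) (f : GroupAlg P) :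
    (1 - xP (-rootWt P i)) * divDiffOp i f = f - weylAct P (sRefl P i) f := by
  have h : (LinearMap.mulLeft K (1 - xP (-rootWt P i))).comp (divDiffOp i) =
      LinearMap.id - (weylAct P (sRefl P i)).toLinearMap := by
    apply groupAlg_lhom_ext
    intro μ
    simp only [LinearMap.comp_apply, LinearMap.mulLeft_apply, LinearMap.sub_apply,
      LinearMap.id_apply, AlgHom.toLinearMap_apply, divDiffOp_xP, weylAct_xP]
    exact divDiff_spec i μ
  exact LinearMap.congr_fun h f

/-- The Demazure-Lusztig operator `f ↦ q s f + (q - q⁻¹) (f - s f) / (1 - x^(-α))`. -/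
def dlOp (i : ι) : Module.End K (GroupAlg P) :=
  q 1 • (weylAct P (sRefl P i)).toLinearMap + (q 1 - q (-1)) • divDiffOp i

theorem dlOp_apply (i : ι) (f : GroupAlg P) :
    dlOp i f = q 1 • weylAct P (sRefl P i) f + (q 1 - q (-1)) • divDiffOp i f := rfl

theorem algebraMap_smul_q (n : ℤ) (f : GroupAlg P) :
    algebraMap (GroupAlg P) (FracAlg P) (q n • f) = qFrac P n * algebraMap _ _ f := by
  rw [Algebra.smul_def, map_mul, qFrac]

/-- In `T_i + q⁻¹` the coefficient of `f` is `c = (q - q⁻¹ x^(-α)) / (1 - x^(-α))`, and that of `s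
f` is `q + q⁻¹ - c`, which is `s c`. -/
theorem algebraMap_dlOp_add (i : ι) (f : GroupAlg P) :
    algebraMap _ (FracAlg P) ((dlOp i + q (-1) • 1 : Module.End K (GroupAlg P)) f) =
      symOp (fracAct P (sRefl P i)) (cFrac P i) (algebraMap _ _ f) := by
  have h := congrArg (algebraMap (GroupAlg P) (FracAlg P)) (one_sub_mul_divDiffOp i f)
  rw [map_mul, map_sub, map_sub, map_one, ← xFrac] at h
  have h1 := one_sub_xFrac_ne_zero (P := P) i
  rw [LinearMap.add_apply, dlOp_apply, symOp_apply, map_mul, fracAct_cFrac, sRefl_smul_self,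
    cFrac_neg, fracAct_algebraMap]
  simp only [LinearMap.smul_apply, Module.End.one_apply, map_add, map_sub, sub_smul,
    algebraMap_smul_q]
  rw [mul_comm, ← eq_div_iff h1] at h
  rw [h, cFrac]
  field_simp
  ring

/-- The image of `T_i + q⁻¹` is `s`-invariant, and on invariants this operator is multiplication by
`c + s c = q + q⁻¹`. -/
theorem dlOp_mul_self (i : ι) :
    (dlOp i * dlOp i : Module.End K (GroupAlg P)) = (q 1 - q (-1)) • dlOp i + 1 := by
  have key : ((dlOp i + q (-1) • (1 : Module.End K (GroupAlg P))) *
      (dlOp i + q (-1) • (1 : Module.End K (GroupAlg P)))) =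
      (q 1 + q (-1)) • (dlOp i + q (-1) • (1 : Module.End K (GroupAlg P))) := by
    refine LinearMap.ext fun f => ?_
    apply IsFractionRing.injective (GroupAlg P) (FracAlg P)
    rw [Module.End.mul_apply, algebraMap_dlOp_add, algebraMap_dlOp_add, LinearMap.smul_apply,
      add_smul, map_add, algebraMap_smul_q, algebraMap_smul_q, algebraMap_dlOp_add]
    have hs : ∀ g, fracAct P (sRefl P i) (fracAct P (sRefl P i) g) = g := by
      intro g
      rw [← fracAct_mul, sRefl_mul_self, fracAct_one]
    simp only [symOp_apply, map_add, map_mul, hs, map_sub, fracAct_qFrac, fracAct_cFrac, sRefl_smul_self,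
      cFrac_neg]
    ring
  exact mul_self_of_shift (R := K) (A := Module.End K (GroupAlg P)) q_one_mul key

/-- The Bernstein relation for the Demazure-Lusztig operators. -/
theorem xP_mul_dlOp (i : ι) (μ : weightLattice P) (f : GroupAlg P) :
    xP μ * dlOp i f = dlOp i (xP (sRefl P i • μ) * f) +
      (q 1 - q (-1)) • (divDiff xP i μ * f) := by
  -- Multiplying by `1 - x^(-α)` turns each divided difference into a plain difference.
  apply mul_left_cancel₀ (one_sub_xP_ne_zero i)
  have e1 := one_sub_mul_divDiffOp i f
  have e2 := one_sub_mul_divDiffOp i (xP (sRefl P i • μ) * f)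
  have e3 := divDiff_spec i μ
  rw [map_mul (weylAct P _), weylAct_xP, ← mul_smul, sRefl_mul_self, one_smul] at e2
  rw [dlOp_apply, dlOp_apply, map_mul (weylAct P _), weylAct_xP, ← mul_smul (sRefl P i) (sRefl P i),
    sRefl_mul_self, one_smul]
  simp only [Algebra.smul_def]
  linear_combination algebraMap K (GroupAlg P) (q 1 - q (-1)) * (xP μ * e1 - e2 - f * e3)

end PolynomialOperators

end

end AffineHecke

namespace AffineHecke

open scoped TensorProduct

noncomputable section

set_option linter.unusedSectionVars false

/-! ### Symmetry of the rank two products under exchange of the generators. -/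

section RankTwo

variable {F : Type*} [CommRing F] {s t : F →+* F} {v : F}

/-- Exchanging `s` and `t` reverses the list of the `a`'s and leaves their product unchanged, so the
two dihedral sums differ only in how the longest element is written; `hst` identifies the two forms.
The cases of length four and six use the same argument. -/
theorem klProd_symOp_three (hs : ∀ f, s (s f) = f) (ht : ∀ f, t (t f) = f)
    (hst : ∀ f, s (t (s f)) = t (s (t f))) {a₀ a₁ a₂ : F}
    (hv : s v = v) (hv' : t v = v) (hs0 : s a₀ = v - a₀) (hs1 : s a₁ = a₂)
    (hs2 : s a₂ = a₁) (ht2 : t a₂ = v - a₂) (ht0 : t a₀ = a₁) (ht1 : t a₁ = a₀)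
    (hR : a₀ * a₂ + v * a₁ - a₁ * (a₀ + a₂) = 1) (f : F) :
    klProd 3 (symOp s a₀) (symOp t a₂) f = klProd 3 (symOp t a₂) (symOp s a₀) f := by
  rw [klProd_symOp_three_aux hs hv hv' hs0 hs1 hs2 ht2 ht0 ht1 hR,
    klProd_symOp_three_aux ht hv' hv ht2 ht1 ht0 hs0 hs2 hs1 (by linear_combination hR),
    show a₂ * a₁ * a₀ * f = a₀ * a₁ * a₂ * f by ring]
  linear_combination hst (a₀ * a₁ * a₂ * f)

theorem klProd_symOp_four (hs : ∀ f, s (s f) = f) (ht : ∀ f, t (t f) = f)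
    (hst : ∀ f, s (t (s (t f))) = t (s (t (s f)))) {a₀ a₁ a₂ a₃ : F}
    (hv : s v = v) (hv' : t v = v) (hs0 : s a₀ = v - a₀) (hs1 : s a₁ = a₃) (hs2 : s a₂ = a₂)
    (hs3 : s a₃ = a₁) (ht3 : t a₃ = v - a₃) (ht0 : t a₀ = a₂) (ht1 : t a₁ = a₁)
    (ht2 : t a₂ = a₀)
    (hR : a₀ * a₃ + v * (a₁ + a₂) - (a₀ * a₁ + a₁ * a₂ + a₂ * a₃) = 2) (f : F) :
    klProd 4 (symOp s a₀) (symOp t a₃) f = klProd 4 (symOp t a₃) (symOp s a₀) f := by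
  rw [klProd_symOp_four_aux hs ht hv hv' hs0 hs1 hs2 hs3 ht3 ht0 ht1 ht2 hR,
    klProd_symOp_four_aux ht hs hv' hv ht3 ht2 ht1 ht0 hs0 hs3 hs2 hs1
      (by linear_combination hR),
    show a₃ * a₂ * a₁ * a₀ * f = a₀ * a₁ * a₂ * a₃ * f by ring]
  linear_combination hst (a₀ * a₁ * a₂ * a₃ * f)

theorem klProd_symOp_six (hs : ∀ f, s (s f) = f) (ht : ∀ f, t (t f) = f)
    (hst : ∀ f, s (t (s (t (s (t f))))) = t (s (t (s (t (s f)))))) {a₀ a₁ a₂ a₃ a₄ a₅ : F}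
    (hv : s v = v) (hv' : t v = v) (hs0 : s a₀ = v - a₀) (hs1 : s a₁ = a₅) (hs2 : s a₂ = a₄)
    (hs3 : s a₃ = a₃) (hs4 : s a₄ = a₂) (hs5 : s a₅ = a₁) (ht5 : t a₅ = v - a₅)
    (ht0 : t a₀ = a₄) (ht1 : t a₁ = a₃) (ht2 : t a₂ = a₂) (ht3 : t a₃ = a₁) (ht4 : t a₄ = a₀)
    (h015 : a₀ * a₅ + v * a₁ - a₁ * (a₀ + a₅) = 1)
    (h123 : a₁ * a₃ + v * a₂ - a₂ * (a₁ + a₃) = 1)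
    (h135 : a₁ * a₅ + v * a₃ - a₃ * (a₁ + a₅) = 1)
    (h345 : a₃ * a₅ + v * a₄ - a₄ * (a₃ + a₅) = 1)
    (h024 : a₀ * a₄ + v * a₂ - a₂ * (a₀ + a₄) = 1) (f : F) :
    klProd 6 (symOp s a₀) (symOp t a₅) f = klProd 6 (symOp t a₅) (symOp s a₀) f := by
  have hR : a₀ * a₅ + v * (a₁ + a₂ + a₃ + a₄) -
      (a₀ * a₁ + a₁ * a₂ + a₂ * a₃ + a₃ * a₄ + a₄ * a₅) = 4 := by
    linear_combination h015 + h123 + h135 + h345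
  have hQ : a₃*a₄*v^2 - a₃*a₄^2*v - a₃*a₄*a₅*v + a₃*a₄^2*a₅ + a₄^2*v^2 - 2*a₄^2*a₅*v
      + a₄^2*a₅^2
      + 2*a₀*a₄*a₅*v - 2*a₀*a₄*a₅^2 + a₀^2*a₅^2 + 2*a₀*a₁*a₅*v - 2*a₀^2*a₁*a₅ + a₁*a₄*v^2
      - a₁*a₄*a₅*v - a₀*a₁*a₄*v + a₀*a₁*a₄*a₅ + a₁^2*v^2 - 2*a₀*a₁^2*v + a₀^2*a₁^2 + a₁*a₂*v^2
      - a₁^2*a₂*v - a₀*a₁*a₂*v + a₀*a₁^2*a₂ - 4*a₄*v + 4*a₄*a₅ - 4*a₀*a₅ - 4*a₁*v + 4*a₀*a₁ + 3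
      - a₁*a₂*a₃*a₄ = 0 := by
    -- The five hypotheses correspond to the five ways of writing a positive root of `G₂` as a sum
    -- of two positive roots; the coefficients certify `hQ` as a consequence of them.
    linear_combination (-3 - a₀*a₁ + a₀*a₅ - a₁*a₂ + a₁*a₅ + a₁*v - a₂*a₄ + a₂*v + a₃*a₄
        - a₃*a₅ - a₄*a₅ + a₄*v) * h015 + (a₀*a₄ - a₀*a₅ + a₁*a₅) * h123
      + (a₁*a₅ - a₄*a₅ + a₄*v) * h135
      + (-1 - a₀*a₂ + a₀*a₅ + a₁*a₂ - a₄*a₅ + a₄*v) * h345 + h024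
  rw [klProd_symOp_six_aux hs ht hv hv' hs0 hs1 hs2 hs3 hs4 hs5 ht5 ht0 ht1 ht2 ht3 ht4 hR hQ,
    klProd_symOp_six_aux ht hs hv' hv ht5 ht4 ht3 ht2 ht1 ht0 hs0 hs5 hs4 hs3 hs2 hs1
      (by linear_combination hR) (by linear_combination hQ),
    show a₅ * a₄ * a₃ * a₂ * a₁ * a₀ * f = a₀ * a₁ * a₂ * a₃ * a₄ * a₅ * f by ring]
  linear_combination hst (a₀ * a₁ * a₂ * a₃ * a₄ * a₅ * f)

end RankTwo

/-! ### Braid relations for the Demazure-Lusztig operators, by type of rank two system. -/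

section Braid

variable {ι M N : Type*} [AddCommGroup M] [Module ℝ M] [AddCommGroup N] [Module ℝ N]
variable {P : RootPairing ι ℝ M N}

/-- The arbitrary summand `z` lets equalities between words in two reflections be checked on all of
`M`, not only on the plane of the two roots. -/
theorem sRefl_smul_add {i j : ι} {a : ℝ} (h : P.coroot' i (P.root j) = -a) (z : M) (x y : ℝ) :
    sRefl P i • (z + x • P.root i + y • P.root j) =
      z + (-x + a * y - P.coroot' i z) • P.root i + y • P.root j := by
  rw [sRefl_smul_root, map_add, map_add, map_smul, map_smul, h, P.root_coroot'_eq_pairing,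
    P.pairing_same]
  simp only [smul_eq_mul]
  module

theorem sRefl_smul_add' {i j : ι} {c : ℝ} (h : P.coroot' j (P.root i) = -c) (z : M) (x y : ℝ) :
    sRefl P j • (z + x • P.root i + y • P.root j) =
      z + x • P.root i + (c * x - y - P.coroot' j z) • P.root j := by
  rw [add_right_comm, sRefl_smul_add h]
  module

theorem sRefl_smul_comb {i j : ι} {a : ℝ} (h : P.coroot' i (P.root j) = -a) (x y : ℝ) :
    sRefl P i • (x • P.root i + y • P.root j) = (-x + a * y) • P.root i + y • P.root j := by
  have := sRefl_smul_add h 0 x y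
  simpa using this

theorem sRefl_smul_comb' {i j : ι} {c : ℝ} (h : P.coroot' j (P.root i) = -c) (x y : ℝ) :
    sRefl P j • (x • P.root i + y • P.root j) = x • P.root i + (c * x - y) • P.root j := by
  have := sRefl_smul_add' h 0 x y
  simpa using this

theorem smul_index_eq {w : P.weylGroup} {k l : ι} (h : w • P.root k = P.root l) : w • k = l :=
  P.root.injective (by rw [root_weyl_smul, h])

theorem altProd_sRefl_two {i j : ι} (hi : P.coroot' i (P.root j) = -0)
    (hj : P.coroot' j (P.root i) = -0) :
    altProd 2 (sRefl P i) (sRefl P j) = altProd 2 (sRefl P j) (sRefl P i) := by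
  apply weyl_ext
  intro z
  -- Zero coefficients bring `z` into the shape on which both coordinate formulas act. The
  -- hypotheses are written with `-0` to match the `-a` of those formulas.
  have e : z = z + (0 : ℝ) • P.root i + (0 : ℝ) • P.root j := by module
  rw [e]
  simp only [altProd, mul_smul, one_smul, sRefl_smul_add hi, sRefl_smul_add' hj]
  module

theorem altProd_sRefl_three {i j : ι} (hi : P.coroot' i (P.root j) = -1)
    (hj : P.coroot' j (P.root i) = -1) :
    altProd 3 (sRefl P i) (sRefl P j) = altProd 3 (sRefl P j) (sRefl P i) := by
  apply weyl_ext
  intro z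
  have e : z = z + (0 : ℝ) • P.root i + (0 : ℝ) • P.root j := by module
  rw [e]
  simp only [altProd, mul_smul, one_smul, sRefl_smul_add hi, sRefl_smul_add' hj]
  module

theorem altProd_sRefl_four {i j : ι} (hi : P.coroot' i (P.root j) = -1)
    (hj : P.coroot' j (P.root i) = -2) :
    altProd 4 (sRefl P i) (sRefl P j) = altProd 4 (sRefl P j) (sRefl P i) := by
  apply weyl_ext
  intro z
  have e : z = z + (0 : ℝ) • P.root i + (0 : ℝ) • P.root j := by module
  rw [e]
  simp only [altProd, mul_smul, one_smul, sRefl_smul_add hi, sRefl_smul_add' hj]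
  module

theorem altProd_sRefl_six {i j : ι} (hi : P.coroot' i (P.root j) = -1)
    (hj : P.coroot' j (P.root i) = -3) :
    altProd 6 (sRefl P i) (sRefl P j) = altProd 6 (sRefl P j) (sRefl P i) := by
  apply weyl_ext
  intro z
  have e : z = z + (0 : ℝ) • P.root i + (0 : ℝ) • P.root j := by module
  rw [e]
  simp only [altProd, mul_smul, one_smul, sRefl_smul_add hi, sRefl_smul_add' hj]
  module

variable [P.IsCrystallographic]

theorem algebraMap_klProd (n : ℕ) (i j : ι) (f : GroupAlg P) :
    algebraMap _ (FracAlg P) ((klProd n (dlOp i + q (-1) • (1 : Module.End K (GroupAlg P)))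
      (dlOp j + q (-1) • (1 : Module.End K (GroupAlg P))) : Module.End K (GroupAlg P)) f) =
    klProd n (symOp (fracAct P (sRefl P i)) (cFrac P i))
      (symOp (fracAct P (sRefl P j)) (cFrac P j)) (algebraMap _ _ f) := by
  induction n using Nat.twoStepInduction generalizing i j with
  | zero => exact map_zero _
  | one => exact algebraMap_dlOp_add i f
  | more n ih1 ih2 =>
    rw [klProd, klProd, LinearMap.sub_apply, map_sub, Module.End.mul_apply, algebraMap_dlOp_add,
      ih1, ih2]
    rfl

theorem dlOp_altProd_of_klProd {i j : ι} {n : ℕ}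
    (h : ∀ f, klProd n (symOp (fracAct P (sRefl P i)) (cFrac P i))
      (symOp (fracAct P (sRefl P j)) (cFrac P j)) f =
      klProd n (symOp (fracAct P (sRefl P j)) (cFrac P j))
      (symOp (fracAct P (sRefl P i)) (cFrac P i)) f) :
    altProd n (dlOp i : Module.End K (GroupAlg P)) (dlOp j) = altProd n (dlOp j) (dlOp i) := by
  apply altProd_comm_of_klProd_comm (R := K) (A := Module.End K (GroupAlg P)) q_one_mul (dlOp_mul_self i) (dlOp_mul_self j)
  refine LinearMap.ext fun f => ?_
  apply IsFractionRing.injective (GroupAlg P) (FracAlg P)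
  rw [algebraMap_klProd, algebraMap_klProd, h]

theorem fracAct_sRefl_sRefl (i : ι) (f : FracAlg P) :
    fracAct P (sRefl P i) (fracAct P (sRefl P i) f) = f := by
  rw [← fracAct_mul, sRefl_mul_self, fracAct_one]

theorem fracAct_sRefl_cFrac_self (i : ι) :
    fracAct P (sRefl P i) (cFrac P i) = qFrac P 1 + qFrac P (-1) - cFrac P i := by
  rw [fracAct_cFrac, sRefl_smul_self, cFrac_neg]

theorem fracAct_v (w : P.weylGroup) :
    fracAct P w (qFrac P 1 + qFrac P (-1)) = qFrac P 1 + qFrac P (-1) := by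
  rw [map_add, fracAct_qFrac, fracAct_qFrac]

theorem fracAct_cFrac_eq {w : P.weylGroup} {k l : ι} (h : w • P.root k = P.root l) :
    fracAct P w (cFrac P k) = cFrac P l := by
  rw [fracAct_cFrac, smul_index_eq h]

theorem dlOp_braid_two {i j : ι} (hi : P.coroot' i (P.root j) = -0)
    (hj : P.coroot' j (P.root i) = -0) :
    altProd 2 (dlOp i : Module.End K (GroupAlg P)) (dlOp j) = altProd 2 (dlOp j) (dlOp i) := by
  have hW := altProd_sRefl_two hi hj
  simp only [altProd, mul_one] at hW
  apply dlOp_altProd_of_klProd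
  refine klProd_symOp_two (fun f => ?_) ?_ ?_
  · rw [← fracAct_mul, ← fracAct_mul, hW]
  · apply fracAct_cFrac_eq
    rw [sRefl_smul_root, hi]; module
  · apply fracAct_cFrac_eq
    rw [sRefl_smul_root, hj]; module

theorem dlOp_braid_three {i j : ι} (hi : P.coroot' i (P.root j) = -1)
    (hj : P.coroot' j (P.root i) = -1) :
    altProd 3 (dlOp i : Module.End K (GroupAlg P)) (dlOp j) = altProd 3 (dlOp j) (dlOp i) := by
  have hW := altProd_sRefl_three hi hj
  simp only [altProd, mul_one] at hW
  set k := sRefl P i • j with hk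
  have r0 : P.root i = (1 : ℝ) • P.root i + (0 : ℝ) • P.root j := by module
  have r2 : P.root j = (0 : ℝ) • P.root i + (1 : ℝ) • P.root j := by module
  have r1 : P.root k = (1 : ℝ) • P.root i + (1 : ℝ) • P.root j := by
    rw [hk, root_weyl_smul, r2, sRefl_smul_comb hi]; module
  apply dlOp_altProd_of_klProd
  refine klProd_symOp_three (a₁ := cFrac P k) (fracAct_sRefl_sRefl i) (fracAct_sRefl_sRefl j)
    (fun f => ?_) (fracAct_v _) (fracAct_v _) (fracAct_sRefl_cFrac_self i) (fracAct_cFrac_eq ?_)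
    (fracAct_cFrac_eq ?_) (fracAct_sRefl_cFrac_self j) (fracAct_cFrac_eq ?_)
    (fracAct_cFrac_eq ?_) (cFrac_add ?_)
  · simp only [← fracAct_mul, hW]
  · rw [r1, sRefl_smul_comb hi]; module
  · rw [r1, r2, sRefl_smul_comb hi]; module
  · rw [r1, r0, sRefl_smul_comb' hj]; module
  · rw [r1, sRefl_smul_comb' hj]; module
  · rw [r1]; module

/-- Here `α_i` is the long root. The functions `a₀, …, a₃` belong to the positive roots in the
convex order `α_i`, `α_i + α_j`, `α_i + 2α_j`, `α_j`, and each simple reflection reverses the three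
roots other than its own. -/
theorem dlOp_braid_four {i j : ι} (hi : P.coroot' i (P.root j) = -1)
    (hj : P.coroot' j (P.root i) = -2) :
    altProd 4 (dlOp i : Module.End K (GroupAlg P)) (dlOp j) = altProd 4 (dlOp j) (dlOp i) := by
  have hW := altProd_sRefl_four hi hj
  simp only [altProd, mul_one] at hW
  set k₁ := sRefl P i • j with hk₁
  set k₂ := sRefl P j • i with hk₂
  have r0 : P.root i = (1 : ℝ) • P.root i + (0 : ℝ) • P.root j := by module
  have r3 : P.root j = (0 : ℝ) • P.root i + (1 : ℝ) • P.root j := by module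
  have r1 : P.root k₁ = (1 : ℝ) • P.root i + (1 : ℝ) • P.root j := by
    rw [hk₁, root_weyl_smul, r3, sRefl_smul_comb hi]; module
  have r2 : P.root k₂ = (1 : ℝ) • P.root i + (2 : ℝ) • P.root j := by
    rw [hk₂, root_weyl_smul, r0, sRefl_smul_comb' hj]; module
  have c1 := cFrac_add (P := P) (i := i) (j := j) (k := k₁) (by rw [r1]; module)
  have c2 := cFrac_add (P := P) (i := k₁) (j := j) (k := k₂) (by rw [r1, r2]; module)
  apply dlOp_altProd_of_klProd
  refine klProd_symOp_four (a₁ := cFrac P k₁) (a₂ := cFrac P k₂) (fracAct_sRefl_sRefl i)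
    (fracAct_sRefl_sRefl j) (fun f => ?_) (fracAct_v _) (fracAct_v _)
    (fracAct_sRefl_cFrac_self i) (fracAct_cFrac_eq ?_) (fracAct_cFrac_eq ?_)
    (fracAct_cFrac_eq ?_) (fracAct_sRefl_cFrac_self j) (fracAct_cFrac_eq ?_)
    (fracAct_cFrac_eq ?_) (fracAct_cFrac_eq ?_) (by linear_combination c1 + c2)
  · simp only [← fracAct_mul, hW]
  · rw [r1, sRefl_smul_comb hi]; module
  · rw [r2, sRefl_smul_comb hi]; module
  · rw [r1, r3, sRefl_smul_comb hi]; module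
  · rw [r2, r0, sRefl_smul_comb' hj]; module
  · rw [r1, sRefl_smul_comb' hj]; module
  · rw [r2, sRefl_smul_comb' hj]; module

/-- Again `α_i` is long; the convex order is `α_i`, `α_i + α_j`, `2α_i + 3α_j`, `α_i + 2α_j`, `α_i +
3α_j`, `α_j`. -/
theorem dlOp_braid_six {i j : ι} (hi : P.coroot' i (P.root j) = -1)
    (hj : P.coroot' j (P.root i) = -3) :
    altProd 6 (dlOp i : Module.End K (GroupAlg P)) (dlOp j) = altProd 6 (dlOp j) (dlOp i) := by
  have hW := altProd_sRefl_six hi hj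
  simp only [altProd, mul_one] at hW
  set k₁ := sRefl P i • j with hk₁
  set k₄ := sRefl P j • i with hk₄
  set k₃ := sRefl P j • k₁ with hk₃
  set k₂ := sRefl P i • k₄ with hk₂
  have r0 : P.root i = (1 : ℝ) • P.root i + (0 : ℝ) • P.root j := by module
  have r5 : P.root j = (0 : ℝ) • P.root i + (1 : ℝ) • P.root j := by module
  have r1 : P.root k₁ = (1 : ℝ) • P.root i + (1 : ℝ) • P.root j := by
    rw [hk₁, root_weyl_smul, r5, sRefl_smul_comb hi]; module
  have r4 : P.root k₄ = (1 : ℝ) • P.root i + (3 : ℝ) • P.root j := by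
    rw [hk₄, root_weyl_smul, r0, sRefl_smul_comb' hj]; module
  have r3 : P.root k₃ = (1 : ℝ) • P.root i + (2 : ℝ) • P.root j := by
    rw [hk₃, root_weyl_smul, r1, sRefl_smul_comb' hj]; module
  have r2 : P.root k₂ = (2 : ℝ) • P.root i + (3 : ℝ) • P.root j := by
    rw [hk₂, root_weyl_smul, r4, sRefl_smul_comb hi]; module
  apply dlOp_altProd_of_klProd
  refine klProd_symOp_six (a₁ := cFrac P k₁) (a₂ := cFrac P k₂) (a₃ := cFrac P k₃)
    (a₄ := cFrac P k₄) (fracAct_sRefl_sRefl i)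
    (fracAct_sRefl_sRefl j) (fun f => ?_) (fracAct_v _) (fracAct_v _)
    (fracAct_sRefl_cFrac_self i) (fracAct_cFrac_eq ?_) (fracAct_cFrac_eq ?_)
    (fracAct_cFrac_eq ?_) (fracAct_cFrac_eq ?_) (fracAct_cFrac_eq ?_)
    (fracAct_sRefl_cFrac_self j) (fracAct_cFrac_eq ?_)
    (fracAct_cFrac_eq ?_) (fracAct_cFrac_eq ?_) (fracAct_cFrac_eq ?_) (fracAct_cFrac_eq ?_)
    (cFrac_add ?_) (cFrac_add ?_) (cFrac_add ?_) (cFrac_add ?_) (cFrac_add ?_)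
  · simp only [← fracAct_mul, hW]
  · rw [r1, sRefl_smul_comb hi]; module
  · rw [r2, r4, sRefl_smul_comb hi]; module
  · rw [r3, sRefl_smul_comb hi]; module
  · rw [r4, r2, sRefl_smul_comb hi]; module
  · rw [r1, r5, sRefl_smul_comb hi]; module
  · rw [r4, r0, sRefl_smul_comb' hj]; module
  · rw [r1, r3, sRefl_smul_comb' hj]; module
  · rw [r2, sRefl_smul_comb' hj]; module
  · rw [r3, r1, sRefl_smul_comb' hj]; module
  · rw [r4, sRefl_smul_comb' hj]; module
  · rw [r1]; module
  · rw [r1, r2, r3]; module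
  · rw [r1, r3]; module
  · rw [r3, r4]; module
  · rw [r2, r4]; module

end Braid

end

end AffineHecke

namespace AffineHecke

open scoped TensorProduct

noncomputable section

set_option linter.unusedSectionVars false

/-! ### The polynomial representation of the affine Hecke algebra. -/

section PolynomialRepresentation

variable {ι M N : Type*} [AddCommGroup M] [Module ℝ M] [AddCommGroup N] [Module ℝ N]
variable {P : RootPairing ι ℝ M N}
variable [Finite ι] [P.IsRootSystem] [P.IsCrystallographic] [P.IsReduced] {b : P.Base}

/-- Simple roots have height one, so an element that moves `α_i` to another height is not the
identity. This bounds the orders of the products `s_i s_j` from below. -/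
theorem comb_smul_ne {i j : b.support} {w : P.weylGroup} {x y : ℝ}
    (h : w • P.root (i : ι) = x • P.root (i : ι) + y • P.root (j : ι)) (hxy : x + y ≠ 1) :
    w ≠ 1 := by
  rintro rfl
  have := congrArg (heightFun b) h
  rw [one_smul, map_add, LinearMap.map_smul, LinearMap.map_smul, heightFun_root_simple,
    heightFun_root_simple] at this
  simp only [smul_eq_mul, mul_one] at this
  exact hxy this.symm

theorem sRefl_mul_pow_of_altProd {i j : ι} {n : ℕ}
    (h : altProd n (sRefl P i) (sRefl P j) = altProd n (sRefl P j) (sRefl P i)) :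
    (sRefl P i * sRefl P j) ^ n = 1 :=
  mul_pow_eq_one_of_altProd_comm (sRefl_mul_self i) (sRefl_mul_self j) h

theorem orderOf_sRefl_two {i j : b.support} (hi : P.coroot' i (P.root j) = -0)
    (hj : P.coroot' j (P.root i) = -0) :
    orderOf (sRefl P (i : ι) * sRefl P (j : ι)) = 2 := by
  have r0 : P.root i = (1 : ℝ) • P.root i + (0 : ℝ) • P.root j := by module
  have e : (sRefl P (i : ι) * sRefl P (j : ι)) • P.root i =
      (-1 : ℝ) • P.root i + (0 : ℝ) • P.root j := by
    rw [r0, mul_smul, sRefl_smul_comb' hj, sRefl_smul_comb hi]; module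
  have : Fact (Nat.Prime 2) := ⟨Nat.prime_two⟩
  exact orderOf_eq_prime (sRefl_mul_pow_of_altProd (altProd_sRefl_two hi hj))
    (comb_smul_ne e (by norm_num))

theorem orderOf_sRefl_three {i j : b.support} (hij : i ≠ j) (hi : P.coroot' i (P.root j) = -1)
    (hj : P.coroot' j (P.root i) = -1) :
    orderOf (sRefl P (i : ι) * sRefl P (j : ι)) = 3 := by
  have r0 : P.root i = (1 : ℝ) • P.root i + (0 : ℝ) • P.root j := by module
  have e : (sRefl P (i : ι) * sRefl P (j : ι)) • P.root i = P.root j := by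
    rw [r0, mul_smul, sRefl_smul_comb' hj, sRefl_smul_comb hi]; module
  have : Fact (Nat.Prime 3) := ⟨Nat.prime_three⟩
  -- `α_i` is sent to `α_j`, of the same height, so here the two roots have to be distinguished
  -- directly.
  refine orderOf_eq_prime (sRefl_mul_pow_of_altProd (altProd_sRefl_three hi hj)) fun h => hij ?_
  rw [h, one_smul] at e
  exact Subtype.ext (P.root.injective e)

theorem orderOf_sRefl_four {i j : b.support} (hi : P.coroot' i (P.root j) = -1)
    (hj : P.coroot' j (P.root i) = -2) :
    orderOf (sRefl P (i : ι) * sRefl P (j : ι)) = 4 := by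
  have r0 : P.root i = (1 : ℝ) • P.root i + (0 : ℝ) • P.root j := by module
  have e : ((sRefl P (i : ι) * sRefl P (j : ι)) ^ 2) • P.root i =
      (-1 : ℝ) • P.root i + (0 : ℝ) • P.root j := by
    rw [r0, pow_two]
    simp only [mul_smul, sRefl_smul_comb' hj, sRefl_smul_comb hi]
    module
  have : Fact (Nat.Prime 2) := ⟨Nat.prime_two⟩
  exact orderOf_eq_prime_pow (p := 2) (n := 1) (comb_smul_ne e (by norm_num))
    (sRefl_mul_pow_of_altProd (altProd_sRefl_four hi hj))

theorem orderOf_sRefl_six {i j : b.support} (hi : P.coroot' i (P.root j) = -1)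
    (hj : P.coroot' j (P.root i) = -3) :
    orderOf (sRefl P (i : ι) * sRefl P (j : ι)) = 6 := by
  have r0 : P.root i = (1 : ℝ) • P.root i + (0 : ℝ) • P.root j := by module
  have e2 : ((sRefl P (i : ι) * sRefl P (j : ι)) ^ 2) • P.root i =
      (1 : ℝ) • P.root i + (3 : ℝ) • P.root j := by
    rw [r0, pow_two]
    simp only [mul_smul, sRefl_smul_comb' hj, sRefl_smul_comb hi]
    module
  have e3 : ((sRefl P (i : ι) * sRefl P (j : ι)) ^ 3) • P.root i =
      (-1 : ℝ) • P.root i + (0 : ℝ) • P.root j := by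
    rw [r0, pow_succ, pow_two]
    simp only [mul_smul, sRefl_smul_comb' hj, sRefl_smul_comb hi]
    module
  refine orderOf_eq_of_pow_and_pow_div_prime (by norm_num)
    (sRefl_mul_pow_of_altProd (altProd_sRefl_six hi hj)) fun p hp hdvd => ?_
  have hle : p ≤ 6 := Nat.le_of_dvd (by norm_num) hdvd
  interval_cases p
  · exact absurd hp (by norm_num)
  · exact absurd hp (by norm_num)
  · exact comb_smul_ne e3 (by norm_num)
  · exact comb_smul_ne e2 (by norm_num)
  · exact absurd hp (by norm_num)
  · exact absurd hdvd (by norm_num)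
  · exact absurd hp (by norm_num)

/-- The Demazure-Lusztig operators satisfy the braid relations. -/
theorem dlOp_braid {i j : b.support} (hij : i ≠ j) :
    altProd (orderOf (sRefl P (i : ι) * sRefl P (j : ι)))
      (dlOp (i : ι) : Module.End K (GroupAlg P)) (dlOp (j : ι)) =
    altProd (orderOf (sRefl P (i : ι) * sRefl P (j : ι))) (dlOp (j : ι)) (dlOp (i : ι)) := by
  have hne : (i : ι) ≠ j := fun h => hij (Subtype.ext h)
  have h := P.pairingIn_pairingIn_mem_set_of_isCrystal_of_isRed' i j
    (fun h => hne (P.root.injective h)) (b.root_ne_neg_of_ne i.2 j.2 hne)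
  have h1 := b.pairingIn_le_zero_of_ne hne i.2 j.2
  have hcast : ∀ k l : ι, P.coroot' l (P.root k) = (P.pairingIn ℤ k l : ℝ) := by
    intro k l
    rw [P.root_coroot'_eq_pairing, ← P.algebraMap_pairingIn ℤ]
    rfl
  have hcomm : orderOf (sRefl P (i : ι) * sRefl P (j : ι)) =
      orderOf (sRefl P (j : ι) * sRefl P (i : ι)) := by
    rw [← orderOf_inv, mul_inv_rev, sRefl_inv, sRefl_inv]
  simp only [Set.mem_insert_iff, Set.mem_singleton_iff, Prod.mk.injEq] at h
  have hi := hcast j i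
  have hj := hcast i j
  -- Distinct simple roots pair non-positively, which leaves six of the eleven pairs of Cartan
  -- integers: types `A₁ × A₁` and `A₂`, and `B₂` and `G₂` with either root long.
  rcases h with h | h | h | h | h | h | h | h | h | h | h <;> obtain ⟨h2, h3⟩ := h <;>
    rw [h3] at hi <;> rw [h2] at hj <;> push_cast at hi hj <;> (try (exfalso; lia))
  · rw [orderOf_sRefl_two (by rw [hi, neg_zero]) (by rw [hj, neg_zero])]
    exact dlOp_braid_two (by rw [hi, neg_zero]) (by rw [hj, neg_zero])
  · rw [orderOf_sRefl_three hij hi hj]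
    exact dlOp_braid_three hi hj
  · rw [hcomm, orderOf_sRefl_four hj hi]
    exact (dlOp_braid_four hj hi).symm
  · rw [orderOf_sRefl_four hi hj]
    exact dlOp_braid_four hi hj
  · rw [hcomm, orderOf_sRefl_six hj hi]
    exact (dlOp_braid_six hj hi).symm
  · rw [orderOf_sRefl_six hi hj]
    exact dlOp_braid_six hi hj

theorem map_divDiff {V V' F : Type*} [AddCommGroup V] [AddCommGroup V'] [FunLike F V V']
    [AddMonoidHomClass F V V'] (f : F) (X : weightLattice P → V) (i : ι) (μ : weightLattice P) :
    f (divDiff X i μ) = divDiff (fun ν => f (X ν)) i μ := by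
  unfold divDiff
  split_ifs <;> simp [map_sum]

variable (b) in
/-- The polynomial representation on the free generators. -/
def freeRep : FreeAlg b →ₐ[K] Module.End K (GroupAlg P) :=
  FreeAlgebra.lift K (Sum.elim (fun i : b.support => dlOp (i : ι))
    (fun μ => LinearMap.mulLeft K (xP μ)))

theorem freeRep_T (i : b.support) : freeRep b (freeT b i) = dlOp (i : ι) :=
  FreeAlgebra.lift_ι_apply _ _

theorem freeRep_X (μ : weightLattice P) : freeRep b (freeX b μ) = LinearMap.mulLeft K (xP μ) :=
  FreeAlgebra.lift_ι_apply _ _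

theorem freeRep_rel ⦃x y : FreeAlg b⦄ (h : Rel b x y) : freeRep b x = freeRep b y := by
  induction h with
  | braid i j hij =>
    rw [map_altProd, map_altProd, freeRep_T, freeRep_T, dlOp_braid hij]
  | quadratic i =>
    rw [map_mul, map_add, map_smul, map_one, freeRep_T, dlOp_mul_self]
  | x_zero =>
    rw [freeRep_X, map_one, xP_zero, LinearMap.mulLeft_one]; rfl
  | x_add μ ν =>
    rw [map_mul, freeRep_X, freeRep_X, freeRep_X, ← xP_mul_xP, LinearMap.mulLeft_mul]; rfl
  | bernstein i μ =>
    rw [map_mul, map_add, map_mul, map_smul, map_divDiff, freeRep_T]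
    simp only [freeRep_X]
    refine LinearMap.ext fun f => ?_
    have e : divDiff (fun ν : weightLattice P => LinearMap.mulLeft K (xP ν)) (i : ι) μ f =
        divDiff xP (i : ι) μ * f :=
      (map_divDiff (LinearMap.applyₗ (R := K) f).toAddMonoidHom
        (fun ν : weightLattice P => LinearMap.mulLeft K (xP ν)) (i : ι) μ).trans
        (map_divDiff (AddMonoidHom.mulRight f) xP (i : ι) μ).symm
    rw [LinearMap.add_apply, LinearMap.smul_apply, e]
    exact xP_mul_dlOp (i : ι) μ f

variable (b) in
/-- The polynomial representation of the affine Hecke algebra. -/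
def polyRep : Hecke b →ₐ[K] Module.End K (GroupAlg P) :=
  RingQuot.liftAlgHom K ⟨freeRep b, freeRep_rel⟩

theorem polyRep_Tgen (i : b.support) : polyRep b (Tgen b i) = dlOp (i : ι) := by
  rw [polyRep, Tgen, RingQuot.liftAlgHom_mkAlgHom_apply, freeRep_T]

theorem polyRep_Xgen (μ : weightLattice P) :
    polyRep b (Xgen b μ) = LinearMap.mulLeft K (xP μ) := by
  rw [polyRep, Xgen, RingQuot.liftAlgHom_mkAlgHom_apply, freeRep_X]

/-- Invariant functions have zero divided difference. Thus `1` spans a line on which every `T_i`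
acts by `q`. -/
theorem dlOp_one (i : ι) : dlOp i (1 : GroupAlg P) = q 1 • 1 := by
  have h : divDiffOp i (1 : GroupAlg P) = 0 := by
    have := one_sub_mul_divDiffOp i (1 : GroupAlg P)
    rw [map_one (weylAct P _), sub_self] at this
    exact (mul_eq_zero.1 this).resolve_left (one_sub_xP_ne_zero i)
  rw [dlOp_apply, h, map_one, smul_zero, add_zero]

theorem length_redWord (w : P.weylGroup) : (redWord b w).length = len b w :=
  (redWord_spec b w).length_eq

theorem q_pow (m : ℤ) (n : ℕ) : q m ^ n = q (n * m) := LaurentPolynomial.T_pow m n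

theorem polyRep_Tw_one (w : P.weylGroup) :
    polyRep b (Tw b w) 1 = q (len b w) • (1 : GroupAlg P) := by
  have h : ∀ l : List b.support, polyRep b (l.map (Tgen b)).prod 1 =
      q 1 ^ l.length • (1 : GroupAlg P) := by
    intro l
    induction l with
    | nil => simp
    | cons i l ih =>
      rw [List.map_cons, List.prod_cons, map_mul, Module.End.mul_apply, ih, map_smul,
        polyRep_Tgen, dlOp_one, List.length_cons, pow_succ, mul_smul]
  rw [Tw, h, length_redWord, q_pow, mul_one]

end PolynomialRepresentation

end

end AffineHecke

namespace AffineHecke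

open scoped TensorProduct

noncomputable section

set_option linter.unusedSectionVars false

/-! ### The finite Hecke algebra: multiplication of the `T_w` and the symmetrizers. -/

section FiniteHecke

variable {ι M N : Type*} [AddCommGroup M] [Module ℝ M] [AddCommGroup N] [Module ℝ N]
variable {P : RootPairing ι ℝ M N}
variable [Finite ι] [P.IsRootSystem] [P.IsCrystallographic] [P.IsReduced] {b : P.Base}

theorem Tgen_braid {i j : b.support} (hij : i ≠ j) :
    altProd (orderOf (sRefl P (i : ι) * sRefl P (j : ι))) (Tgen b i) (Tgen b j) =
    altProd (orderOf (sRefl P (i : ι) * sRefl P (j : ι))) (Tgen b j) (Tgen b i) := by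
  rw [Tgen, Tgen, ← map_altProd, ← map_altProd]
  exact RingQuot.mkAlgHom_rel K (Rel.braid i j hij)

theorem Tgen_mul_self (i : b.support) :
    Tgen b i * Tgen b i = (q 1 - q (-1)) • Tgen b i + 1 := by
  have := RingQuot.mkAlgHom_rel K (Rel.quadratic i)
  rwa [map_mul, map_add, map_smul, map_one] at this

theorem Xgen_zero : Xgen b 0 = 1 := by
  have := RingQuot.mkAlgHom_rel K (Rel.x_zero (b := b))
  rwa [map_one] at this

theorem Xgen_mul_Xgen (μ ν : weightLattice P) : Xgen b μ * Xgen b ν = Xgen b (μ + ν) := by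
  have := RingQuot.mkAlgHom_rel K (Rel.x_add (b := b) μ ν)
  rwa [map_mul] at this

theorem Xgen_mul_Tgen (i : b.support) (μ : weightLattice P) :
    Xgen b μ * Tgen b i = Tgen b i * Xgen b (sRefl P (i : ι) • μ) +
      (q 1 - q (-1)) • divDiff (Xgen b) (i : ι) μ := by
  have := RingQuot.mkAlgHom_rel K (Rel.bernstein i μ)
  rwa [map_mul, map_add, map_mul, map_smul, map_divDiff] at this

/-- By Matsumoto's theorem the chosen reduced word may be replaced by one that begins or ends with a
prescribed letter. -/
theorem prod_map_Tgen {w : P.weylGroup} {l : List b.support} (h : IsReducedWord b w l) :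
    (l.map (Tgen b)).prod = Tw b w :=
  prod_map_eq_of_isReducedWord (Tgen b) (fun _ _ hij => Tgen_braid hij) h (redWord_spec b w)

theorem Tgen_mul_Tw_of_isPos {i : b.support} {w : P.weylGroup} (h : b.IsPos (w⁻¹ • (i : ι))) :
    Tgen b i * Tw b w = Tw b (sRefl P (i : ι) * w) := by
  have hw := isReducedWord_iff.1 (redWord_spec b w)
  rw [← prod_map_Tgen (w := sRefl P (i : ι) * w) (l := i :: redWord b w), List.map_cons,
    List.prod_cons, Tw]
  rw [isReducedWord_iff, wordProd_cons, hw.1, List.length_cons, hw.2,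
    len_sRefl_mul_of_isPos i.2 h]
  exact ⟨rfl, rfl⟩

theorem Tgen_mul_Tw_of_not_isPos {i : b.support} {w : P.weylGroup}
    (h : ¬ b.IsPos (w⁻¹ • (i : ι))) :
    Tgen b i * Tw b w = Tw b (sRefl P (i : ι) * w) + (q 1 - q (-1)) • Tw b w := by
  have h' : b.IsPos ((sRefl P (i : ι) * w)⁻¹ • (i : ι)) := by
    rw [mul_inv_rev, sRefl_inv, mul_smul, sRefl_smul_self, weyl_smul_neg, isPos_neg_iff]
    exact h
  have e := Tgen_mul_Tw_of_isPos h'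
  rw [← mul_assoc, sRefl_mul_self, one_mul] at e
  rw [← e, ← mul_assoc, Tgen_mul_self, add_mul, one_mul, smul_mul_assoc, add_comm]

theorem Tw_mul_Tgen_of_isPos {i : b.support} {w : P.weylGroup} (h : b.IsPos (w • (i : ι))) :
    Tw b w * Tgen b i = Tw b (w * sRefl P (i : ι)) := by
  have hw := isReducedWord_iff.1 (redWord_spec b w)
  rw [← prod_map_Tgen (w := w * sRefl P (i : ι)) (l := redWord b w ++ [i]), List.map_append, List.prod_append, Tw]
  · simp
  rw [isReducedWord_iff, wordProd_append, hw.1, List.length_append, hw.2,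
    len_mul_sRefl_of_isPos i.2 h]
  exact ⟨by simp [wordProd], rfl⟩

theorem Tw_mul_Tgen_of_not_isPos {i : b.support} {w : P.weylGroup}
    (h : ¬ b.IsPos (w • (i : ι))) :
    Tw b w * Tgen b i = Tw b (w * sRefl P (i : ι)) + (q 1 - q (-1)) • Tw b w := by
  have h' : b.IsPos ((w * sRefl P (i : ι)) • (i : ι)) := by
    rw [mul_smul, sRefl_smul_self, weyl_smul_neg, isPos_neg_iff]
    exact h
  have e := Tw_mul_Tgen_of_isPos h'
  rw [mul_assoc, sRefl_mul_self, mul_one] at e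
  rw [← e, mul_assoc, Tgen_mul_self, mul_add, mul_one, mul_smul_comm, add_comm]

-- Reindexing by `w ↦ s_i w` turns an eigenvector equation for a combination of the `T_w` into a
-- condition on its coefficients.
open Classical in
theorem Tgen_mul_sum {i : b.support} {c : P.weylGroup → K} {r : K}
    (hc : ∀ w, c (sRefl P (i : ι) * w) +
      (if b.IsPos (w⁻¹ • (i : ι)) then 0 else (q 1 - q (-1)) * c w) = r * c w) :
    Tgen b i * ∑ w, c w • Tw b w = r • ∑ w, c w • Tw b w := by
  have h : ∀ w, Tgen b i * c w • Tw b w = c w • Tw b (sRefl P (i : ι) * w) +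
      (if b.IsPos (w⁻¹ • (i : ι)) then 0 else (q 1 - q (-1)) * c w) • Tw b w := by
    intro w
    rw [mul_smul_comm]
    split_ifs with h
    · rw [Tgen_mul_Tw_of_isPos h, zero_smul, add_zero]
    · rw [Tgen_mul_Tw_of_not_isPos h, smul_add, smul_smul, mul_comm]
  rw [Finset.mul_sum, Finset.sum_congr rfl fun w _ => h w, Finset.sum_add_distrib,
    ← Equiv.sum_comp (Equiv.mulLeft (sRefl P (i : ι))), ← Finset.sum_add_distrib,
    Finset.smul_sum]
  refine Finset.sum_congr rfl fun w _ => ?_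
  rw [Equiv.coe_mulLeft, ← mul_assoc, sRefl_mul_self, one_mul, ← add_smul, hc, mul_smul]

open Classical in
theorem sum_mul_Tgen {i : b.support} {c : P.weylGroup → K} {r : K}
    (hc : ∀ w, c (w * sRefl P (i : ι)) +
      (if b.IsPos (w • (i : ι)) then 0 else (q 1 - q (-1)) * c w) = r * c w) :
    (∑ w, c w • Tw b w) * Tgen b i = r • ∑ w, c w • Tw b w := by
  have h : ∀ w, c w • Tw b w * Tgen b i = c w • Tw b (w * sRefl P (i : ι)) +
      (if b.IsPos (w • (i : ι)) then 0 else (q 1 - q (-1)) * c w) • Tw b w := by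
    intro w
    rw [smul_mul_assoc]
    split_ifs with h
    · rw [Tw_mul_Tgen_of_isPos h, zero_smul, add_zero]
    · rw [Tw_mul_Tgen_of_not_isPos h, smul_add, smul_smul, mul_comm]
  rw [Finset.sum_mul, Finset.sum_congr rfl fun w _ => h w, Finset.sum_add_distrib,
    ← Equiv.sum_comp (Equiv.mulRight (sRefl P (i : ι))), ← Finset.sum_add_distrib,
    Finset.smul_sum]
  refine Finset.sum_congr rfl fun w _ => ?_
  rw [Equiv.coe_mulRight, mul_assoc, sRefl_mul_self, mul_one, ← add_smul, hc, mul_smul]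

variable (b) in
/-- The symmetrizer `∑_w q^ℓ(w) T_w`. -/
def symSum : Hecke b := ∑ w : P.weylGroup, q (len b w) • Tw b w

variable (b) in
/-- The antisymmetrizer `∑_w (-q)^(-ℓ(w)) T_w`. -/
def altSum : Hecke b := ∑ w : P.weylGroup, ((-1 : K) ^ len b w * q (-len b w)) • Tw b w

theorem Tgen_mul_symSum (i : b.support) : Tgen b i * symSum b = q 1 • symSum b := by
  classical
  refine Tgen_mul_sum fun w => ?_
  split_ifs with h
  · rw [len_sRefl_mul_of_isPos i.2 h, q_mul_q, add_zero]; push_cast; rw [add_comm]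
  · rw [← len_sRefl_mul_of_not_isPos i.2 h, sub_mul, q_mul_q, q_mul_q]; push_cast
    rw [show -1 + ((len b (sRefl P (i : ι) * w) : ℤ) + 1) = len b (sRefl P (i : ι) * w) by ring]
    ring

theorem symSum_mul_Tgen (i : b.support) : symSum b * Tgen b i = q 1 • symSum b := by
  classical
  refine sum_mul_Tgen fun w => ?_
  split_ifs with h
  · rw [len_mul_sRefl_of_isPos i.2 h, q_mul_q, add_zero]; push_cast; rw [add_comm]
  · rw [← len_mul_sRefl_of_not_isPos i.2 h, sub_mul, q_mul_q, q_mul_q]; push_cast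
    rw [show -1 + ((len b (w * sRefl P (i : ι)) : ℤ) + 1) = len b (w * sRefl P (i : ι)) by ring]
    ring

theorem altSum_mul_Tgen (i : b.support) : altSum b * Tgen b i = (-q (-1)) • altSum b := by
  classical
  refine sum_mul_Tgen fun w => ?_
  split_ifs with h
  · rw [len_mul_sRefl_of_isPos i.2 h, add_zero, pow_succ]; push_cast
    rw [neg_add, add_comm, ← q_mul_q]
    ring
  · rw [← len_mul_sRefl_of_not_isPos i.2 h, pow_succ]; push_cast
    rw [neg_add, ← q_mul_q]
    linear_combination (-1) ^ len b (w * sRefl P (i : ι)) *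
      q (-len b (w * sRefl P (i : ι))) * (-q_one_mul)

theorem incl_Tgen_mul_one₀ (i : b.support) : incl b (Tgen b i) * one₀ b = q 1 • one₀ b := by
  rw [one₀, mul_smul_comm, ← map_mul, ← symSum, Tgen_mul_symSum, map_smul, smul_comm]

theorem one₀_mul_incl_Tgen (i : b.support) : one₀ b * incl b (Tgen b i) = q 1 • one₀ b := by
  rw [one₀, smul_mul_assoc, ← map_mul, ← symSum, symSum_mul_Tgen, map_smul, smul_comm]

theorem eps₀_mul_incl_Tgen (i : b.support) :
    eps₀ b * incl b (Tgen b i) = (-q (-1)) • eps₀ b := by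
  rw [eps₀, smul_mul_assoc, ← map_mul, ← altSum, altSum_mul_Tgen, map_smul, smul_comm]

theorem polyRep_symSum_one : polyRep b (symSum b) 1 = poincare b 2 • (1 : GroupAlg P) := by
  rw [symSum, map_sum, LinearMap.sum_apply, poincare, Finset.sum_smul]
  refine Finset.sum_congr rfl fun w _ => ?_
  rw [map_smul, LinearMap.smul_apply, polyRep_Tw_one, smul_smul, q_mul_q, q_pow]
  congr 2
  ring

/-- Left multiplication by `s_i` pairs the elements it lengthens with those it shortens, and lengths
within a pair differ by one. -/
theorem one_add_dvd_poincare (i : b.support) : 1 + q 2 ∣ poincare b 2 := by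
  classical
  refine ⟨∑ w with b.IsPos (w⁻¹ • (i : ι)), q 2 ^ len b w, ?_⟩
  rw [poincare, ← Finset.sum_filter_add_sum_filter_not _ (fun w => b.IsPos (w⁻¹ • (i : ι))),
    add_mul, one_mul, Finset.mul_sum]
  congr 1
  have inv : ∀ w : P.weylGroup, (sRefl P (i : ι) * w)⁻¹ • (i : ι) = negRoot P (w⁻¹ • (i : ι)) := by
    intro w
    rw [mul_inv_rev, sRefl_inv, mul_smul, sRefl_smul_self, weyl_smul_neg]
  refine Finset.sum_nbij' (sRefl P (i : ι) * ·) (sRefl P (i : ι) * ·) ?_ ?_ ?_ ?_ ?_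
  · intro w hw
    simp only [Finset.mem_filter, Finset.mem_univ, true_and] at hw ⊢
    rwa [inv, isPos_neg_iff]
  · intro w hw
    simp only [Finset.mem_filter, Finset.mem_univ, true_and] at hw ⊢
    rwa [inv, isPos_neg_iff, not_not]
  · intro w _
    rw [← mul_assoc, sRefl_mul_self, one_mul]
  · intro w _
    rw [← mul_assoc, sRefl_mul_self, one_mul]
  · intro w hw
    simp only [Finset.mem_filter, Finset.mem_univ, true_and] at hw
    rw [← len_sRefl_mul_of_not_isPos i.2 hw, pow_succ']

end FiniteHecke

end

end AffineHecke

namespace AffineHecke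

open scoped TensorProduct

noncomputable section

set_option linter.unusedSectionVars false

/-! ### Dominance, the invariant form, and Weyl group orbits of weights. -/

section Weights

variable {ι M N : Type*} [AddCommGroup M] [Module ℝ M] [AddCommGroup N] [Module ℝ N]
variable {P : RootPairing ι ℝ M N}

theorem wt_eq_iff {x : weightLattice P} {i : ι} {n : ℤ} :
    wt x i = n ↔ P.coroot' i (x : M) = (n : ℝ) := by
  rw [wt_spec]
  exact_mod_cast Iff.rfl

theorem wt_sub (x y : weightLattice P) (i : ι) : wt (x - y) i = wt x i - wt y i := by
  rw [wt_eq_iff]; push_cast; rw [map_sub, wt_spec, wt_spec]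

theorem wt_neg (x : weightLattice P) (i : ι) : wt (-x) i = -wt x i := by
  rw [wt_eq_iff]; push_cast; rw [map_neg, wt_spec]

theorem wt_nsmul (n : ℕ) (x : weightLattice P) (i : ι) : wt (n • x) i = n * wt x i := by
  rw [wt_eq_iff]; push_cast; rw [map_nsmul, wt_spec, nsmul_eq_mul]

theorem coroot'_sRefl_smul (i k : ι) (x : M) :
    P.coroot' (sRefl P i • k) (sRefl P i • x) = P.coroot' k x := by
  change P.toLinearMap (P.reflection i x) (P.coroot (P.reflectionPerm i k)) =
    P.toLinearMap x (P.coroot k)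
  rw [P.coroot_reflectionPerm, P.reflection_apply, P.coreflection_apply, map_sub, map_sub,
    map_smul, map_smul, LinearMap.sub_apply, LinearMap.sub_apply, LinearMap.smul_apply,
    LinearMap.smul_apply, P.root_coroot_eq_pairing, P.root_coroot_eq_pairing, P.pairing_same]
  change _ - _ - _ • (P.coroot' i x - P.coroot' i x • (2 : ℝ)) = _
  simp only [smul_eq_mul]
  ring

theorem wt_weyl_smul (w : P.weylGroup) (x : weightLattice P) (k : ι) :
    wt (w • x) (w • k) = wt x k := by
  obtain ⟨g, hg⟩ := w
  induction hg using RootPairing.weylGroup.induction generalizing x k with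
  | mem i =>
    rw [wt_eq_iff, ← wt_spec]
    exact coroot'_sRefl_smul i k (x : M)
  | one => rw [show (⟨1, one_mem _⟩ : P.weylGroup) = 1 from rfl, one_smul, one_smul]
  | mul g₁ g₂ h₁ h₂ ih₁ ih₂ =>
    rw [show (⟨g₁ * g₂, mul_mem h₁ h₂⟩ : P.weylGroup) = ⟨g₁, h₁⟩ * ⟨g₂, h₂⟩ from rfl,
      mul_smul, mul_smul, ih₁, ih₂]

theorem wt_weyl_smul' (w : P.weylGroup) (x : weightLattice P) (k : ι) :
    wt (w • x) k = wt x (w⁻¹ • k) := by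
  rw [← wt_weyl_smul w x, smul_inv_smul]

theorem wt_negRoot (x : weightLattice P) (k : ι) : wt x (negRoot P k) = -wt x k := by
  have := wt_weyl_smul (sRefl P k) (sRefl P k • x) k
  rw [← mul_smul, sRefl_mul_self, one_smul, sRefl_smul_self] at this
  rw [this, wt_eq_iff, coe_weyl_smul, sRefl_smul_root, LinearMap.map_sub]
  rw [LinearMap.map_smul (P.coroot' k) (P.coroot' k (x : M)) (P.root k),
    P.root_coroot'_eq_pairing, P.pairing_same, wt_spec]
  push_cast
  simp only [smul_eq_mul]
  ring

theorem wt_rootWt_self [P.IsCrystallographic] (i : ι) : wt (rootWt P i) i = 2 := by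
  rw [wt_eq_iff]
  change P.coroot' i (P.root i) = _
  rw [P.root_coroot'_eq_pairing, P.pairing_same]
  norm_num

variable [Finite ι]

/-- The Weyl invariant form `∑_α ⟨x, α^∨⟩ ⟨y, α^∨⟩`, the sum running over all roots. -/
def wtForm (x y : weightLattice P) : ℤ :=
  ∑ k ∈ (Set.toFinite (Set.univ : Set ι)).toFinset, wt x k * wt y k

theorem wtForm_weyl_smul (w : P.weylGroup) (x y : weightLattice P) :
    wtForm (w • x) (w • y) = wtForm x y := by
  refine Finset.sum_nbij' (w⁻¹ • ·) (w • ·) (by simp) (by simp) (by simp) (by simp) ?_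
  intro k _
  rw [wt_weyl_smul', wt_weyl_smul']

theorem wtForm_self_nonneg (x : weightLattice P) : 0 ≤ wtForm x x :=
  Finset.sum_nonneg fun _ _ => mul_self_nonneg _

theorem wtForm_sub_nsmul (x y z : weightLattice P) (n : ℕ) :
    wtForm (x - n • y) z = wtForm x z - n * wtForm y z := by
  simp only [wtForm, wt_sub, wt_nsmul, Finset.mul_sum, ← Finset.sum_sub_distrib]
  exact Finset.sum_congr rfl fun k _ => by ring

theorem wtForm_comm (x y : weightLattice P) : wtForm x y = wtForm y x :=
  Finset.sum_congr rfl fun _ _ => mul_comm _ _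

variable [P.IsCrystallographic]

theorem wtForm_rootWt_pos (i : ι) : 0 < wtForm (rootWt P i) (rootWt P i) := by
  refine lt_of_lt_of_le (b := wt (rootWt P i) i * wt (rootWt P i) i) ?_
    (Finset.single_le_sum (f := fun k => wt (rootWt P i) k * wt (rootWt P i) k)
      (fun _ _ => mul_self_nonneg _) (by simp))
  rw [wt_rootWt_self]; norm_num

theorem wt_add (x y : weightLattice P) (i : ι) : wt (x + y) i = wt x i + wt y i := by
  rw [wt_eq_iff]; push_cast; rw [map_add, wt_spec, wt_spec]

theorem wt_zsmul (n : ℤ) (x : weightLattice P) (i : ι) : wt (n • x) i = n * wt x i := by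
  rw [wt_eq_iff]; push_cast; rw [map_zsmul, wt_spec, zsmul_eq_mul]

/-- Follows from invariance under `s_i`, which negates `α_i`. The form is additive in the root,
whereas the pairing with its coroot is not, so sign conditions pass from simple to positive roots
through it. -/
theorem two_mul_wtForm_rootWt (x : weightLattice P) (i : ι) :
    2 * wtForm x (rootWt P i) = wt x i * wtForm (rootWt P i) (rootWt P i) := by
  have h := wtForm_weyl_smul (sRefl P i) x (rootWt P i)
  rw [← rootWt_weyl_smul, sRefl_smul_self, rootWt_neg, sRefl_smul] at h
  have e : wtForm (x - wt x i • rootWt P i) (-rootWt P i) =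
      wt x i * wtForm (rootWt P i) (rootWt P i) - wtForm x (rootWt P i) := by
    simp only [wtForm, wt_sub, wt_neg, wt_zsmul, Finset.mul_sum, ← Finset.sum_sub_distrib]
    exact Finset.sum_congr rfl fun k _ => by ring
  lia

theorem wtForm_rootWt_add (x : weightLattice P) {i j k : ι} (h : P.root k = P.root i + P.root j) :
    wtForm x (rootWt P k) = wtForm x (rootWt P i) + wtForm x (rootWt P j) := by
  have : rootWt P k = rootWt P i + rootWt P j := Subtype.ext h
  simp only [this, wtForm, wt_add, mul_add, Finset.sum_add_distrib]

/-- The norm drops by `j (⟨x, α^∨⟩ - j) (α, α)`, which is positive strictly inside the root string.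
-/
theorem wtForm_sub_lt {x : weightLattice P} {i : ι} {j : ℕ} (hj : 0 < j)
    (hj' : (j : ℤ) < wt x i) :
    wtForm (x - j • rootWt P i) (x - j • rootWt P i) < wtForm x x := by
  rw [wtForm_sub_nsmul, wtForm_comm x, wtForm_comm (rootWt P i), wtForm_sub_nsmul,
    wtForm_sub_nsmul, wtForm_comm (rootWt P i) x]
  have e := two_mul_wtForm_rootWt x i
  have h1 : (0 : ℤ) < j * (wt x i - j) * wtForm (rootWt P i) (rootWt P i) :=
    mul_pos (mul_pos (by exact_mod_cast hj) (by lia)) (wtForm_rootWt_pos i)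
  nlinarith

theorem wt_nonneg_iff_wtForm (x : weightLattice P) (i : ι) :
    0 ≤ wt x i ↔ 0 ≤ wtForm x (rootWt P i) := by
  have e := two_mul_wtForm_rootWt x i
  have h := wtForm_rootWt_pos (P := P) i
  rw [← mul_nonneg_iff_of_pos_right h, ← e]
  lia

theorem wt_pos_iff_wtForm (x : weightLattice P) (i : ι) :
    0 < wt x i ↔ 0 < wtForm x (rootWt P i) := by
  have e := two_mul_wtForm_rootWt x i
  have h := wtForm_rootWt_pos (P := P) i
  rw [← mul_pos_iff_of_pos_right h, ← e]
  lia

variable [P.IsRootSystem] [P.IsReduced] {b : P.Base}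

variable (b) in
/-- The number of positive roots that pair negatively with `x`. -/
def negCount (x : weightLattice P) : ℕ := {k : ι | b.IsPos k ∧ wt x k < 0}.ncard

/-- `s_i` permutes the positive roots other than `α_i`, and `α_i` itself leaves the set that is
counted. -/
theorem negCount_lt {x : weightLattice P} {i : ι} (hi : i ∈ b.support) (h : wt x i < 0) :
    negCount b (sRefl P i • x) < negCount b x := by
  unfold negCount
  have hinj : Function.Injective (fun j : ι => sRefl P i • j) := MulAction.injective _
  rw [← Set.ncard_image_of_injective _ hinj]
  apply Set.ncard_lt_ncard _ (Set.toFinite _)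
  have hi' : wt (sRefl P i • x) i = -wt x i := by
    rw [wt_weyl_smul', sRefl_inv, sRefl_smul_self, wt_negRoot]
  refine ⟨?_, fun hsub => ?_⟩
  · rintro _ ⟨k, ⟨hk, hk'⟩, rfl⟩
    refine ⟨isPos_sRefl_smul hi hk (by rintro rfl; lia), ?_⟩
    rwa [wt_weyl_smul', sRefl_inv] at hk'
  · obtain ⟨k, ⟨hk, -⟩, hki⟩ := hsub (show i ∈ _ from ⟨b.isPos_of_mem_support hi, h⟩)
    have : k = negRoot P i := by
      rw [← sRefl_smul_sRefl_smul (P := P) i k, show sRefl P i • k = i from hki, sRefl_smul_self]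
    rw [this, isPos_neg_iff] at hk
    exact hk (b.isPos_of_mem_support hi)

theorem mem_dominant_iff {x : weightLattice P} :
    x ∈ dominant b ↔ ∀ i ∈ b.support, 0 ≤ wt x i := by
  refine ⟨fun h i hi => h i (b.isPos_of_mem_support hi), fun h k hk => ?_⟩
  rw [wt_nonneg_iff_wtForm]
  refine hk.induction_on_add (p := fun k => 0 ≤ wtForm x (rootWt P k))
    (fun i hi => (wt_nonneg_iff_wtForm x i).1 (h i hi)) fun i j k hk hi hj => ?_
  rw [wtForm_rootWt_add x hk]
  exact add_nonneg hi ((wt_nonneg_iff_wtForm x j).1 (h j hj))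

theorem mem_strictlyDominant_iff {x : weightLattice P} :
    x ∈ strictlyDominant b ↔ ∀ i ∈ b.support, 0 < wt x i := by
  refine ⟨fun h i hi => h i (b.isPos_of_mem_support hi), fun h k hk => ?_⟩
  rw [wt_pos_iff_wtForm]
  refine hk.induction_on_add (p := fun k => 0 < wtForm x (rootWt P k))
    (fun i hi => (wt_pos_iff_wtForm x i).1 (h i hi)) fun i j k hk hi hj => ?_
  rw [wtForm_rootWt_add x hk]
  exact add_pos hi ((wt_pos_iff_wtForm x j).1 (h j hj))

theorem strictlyDominant_subset : strictlyDominant b ⊆ dominant b := fun _ h i hi => (h i hi).le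

theorem exists_wt_eq_zero {x : weightLattice P} (hx : x ∈ dominant b)
    (hx' : x ∉ strictlyDominant b) : ∃ i ∈ b.support, wt x i = 0 := by
  rw [mem_strictlyDominant_iff] at hx'
  push Not at hx'
  obtain ⟨i, hi, h⟩ := hx'
  exact ⟨i, hi, le_antisymm h (hx i (b.isPos_of_mem_support hi))⟩

theorem sRefl_smul_eq_self {x : weightLattice P} {i : ι} (h : wt x i = 0) :
    sRefl P i • x = x := by
  rw [sRefl_smul, h, zero_smul, sub_zero]

theorem exists_weyl_smul_mem_dominant (x : weightLattice P) :
    ∃ w : P.weylGroup, w • x ∈ dominant b := by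
  induction hn : negCount b x using Nat.strong_induction_on generalizing x with
  | _ n ih =>
    by_cases hx : x ∈ dominant b
    · exact ⟨1, by rwa [one_smul]⟩
    rw [mem_dominant_iff] at hx
    push Not at hx
    obtain ⟨i, hi, h⟩ := hx
    obtain ⟨w, hw⟩ := ih _ (hn ▸ negCount_lt hi h) _ rfl
    exact ⟨w * sRefl P i, by rwa [mul_smul]⟩

theorem exists_not_isPos_smul {w : P.weylGroup} (hw : w ≠ 1) :
    ∃ i ∈ b.support, ¬ b.IsPos (w • i) := by
  by_contra! h
  apply hw
  apply eq_one_of_len_eq_zero (b := b)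
  rw [len, Set.ncard_eq_zero, Set.eq_empty_iff_forall_notMem]
  rintro k ⟨hk, hk'⟩
  refine hk' (hk.induction_on_add (p := fun k => b.IsPos (w • k)) h fun i j k hk hi hj => ?_)
  have hj := h j hj
  rw [isPos_iff_heightFun] at hi hj ⊢
  rw [root_weyl_smul, hk, weyl_smul_add, ← root_weyl_smul, ← root_weyl_smul, map_add]
  exact add_pos hi hj

theorem wt_nonpos_of_not_isPos {x : weightLattice P} (hx : x ∈ dominant b) {k : ι}
    (hk : ¬ b.IsPos k) : wt x k ≤ 0 := by
  rw [← isPos_neg_iff] at hk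
  have := hx _ hk
  rw [wt_negRoot] at this
  lia

/-- Distinct dominant weights lie in distinct Weyl group orbits. -/
theorem weyl_smul_eq_of_mem_dominant {x : weightLattice P} (hx : x ∈ dominant b)
    {w : P.weylGroup} (hw : w • x ∈ dominant b) : w • x = x := by
  induction hn : len b w using Nat.strong_induction_on generalizing w with
  | _ n ih =>
    by_cases h1 : w = 1
    · rw [h1, one_smul]
    obtain ⟨i, hi, h⟩ := exists_not_isPos_smul (b := b) h1
    -- `⟨x, α_i^∨⟩ = ⟨wx, (wα_i)^∨⟩`, where `wx` is dominant and `wα_i` is negative. Hence `s_i`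
    -- fixes `x`, and `w` can be replaced by the shorter `w s_i`.
    have h0 : wt x i = 0 := le_antisymm (by
      rw [← wt_weyl_smul w]; exact wt_nonpos_of_not_isPos hw h) (hx i (b.isPos_of_mem_support hi))
    have e : (w * sRefl P i) • x = w • x := by rw [mul_smul, sRefl_smul_eq_self h0]
    have hlt : len b (w * sRefl P i) < n := by
      have := len_mul_sRefl_of_not_isPos hi h
      lia
    rw [← e]
    exact ih _ hlt (by rwa [e]) rfl

/-- The Weyl group acts freely on the orbit of a strictly dominant weight. -/
theorem eq_one_of_mem_strictlyDominant {x : weightLattice P} (hx : x ∈ strictlyDominant b)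
    {w : P.weylGroup} (hw : w • x = x) : w = 1 := by
  by_contra h1
  obtain ⟨i, hi, h⟩ := exists_not_isPos_smul (b := b) h1
  have := hx i (b.isPos_of_mem_support hi)
  rw [← wt_weyl_smul w, hw] at this
  exact (wt_nonpos_of_not_isPos (strictlyDominant_subset hx) h).not_gt this

end Weights

end

end AffineHecke

namespace AffineHecke

open scoped TensorProduct

noncomputable section

set_option linter.unusedSectionVars false

/-! ### Criteria for a basis of a submodule. -/

section IsBasisOf

variable {A V κ : Type*} [CommRing A] [AddCommGroup V] [Module A V] {S : Submodule A V} {v : κ → V}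

theorem isBasisOf_of_linearIndependent (h : LinearIndependent A v)
    (hS : Submodule.span A (Set.range v) = S) : IsBasisOf S v := by
  subst hS
  exact ⟨Module.Basis.span h, fun k => congrArg Subtype.val (Module.Basis.span_apply h k)⟩

/-- The `φ k` are coordinate functionals: subtracting from `f` its expansion leaves an element
killed by all of them, hence zero. -/
theorem isBasisOf_of_dual [DecidableEq κ] (φ : κ → V →ₗ[A] A) (hv : ∀ k, v k ∈ S)
    (hφ : ∀ k l, φ k (v l) = if k = l then 1 else 0)
    (hfin : ∀ f ∈ S, {k | φ k f ≠ 0}.Finite)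
    (hdet : ∀ f ∈ S, (∀ k, φ k f = 0) → f = 0) : IsBasisOf S v := by
  refine isBasisOf_of_linearIndependent ?_ (le_antisymm ?_ fun f hf => ?_)
  · rw [linearIndependent_iff']
    intro s g hg k hk
    have := congrArg (φ k) hg
    simpa [hφ, hk] using this
  · rw [Submodule.span_le]
    rintro _ ⟨k, rfl⟩
    exact hv k
  · have key := hdet (f - ∑ k ∈ (hfin f hf).toFinset, φ k f • v k)
      (S.sub_mem hf (S.sum_mem fun k _ => S.smul_mem _ (hv k))) fun k => by
        rw [map_sub, map_sum]
        simp only [map_smul, hφ, smul_eq_mul, mul_ite, mul_one, mul_zero, Finset.sum_ite_eq,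
          Set.Finite.mem_toFinset, Set.mem_ofPred_eq]
        split_ifs with h
        · exact sub_self _
        · rw [sub_zero]; simpa using h
    rw [sub_eq_zero.1 key]
    exact Submodule.sum_mem _ fun k _ => Submodule.smul_mem _ _ (Submodule.subset_span ⟨k, rfl⟩)

end IsBasisOf

section EvalOne

/-- The specialization `q = 1`. -/
def evalOne : K →+* ℤ := LaurentPolynomial.eval₂ (RingHom.id ℤ) 1

theorem evalOne_q (n : ℤ) : evalOne (q n) = 1 := by
  rw [evalOne, LaurentPolynomial.eval₂_T, one_zpow, Units.val_one]

end EvalOne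

/-! ### Bases of the symmetric and alternating functions. -/

section Invariants

variable {ι M N : Type*} [AddCommGroup M] [Module ℝ M] [AddCommGroup N] [Module ℝ N]
variable {P : RootPairing ι ℝ M N}
variable [Finite ι] [P.IsRootSystem] [P.IsCrystallographic] [P.IsReduced] {b : P.Base}

theorem finite_coord_ne_zero (D : Set (weightLattice P)) (f : GroupAlg P) :
    {k : D | (xBasis P).coord k f ≠ 0}.Finite := by
  refine Set.Finite.of_finite_image (f := Subtype.val) ?_ Subtype.val_injective.injOn
  refine ((xBasis P).repr f).hasFiniteSupport.subset ?_
  rintro _ ⟨k, hk, rfl⟩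
  exact hk

theorem coord_weylAct (w : P.weylGroup) (f : GroupAlg P) (μ : weightLattice P) :
    (xBasis P).coord (w • μ) (weylAct P w f) = (xBasis P).coord μ f :=
  weylAct_coeff w f μ

open Classical in
theorem coord_xP (μ ν : weightLattice P) :
    (xBasis P).coord ν (xP μ) = if μ = ν then 1 else 0 := by
  rw [← xBasis_apply, Module.Basis.coord_apply, Module.Basis.repr_self, Finsupp.single_apply]

theorem mSym_mem (μ : weightLattice P) : mSym μ ∈ symmFun P := by
  intro w
  rw [mSym, map_sum]
  refine Finset.sum_nbij' (w • ·) (w⁻¹ • ·) ?_ ?_ (by simp) (by simp) ?_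
  · intro γ hγ
    simp only [Set.Finite.mem_toFinset] at hγ ⊢
    exact (MulAction.mem_orbit_of_mem_orbit _ hγ)
  · intro γ hγ
    simp only [Set.Finite.mem_toFinset] at hγ ⊢
    exact (MulAction.mem_orbit_of_mem_orbit _ hγ)
  · intro γ _
    exact weylAct_xP P w γ

open Classical in
theorem coord_mSym {x y : weightLattice P} (hx : x ∈ dominant b) (hy : y ∈ dominant b) :
    (xBasis P).coord y (mSym x) = if y = x then 1 else 0 := by
  rw [mSym, map_sum]
  simp only [coord_xP, Finset.sum_ite_eq', Set.Finite.mem_toFinset]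
  congr 1
  refine propext ⟨?_, fun h => h ▸ MulAction.mem_orbit_self _⟩
  rintro ⟨w, rfl⟩
  exact weyl_smul_eq_of_mem_dominant hx hy

/-- The orbit sums of dominant weights form a basis of the symmetric functions. -/
theorem isBasisOf_mSym :
    IsBasisOf (symmFun P) (fun x : dominant b => mSym (x : weightLattice P)) := by
  classical
  refine isBasisOf_of_dual (fun x => (xBasis P).coord x) (fun x => mSym_mem _) (fun x y => ?_)
    (fun f _ => finite_coord_ne_zero _ f) fun f hf h => ?_
  · rw [coord_mSym y.2 x.2]
    simp only [Subtype.ext_iff]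
  · refine (xBasis P).ext_elem fun μ => ?_
    obtain ⟨w, hw⟩ := exists_weyl_smul_mem_dominant (b := b) μ
    have := h ⟨_, hw⟩
    rw [map_zero, Finsupp.zero_apply, ← Module.Basis.coord_apply, ← coord_weylAct w, hf w]
    exact this

theorem neg_one_pow_len_mul (w v : P.weylGroup) :
    (-1 : K) ^ len b (w * v) = (-1) ^ len b w * (-1) ^ len b v := by
  induction v using weyl_induction b generalizing w with
  | one => rw [mul_one, len_one, pow_zero, mul_one]
  | mul i hi v ih =>
    rw [← mul_assoc, ih, neg_one_pow_len_mul_sRefl _ hi, ih, len_sRefl hi]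
    ring

theorem aAlt_mem (μ : weightLattice P) : aAlt b μ ∈ altFun b := by
  intro v
  rw [aAlt, map_sum, Finset.smul_sum]
  refine Fintype.sum_equiv (Equiv.mulLeft v) _ _ fun w => ?_
  rw [map_smul, Equiv.coe_mulLeft, ← weylAct_mul, neg_one_pow_len_mul, smul_smul, ← mul_assoc,
    ← mul_pow]
  simp

open Classical in
theorem coord_aAlt {x y : weightLattice P} (hx : x ∈ strictlyDominant b)
    (hy : y ∈ strictlyDominant b) :
    (xBasis P).coord y (aAlt b x) = if y = x then 1 else 0 := by
  rw [aAlt, map_sum]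
  simp only [map_smul, weylAct_xP, coord_xP, smul_eq_mul, mul_ite, mul_one, mul_zero]
  split_ifs with h
  · subst h
    rw [Finset.sum_eq_single 1]
    · rw [one_smul, if_pos rfl, len_one, pow_zero]
    · intro w _ hw
      rw [if_neg fun h => hw (eq_one_of_mem_strictlyDominant hx h)]
    · exact fun h => absurd (Finset.mem_univ _) h
  · refine Finset.sum_eq_zero fun w _ => if_neg ?_
    rintro rfl
    exact h (weyl_smul_eq_of_mem_dominant (strictlyDominant_subset hx)
      (strictlyDominant_subset hy))

/-- The alternating sums of strictly dominant weights form a basis of the alternating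
functions. -/
theorem isBasisOf_aAlt :
    IsBasisOf (altFun b) (fun x : strictlyDominant b => aAlt b (x : weightLattice P)) := by
  classical
  refine isBasisOf_of_dual (fun x => (xBasis P).coord x) (fun x => aAlt_mem _) (fun x y => ?_)
    (fun f _ => finite_coord_ne_zero _ f) fun f hf h => ?_
  · rw [coord_aAlt y.2 x.2]
    simp only [Subtype.ext_iff]
  · refine (xBasis P).ext_elem fun μ => ?_
    obtain ⟨w, hw⟩ := exists_weyl_smul_mem_dominant (b := b) μ
    have h0 : (xBasis P).coord (w • μ) f = 0 := by
      by_cases hs : w • μ ∈ strictlyDominant b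
      · exact h ⟨_, hs⟩
      obtain ⟨i, hi, h⟩ := exists_wt_eq_zero hw hs
      have e := coord_weylAct (sRefl P i) f (w • μ)
      rw [sRefl_smul_eq_self h, hf, len_sRefl hi, pow_one, map_smul, neg_smul, one_smul] at e
      -- On a wall the coefficient equals its own negative; specializing at `q = 1` shows that `2`
      -- is nonzero in the domain `𝕂`.
      have h2 : (2 : K) * (xBasis P).coord (w • μ) f = 0 := by linear_combination -e
      refine (mul_eq_zero.1 h2).resolve_left fun h2 => ?_
      have := congrArg evalOne h2
      rw [map_ofNat, map_zero] at this
      exact two_ne_zero this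
    rw [map_zero, Finsupp.zero_apply, ← Module.Basis.coord_apply, ← coord_weylAct w, hf w,
      map_smul, h0, smul_zero]

end Invariants

end

end AffineHecke

namespace AffineHecke

open scoped TensorProduct

noncomputable section

set_option linter.unusedSectionVars false

/-! ### Straightening to dominant weights. -/

section Straightening

variable {ι M N : Type*} [AddCommGroup M] [Module ℝ M] [AddCommGroup N] [Module ℝ N]
variable {P : RootPairing ι ℝ M N}
variable [Finite ι] [P.IsRootSystem] [P.IsCrystallographic] [P.IsReduced] {b : P.Base}

theorem divDiff_mem {A V : Type*} [Ring A] [AddCommGroup V] [Module A V] {S : Submodule A V}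
    {X : weightLattice P → V} (h : ∀ μ, X μ ∈ S) (i : ι) (μ : weightLattice P) :
    divDiff X i μ ∈ S := by
  rw [divDiff]
  split_ifs
  · exact S.sum_mem fun _ _ => h _
  · exact S.neg_mem (S.sum_mem fun _ _ => h _)

/-- A family satisfying the Bernstein straightening relations is spanned by its dominant
members. -/
theorem mem_of_straightening {V : Type*} [AddCommGroup V] [Module K V] {S : Submodule K V}
    {E : weightLattice P → V} {r : K} (hr : IsUnit r)
    (hE : ∀ i ∈ b.support, ∀ μ,
      q 1 • E μ = r • E (sRefl P i • μ) + (q 1 - q (-1)) • divDiff E i μ)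
    (hS : ∀ μ ∈ dominant b, E μ ∈ S) (μ : weightLattice P) : E μ ∈ S := by
  induction hn : (wtForm μ μ).toNat using Nat.strong_induction_on generalizing μ with
  | _ n ih =>
    induction hm : negCount b μ using Nat.strong_induction_on generalizing μ with
    | _ m ih' =>
      by_cases hμ : μ ∈ dominant b
      · exact hS μ hμ
      rw [mem_dominant_iff] at hμ
      push Not at hμ
      obtain ⟨i, hi, h⟩ := hμ
      set ν := sRefl P i • μ with hν
      have hform : wtForm ν ν = wtForm μ μ := wtForm_weyl_smul _ _ _
      have hνi : wt ν i = -wt μ i := by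
        rw [hν, wt_weyl_smul', sRefl_inv, sRefl_smul_self, wt_negRoot]
      have hνS : E ν ∈ S := ih' _ (hm ▸ negCount_lt hi h) ν (by rw [hform, hn]) rfl
      -- The relation is used at `ν = s_i μ`, which pairs positively with `α_i`: then `E μ` carries
      -- the unit coefficient `r`. The term `j = 0` of the sum is `E ν`, covered by the inner
      -- induction, and the others are strictly shorter.
      have key := hE i hi ν
      rw [hν, ← mul_smul, sRefl_mul_self, one_smul, ← hν] at key
      have hd : divDiff E i ν ∈ S := by
        rw [divDiff, if_pos (by lia)]
        refine S.sum_mem fun j hj => ?_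
        rw [Finset.mem_range] at hj
        rcases Nat.eq_zero_or_pos j with rfl | hj0
        · rwa [zero_smul, sub_zero]
        · have := wtForm_sub_lt hj0 (show (j : ℤ) < wt ν i by lia)
          have h0 := wtForm_self_nonneg (ν - j • rootWt P i)
          exact ih _ (by lia) _ rfl
      obtain ⟨u, rfl⟩ := hr
      have : E μ = (↑u⁻¹ : K) • ((q 1) • E ν - (q 1 - q (-1)) • divDiff E i ν) := by
        rw [key, add_sub_cancel_right, smul_smul, Units.inv_mul, one_smul]
      rw [this]
      exact S.smul_mem _ (S.sub_mem (S.smul_mem _ hνS) (S.smul_mem _ hd))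

end Straightening

/-! ### Spanning sets of the sandwiched modules. -/

section Spanning

variable {ι M N : Type*} [AddCommGroup M] [Module ℝ M] [AddCommGroup N] [Module ℝ N]
variable {P : RootPairing ι ℝ M N}
variable [Finite ι] [P.IsRootSystem] [P.IsCrystallographic] [P.IsReduced] {b : P.Base}

variable (b) in
/-- The `𝕂`-span of the elements `x^μ 𝟏₀`. -/
def xSpan : Submodule K (Hecke' b) :=
  Submodule.span K (Set.range fun μ => incl b (Xgen b μ) * one₀ b)

theorem incl_Xgen_mul_one₀_mem (μ : weightLattice P) : incl b (Xgen b μ) * one₀ b ∈ xSpan b :=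
  Submodule.subset_span ⟨μ, rfl⟩

theorem incl_mul_mem_xSpan_of_forall {h : Hecke b}
    (hh : ∀ μ, incl b h * (incl b (Xgen b μ) * one₀ b) ∈ xSpan b) {n : Hecke' b}
    (hn : n ∈ xSpan b) : incl b h * n ∈ xSpan b := by
  induction hn using Submodule.span_induction with
  | mem x hx =>
    obtain ⟨μ, rfl⟩ := hx
    exact hh μ
  | zero => rw [mul_zero]; exact Submodule.zero_mem _
  | add x y _ _ hx hy => rw [mul_add]; exact Submodule.add_mem _ hx hy
  | smul c x _ hx => rw [mul_smul_comm]; exact Submodule.smul_mem _ _ hx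

theorem incl_Xgen_mul_mem_xSpan (ν : weightLattice P) {n : Hecke' b} (hn : n ∈ xSpan b) :
    incl b (Xgen b ν) * n ∈ xSpan b := by
  refine incl_mul_mem_xSpan_of_forall (fun μ => ?_) hn
  rw [← mul_assoc, ← map_mul, Xgen_mul_Xgen]
  exact incl_Xgen_mul_one₀_mem _

theorem incl_divDiff_mul_one₀_mem (i : ι) (μ : weightLattice P) :
    incl b (divDiff (Xgen b) i μ) * one₀ b ∈ xSpan b := by
  have h := map_divDiff ((AddMonoidHom.mulRight (one₀ b)).comp (incl b : Hecke b →+ Hecke' b))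
    (Xgen b) i μ
  change incl b (divDiff (Xgen b) i μ) * one₀ b = _ at h
  rw [h]
  exact divDiff_mem (fun μ => incl_Xgen_mul_one₀_mem μ) i μ

theorem incl_Tgen_mul_mem_xSpan (i : b.support) {n : Hecke' b} (hn : n ∈ xSpan b) :
    incl b (Tgen b i) * n ∈ xSpan b := by
  refine incl_mul_mem_xSpan_of_forall (fun μ => ?_) hn
  -- At the weight `s_i μ` the Bernstein relation contains `T_i x^μ`, and the other `T_i` is
  -- absorbed by `𝟏₀`.
  have e := congrArg (incl b · * one₀ b) (Xgen_mul_Tgen i (sRefl P (i : ι) • μ))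
  simp only [map_add, map_mul, map_smul, add_mul, mul_assoc, incl_Tgen_mul_one₀,
    mul_smul_comm, smul_mul_assoc] at e
  rw [← mul_smul (sRefl P (i : ι)), sRefl_mul_self, one_smul] at e
  refine (Submodule.add_mem_iff_left _ (Submodule.smul_mem _ (q 1 - q (-1))
    (incl_divDiff_mul_one₀_mem (i : ι) (sRefl P (i : ι) • μ)))).1 ?_
  rw [← e]
  exact Submodule.smul_mem _ _ (incl_Xgen_mul_one₀_mem _)

/-- A subset of the affine Hecke algebra that contains the generators and the scalars and is closed
under addition and multiplication is everything. -/
theorem hecke_induction {p : Hecke b → Prop} (scalar : ∀ c : K, p (algebraMap K _ c))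
    (T : ∀ i, p (Tgen b i)) (X : ∀ μ, p (Xgen b μ)) (add : ∀ x y, p x → p y → p (x + y))
    (mul : ∀ x y, p x → p y → p (x * y)) (h : Hecke b) : p h := by
  obtain ⟨h, rfl⟩ := RingQuot.mkAlgHom_surjective K (Rel b) h
  induction h using FreeAlgebra.induction with
  | grade0 c => rw [AlgHom.commutes]; exact scalar c
  | grade1 x =>
    rcases x with i | ν
    · exact T i
    · exact X ν
  | mul x y hx hy => rw [map_mul]; exact mul _ _ hx hy
  | add x y hx hy => rw [map_add]; exact add _ _ hx hy

theorem incl_mul_mem_xSpan (h : Hecke b) {n : Hecke' b} (hn : n ∈ xSpan b) :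
    incl b h * n ∈ xSpan b := by
  induction h using hecke_induction generalizing n with
  | scalar c =>
    rw [Algebra.algebraMap_eq_smul_one, map_smul, map_one, smul_mul_assoc, one_mul]
    exact Submodule.smul_mem _ _ hn
  | T i => exact incl_Tgen_mul_mem_xSpan i hn
  | X ν => exact incl_Xgen_mul_mem_xSpan ν hn
  | mul x y hx hy =>
    rw [map_mul, mul_assoc]
    exact hx (hy hn)
  | add x y hx hy =>
    rw [map_add, add_mul]
    exact Submodule.add_mem _ (hx hn) (hy hn)

theorem incl_mul_one₀_mem (h : Hecke b) : incl b h * one₀ b ∈ xSpan b := by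
  refine incl_mul_mem_xSpan h ?_
  have := incl_Xgen_mul_one₀_mem (b := b) 0
  rwa [Xgen_zero, map_one, one_mul] at this

theorem sandwich_eq_span (e : Hecke' b) :
    sandwich b e (one₀ b) =
      Submodule.span K (Set.range fun μ => e * incl b (Xgen b μ) * one₀ b) := by
  apply le_antisymm
  · rintro _ ⟨h, rfl⟩
    change e * incl b h * one₀ b ∈ _
    have : (xSpan b).map (LinearMap.mulLeft K e) =
        Submodule.span K (Set.range fun μ => e * incl b (Xgen b μ) * one₀ b) := by
      rw [xSpan, Submodule.map_span, ← Set.range_comp]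
      congr 1
      ext x
      simp [mul_assoc]
    rw [← this, mul_assoc]
    exact ⟨_, incl_mul_one₀_mem h, rfl⟩
  · rw [Submodule.span_le]
    rintro _ ⟨μ, rfl⟩
    exact ⟨Xgen b μ, rfl⟩

theorem sandwich'_eq_span (e : Hecke' b) :
    sandwich' b e (one₀ b) =
      Submodule.span (K' b) (sandwich b e (one₀ b) : Set (Hecke' b)) := by
  apply le_antisymm
  · rintro _ ⟨x, rfl⟩
    change e * x * one₀ b ∈ _
    induction x using TensorProduct.induction_on with
    | zero => rw [mul_zero, zero_mul]; exact Submodule.zero_mem _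
    | tmul c h =>
      have : c ⊗ₜ[K] h = c • incl b h := by
        rw [incl, Algebra.TensorProduct.includeRight_apply, TensorProduct.smul_tmul', smul_eq_mul,
          mul_one]
      rw [this, mul_smul_comm, smul_mul_assoc]
      exact Submodule.smul_mem _ _ (Submodule.subset_span ⟨h, rfl⟩)
    | add x y hx hy =>
      rw [mul_add, add_mul]
      exact Submodule.add_mem _ hx hy
  · rw [Submodule.span_le]
    rintro _ ⟨h, rfl⟩
    exact ⟨incl b h, rfl⟩

/-- In the Bernstein relation one `T_i` stands next to `𝟏₀` and becomes `q`, the other next to `e`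
and becomes `r`. -/
theorem bernstein_sandwich {e : Hecke' b} {r : K}
    (he : ∀ i : b.support, e * incl b (Tgen b i) = r • e) (i : b.support) (μ : weightLattice P) :
    q 1 • (e * incl b (Xgen b μ) * one₀ b) =
      r • (e * incl b (Xgen b (sRefl P (i : ι) • μ)) * one₀ b) +
      (q 1 - q (-1)) • divDiff (fun μ => e * incl b (Xgen b μ) * one₀ b) (i : ι) μ := by
  have h := congrArg ((LinearMap.mulLeftRight K (e, one₀ b)).comp (incl b).toLinearMap)
    (Xgen_mul_Tgen i μ)
  rw [map_add, map_smul] at h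
  have hd := map_divDiff ((LinearMap.mulLeftRight K (e, one₀ b)).comp
    (incl b).toLinearMap).toAddMonoidHom (Xgen b) (i : ι) μ
  change e * incl b (Xgen b μ * Tgen b i) * one₀ b =
    e * incl b (Tgen b i * Xgen b (sRefl P (i : ι) • μ)) * one₀ b + _ at h
  rw [map_mul, map_mul, mul_assoc, mul_assoc, incl_Tgen_mul_one₀, mul_smul_comm, mul_smul_comm,
    ← mul_assoc, ← mul_assoc e, he, smul_mul_assoc, smul_mul_assoc] at h
  rw [h]
  congr 2

/-- The elements `e x^λ 𝟏₀` with `λ` dominant span `e H̃ 𝟏₀`. -/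
theorem sandwich_eq_span_dominant {e : Hecke' b} {r : K} (hr : IsUnit r)
    (he : ∀ i : b.support, e * incl b (Tgen b i) = r • e) :
    sandwich b e (one₀ b) =
      Submodule.span K (Set.range fun μ : dominant b => e * incl b (Xgen b μ) * one₀ b) := by
  rw [sandwich_eq_span]
  apply le_antisymm
  · rw [Submodule.span_le]
    rintro _ ⟨μ, rfl⟩
    refine mem_of_straightening (b := b) (E := fun μ => e * incl b (Xgen b μ) * one₀ b) hr
      (fun i hi μ => bernstein_sandwich he ⟨i, hi⟩ μ) (fun μ hμ => ?_) μ
    exact Submodule.subset_span ⟨⟨μ, hμ⟩, rfl⟩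
  · apply Submodule.span_mono
    rintro _ ⟨μ, rfl⟩
    exact ⟨μ, rfl⟩

theorem isUnit_q (n : ℤ) : IsUnit (q n) := LaurentPolynomial.isUnit_T n

/-- When `s_i` fixes `μ` the divided difference vanishes and `q A_μ = -q⁻¹ A_μ` remains, so `1 + q²`
kills `A_μ`; its multiple `W_0(q²)` is invertible in `𝕂'`. -/
theorem AHecke_eq_zero {μ : weightLattice P} {i : ι} (hi : i ∈ b.support) (h : wt μ i = 0) :
    AHecke b μ = 0 := by
  have e := bernstein_sandwich (r := -q (-1)) eps₀_mul_incl_Tgen ⟨i, hi⟩ μ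
  rw [sRefl_smul_eq_self h, divDiff, if_pos h.ge, h] at e
  change q 1 • AHecke b μ = -q (-1) • AHecke b μ + _ at e
  rw [Int.toNat_zero, Finset.sum_range_zero, smul_zero, add_zero] at e
  replace e := congrArg (· + q (-1) • AHecke b μ) e
  simp only [← add_smul, neg_add_cancel, zero_smul] at e
  have e2 := congrArg (q 1 • ·) e
  simp only [smul_smul, smul_zero, mul_add, q_mul_q] at e2
  obtain ⟨c, hc⟩ := one_add_dvd_poincare (b := b) ⟨i, hi⟩
  have e3 : poincare b 2 • AHecke b μ = 0 := by
    have e4 : (q 2 + q 0) • AHecke b μ = 0 := e2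
    have e5 : poincare b 2 = c * (q 2 + q 0) := by rw [hc, q_zero]; ring
    calc poincare b 2 • AHecke b μ = (c * (q 2 + q 0)) • AHecke b μ := congrArg (· • _) e5
      _ = 0 := by rw [mul_smul, e4, smul_zero]
  have hu : IsUnit (algebraMap K (K' b) (poincare b 2)) :=
    IsLocalization.Away.algebraMap_isUnit _
  rw [← algebraMap_smul (K' b)] at e3
  exact hu.smul_eq_zero.1 e3

theorem sandwich_one₀_eq_span :
    sandwich b (one₀ b) (one₀ b) =
      Submodule.span K (Set.range fun μ : dominant b => MHecke b (μ : weightLattice P)) :=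
  sandwich_eq_span_dominant (isUnit_q 1) one₀_mul_incl_Tgen

theorem sandwich_eps₀_eq_span :
    sandwich b (eps₀ b) (one₀ b) =
      Submodule.span K (Set.range fun μ : strictlyDominant b => AHecke b (μ : weightLattice P)) := by
  rw [sandwich_eq_span_dominant (isUnit_q (-1)).neg eps₀_mul_incl_Tgen]
  apply le_antisymm
  · rw [Submodule.span_le]
    rintro _ ⟨μ, rfl⟩
    change AHecke b (μ : weightLattice P) ∈ _
    by_cases h : (μ : weightLattice P) ∈ strictlyDominant b
    · exact Submodule.subset_span ⟨⟨μ, h⟩, rfl⟩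
    · obtain ⟨i, hi, h⟩ := exists_wt_eq_zero μ.2 h
      rw [AHecke_eq_zero hi h]
      exact Submodule.zero_mem _
  · apply Submodule.span_mono
    rintro _ ⟨μ, rfl⟩
    exact ⟨⟨μ, strictlyDominant_subset μ.2⟩, rfl⟩

theorem sandwich'_eq_span_range {e : Hecke' b} {κ : Type*} {v : κ → Hecke' b}
    (h : sandwich b e (one₀ b) = Submodule.span K (Set.range v)) :
    sandwich' b e (one₀ b) = Submodule.span (K' b) (Set.range v) := by
  rw [sandwich'_eq_span, h, Submodule.span_span_of_tower]

end Spanning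

end

end AffineHecke

namespace AffineHecke

open scoped TensorProduct

noncomputable section

set_option linter.unusedSectionVars false

/-! ### Linear independence by specialization at `q = 1`. -/

section Independence

variable {ι M N : Type*} [AddCommGroup M] [Module ℝ M] [AddCommGroup N] [Module ℝ N]
variable {P : RootPairing ι ℝ M N}
variable [Finite ι] [P.IsRootSystem] [P.IsCrystallographic] [P.IsReduced] {b : P.Base}

theorem evalOne_coord_dlOp (i : ι) (f : GroupAlg P) (ν : weightLattice P) :
    evalOne ((xBasis P).coord ν (dlOp i f)) = evalOne ((xBasis P).coord (sRefl P i • ν) f) := by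
  rw [dlOp_apply, map_add, map_smul, map_smul, map_add, smul_eq_mul, smul_eq_mul, map_mul, map_mul,
    map_sub, evalOne_q, evalOne_q, sub_self, zero_mul, add_zero, one_mul,
    ← coord_weylAct (sRefl P i), ← weylAct_mul, sRefl_mul_self, weylAct_one]

theorem evalOne_coord_polyRep_prod (l : List b.support) (f : GroupAlg P) (ν : weightLattice P) :
    evalOne ((xBasis P).coord ν (polyRep b (l.map (Tgen b)).prod f)) =
      evalOne ((xBasis P).coord ((wordProd b l)⁻¹ • ν) f) := by
  induction l generalizing ν with
  | nil => simp [wordProd_nil]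
  | cons i l ih =>
    rw [List.map_cons, List.prod_cons, map_mul, Module.End.mul_apply, polyRep_Tgen,
      evalOne_coord_dlOp, ih, wordProd_cons, mul_inv_rev, sRefl_inv, mul_smul]

/-- At `q = 1`, the polynomial representation becomes the action of the Weyl group. -/
theorem evalOne_coord_polyRep_Tw (w : P.weylGroup) (f : GroupAlg P) (ν : weightLattice P) :
    evalOne ((xBasis P).coord ν (polyRep b (Tw b w) f)) =
      evalOne ((xBasis P).coord (w⁻¹ • ν) f) := by
  rw [Tw, evalOne_coord_polyRep_prod, (redWord_spec b w).1]

open Classical in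
theorem evalOne_coord_polyRep_sum (c : P.weylGroup → K) (μ ν : weightLattice P) :
    evalOne ((xBasis P).coord ν (polyRep b (∑ w, c w • Tw b w) (xP μ))) =
      ∑ w, if w • μ = ν then evalOne (c w) else 0 := by
  rw [map_sum, LinearMap.sum_apply, map_sum, map_sum]
  refine Finset.sum_congr rfl fun w _ => ?_
  rw [map_smul, LinearMap.smul_apply, map_smul, smul_eq_mul, map_mul, evalOne_coord_polyRep_Tw,
    coord_xP]
  simp only [eq_inv_smul_iff]
  split_ifs
  · rw [map_one, mul_one]
  · rw [map_zero, mul_zero]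

theorem evalOne_coord_polyRep_sum_ne (c : P.weylGroup → K) {μ ν : weightLattice P}
    (hμ : μ ∈ dominant b) (hν : ν ∈ dominant b) (h : μ ≠ ν) :
    evalOne ((xBasis P).coord ν (polyRep b (∑ w, c w • Tw b w) (xP μ))) = 0 := by
  classical
  rw [evalOne_coord_polyRep_sum]
  refine Finset.sum_eq_zero fun w _ => if_neg ?_
  rintro rfl
  exact h (weyl_smul_eq_of_mem_dominant hμ hν).symm

/-- The value is the order of the stabilizer of `μ`. -/
theorem evalOne_coord_symSum_ne_zero (μ : weightLattice P) :
    evalOne ((xBasis P).coord μ (polyRep b (symSum b) (xP μ))) ≠ 0 := by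
  classical
  rw [symSum, evalOne_coord_polyRep_sum]
  refine ne_of_gt (Finset.sum_pos' (fun w _ => ?_) ⟨1, Finset.mem_univ _, ?_⟩)
  · split_ifs
    · rw [evalOne_q]; exact zero_le_one
    · exact le_rfl
  · rw [if_pos (one_smul _ _), evalOne_q]; exact zero_lt_one

/-- The stabilizer is trivial, so only `w = 1` contributes and no signs can cancel. -/
theorem evalOne_coord_altSum_ne_zero {μ : weightLattice P} (hμ : μ ∈ strictlyDominant b) :
    evalOne ((xBasis P).coord μ (polyRep b (altSum b) (xP μ))) ≠ 0 := by
  classical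
  rw [altSum, evalOne_coord_polyRep_sum, Finset.sum_eq_single 1]
  · rw [if_pos (one_smul _ _), len_one, pow_zero, one_mul, evalOne_q]
    exact one_ne_zero
  · intro w _ hw
    exact if_neg fun h => hw (eq_one_of_mem_strictlyDominant hμ h)
  · exact fun h => absurd (Finset.mem_univ _) h

theorem poincare_ne_zero : poincare b 2 ≠ 0 := by
  intro h
  have := congrArg evalOne h
  rw [poincare, map_sum, map_zero] at this
  simp only [map_pow, evalOne_q, one_pow, Finset.sum_const, Finset.card_univ, nsmul_eq_mul,
    mul_one, Nat.cast_eq_zero] at this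
  exact Fintype.card_ne_zero this

variable (b) in
theorem powers_poincare_le : Submonoid.powers (poincare b 2) ≤ nonZeroDivisors K :=
  powers_le_nonZeroDivisors_of_noZeroDivisors (M₀ := K) (poincare_ne_zero (b := b))

theorem algebraMap_K'_injective : Function.Injective (algebraMap K (K' b)) :=
  IsLocalization.injective (K' b) (powers_poincare_le b)

instance : IsDomain (K' b) := IsLocalization.isDomain_localization (powers_poincare_le b)

/-- At `q = 1` the finite matrix indexed by `s` is diagonal with nonzero entries, so its determinant
is nonzero in `𝕂` and stays nonzero in `B`. -/
theorem eq_zero_of_evalOne_diagonal {B κ : Type*} [CommRing B] [IsDomain B] [Algebra K B]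
    (hB : Function.Injective (algebraMap K B)) {C : κ → κ → K}
    (hdiag : ∀ k, evalOne (C k k) ≠ 0) (hoff : ∀ k l, l ≠ k → evalOne (C k l) = 0)
    {s : Finset κ} {g : κ → B} (h : ∀ k, ∑ l ∈ s, g l * algebraMap K B (C k l) = 0)
    {k : κ} (hk : k ∈ s) : g k = 0 := by
  classical
  let A : Matrix s s K := Matrix.of fun k l => C k l
  have hdet : evalOne A.det ≠ 0 := by
    rw [RingHom.map_det, show evalOne.mapMatrix A = Matrix.diagonal fun k : s => evalOne (C k k) from ?_,
      Matrix.det_diagonal]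
    · exact Finset.prod_ne_zero_iff.2 fun k _ => hdiag k
    · ext k l
      rw [Matrix.diagonal_apply]
      split_ifs with hkl
      · subst hkl; rfl
      · exact hoff k l fun h' => hkl (Subtype.ext h'.symm)
  have hdet' : ((algebraMap K B).mapMatrix A).det ≠ 0 := by
    rw [← RingHom.map_det, map_ne_zero_iff _ hB]
    intro h0
    rw [h0, map_zero] at hdet
    exact hdet rfl
  have := Matrix.eq_zero_of_mulVec_eq_zero hdet' (v := fun l : s => g l) (by
    ext k
    rw [Pi.zero_apply, ← h k, ← Finset.sum_coe_sort s]
    exact Finset.sum_congr rfl fun l _ => mul_comm _ _)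
  exact congrFun this ⟨k, hk⟩

variable (b) in
/-- The functional `h ↦ ⟨x^ν⟩ (h · 1)` on the affine Hecke algebra, where `h · 1` is computed in the
polynomial representation. -/
def polyCoeff (ν : weightLattice P) : Hecke b →ₗ[K] K :=
  (xBasis P).coord ν ∘ₗ LinearMap.applyₗ 1 ∘ₗ (polyRep b).toLinearMap

/-- The symmetrizer acts on `1` by `W_0(q²)`, which reduces a sandwiched element to the action of
`Z` on `x^μ`. -/
theorem polyCoeff_mul_symSum (Z : Hecke b) (μ ν : weightLattice P) :
    polyCoeff b ν (Z * Xgen b μ * symSum b) =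
      poincare b 2 * (xBasis P).coord ν (polyRep b Z (xP μ)) := by
  change (xBasis P).coord ν (polyRep b (Z * Xgen b μ * symSum b) 1) = _
  rw [map_mul, map_mul, Module.End.mul_apply, Module.End.mul_apply, polyRep_symSum_one, map_smul,
    polyRep_Xgen, LinearMap.mulLeft_apply, mul_one, map_smul, map_smul, smul_eq_mul]

variable (b) in
/-- The scalar extension of `polyCoeff`. -/
def polyCoeff' (ν : weightLattice P) : Hecke' b →ₗ[K' b] K' b :=
  TensorProduct.AlgebraTensorModule.lift
    ((LinearMap.lsmul (K' b) (Hecke b →ₗ[K] K' b)).flip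
      ((Algebra.linearMap K (K' b)).comp (polyCoeff b ν)))

theorem polyCoeff'_smul_incl (ν : weightLattice P) (c : K' b) (h : Hecke b) :
    polyCoeff' b ν (c • incl b h) = c * algebraMap K (K' b) (polyCoeff b ν h) := by
  rw [map_smul, smul_eq_mul]
  congr 1
  exact one_mul _

/-- Applying the coefficient functionals at the weights of `D` to a dependence gives, up to a
nonzero factor, the linear system of `eq_zero_of_evalOne_diagonal`. -/
theorem linearIndependent_smul_incl {Z : Hecke b} {u : K' b} (hu : IsUnit u)
    {D : Set (weightLattice P)}
    (hdiag : ∀ μ ∈ D, evalOne ((xBasis P).coord μ (polyRep b Z (xP μ))) ≠ 0)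
    (hoff : ∀ μ ∈ D, ∀ ν ∈ D, μ ≠ ν → evalOne ((xBasis P).coord ν (polyRep b Z (xP μ))) = 0) :
    LinearIndependent (K' b)
      (fun μ : D => u • incl b (Z * Xgen b (μ : weightLattice P) * symSum b)) := by
  rw [linearIndependent_iff']
  intro s g hg k hk
  have hp : algebraMap K (K' b) (poincare b 2) ≠ 0 :=
    (map_ne_zero_iff _ algebraMap_K'_injective).2 poincare_ne_zero
  refine eq_zero_of_evalOne_diagonal (B := K' b) algebraMap_K'_injective
    (C := fun ν μ : D => (xBasis P).coord (ν : weightLattice P) (polyRep b Z (xP μ)))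
    (fun μ => hdiag μ μ.2)
    (fun ν μ h => hoff μ μ.2 ν ν.2 fun h' => h (Subtype.ext h')) (fun ν => ?_) hk
  have e := congrArg (polyCoeff' b ν) hg
  rw [map_sum, map_zero] at e
  have e' : u * algebraMap K (K' b) (poincare b 2) * ∑ μ ∈ s, g μ * algebraMap K (K' b)
      ((xBasis P).coord (ν : weightLattice P) (polyRep b Z (xP μ))) = 0 := by
    rw [Finset.mul_sum, ← e]
    refine Finset.sum_congr rfl fun μ _ => ?_
    rw [map_smul, polyCoeff'_smul_incl, polyCoeff_mul_symSum, map_mul, smul_eq_mul]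
    ring
  exact (mul_eq_zero.1 e').resolve_left (mul_ne_zero hu.ne_zero hp)

theorem isUnit_inverse_poincare :
    IsUnit (Ring.inverse (algebraMap K (K' b) (poincare b 2))) :=
  (IsLocalization.Away.algebraMap_isUnit (S := K' b) (poincare b 2)).ringInverse

theorem MHecke_eq (μ : weightLattice P) :
    MHecke b μ = (Ring.inverse (algebraMap K (K' b) (poincare b 2)) *
      Ring.inverse (algebraMap K (K' b) (poincare b 2))) •
        incl b (symSum b * Xgen b μ * symSum b) := by
  rw [MHecke, one₀, ← symSum, map_mul, map_mul, smul_mul_assoc, smul_mul_assoc, mul_smul_comm,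
    smul_smul]

theorem AHecke_eq (μ : weightLattice P) :
    AHecke b μ = (Ring.inverse (algebraMap K (K' b) (poincare b (-2))) *
      Ring.inverse (algebraMap K (K' b) (poincare b 2))) •
        incl b (altSum b * Xgen b μ * symSum b) := by
  rw [AHecke, eps₀, one₀, ← symSum, ← altSum, map_mul, map_mul, smul_mul_assoc, smul_mul_assoc,
    mul_smul_comm, smul_smul]

theorem linearIndependent_MHecke :
    LinearIndependent (K' b) (fun μ : dominant b => MHecke b (μ : weightLattice P)) := by
  simp only [MHecke_eq]
  exact linearIndependent_smul_incl (isUnit_inverse_poincare.mul isUnit_inverse_poincare)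
    (fun μ _ => evalOne_coord_symSum_ne_zero μ)
    fun μ hμ ν hν h => evalOne_coord_polyRep_sum_ne _ hμ hν h

theorem linearIndependent_AHecke :
    LinearIndependent (K' b) (fun μ : strictlyDominant b => AHecke b (μ : weightLattice P)) := by
  simp only [AHecke_eq]
  exact linearIndependent_smul_incl
    ((isUnit_poincare_neg_two b).ringInverse.mul isUnit_inverse_poincare)
    (fun μ hμ => evalOne_coord_altSum_ne_zero hμ)
    fun μ hμ ν hν h => evalOne_coord_polyRep_sum_ne _ (strictlyDominant_subset hμ)
      (strictlyDominant_subset hν) h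

theorem linearIndependent_restrict {κ : Type*} {v : κ → Hecke' b}
    (h : LinearIndependent (K' b) v) : LinearIndependent K v := by
  refine h.restrict_scalars ?_
  intro x y hxy
  simp only [Algebra.smul_def, mul_one] at hxy
  exact algebraMap_K'_injective hxy

end Independence

end

end AffineHecke
-- The theorem.
open AffineHecke in
theorem theorem2p7 {ι M N : Type*} [Finite ι]
    [AddCommGroup M] [Module ℝ M] [AddCommGroup N] [Module ℝ N]
    (P : RootPairing ι ℝ M N) [P.IsRootSystem] [P.IsCrystallographic] [P.IsReduced]
    [P.IsIrreducible] (b : P.Base) :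
    IsBasisOf (symmFun P) (fun x : dominant b => mSym (x : weightLattice P)) ∧
    IsBasisOf (sandwich b (one₀ b) (one₀ b))
      (fun x : dominant b => MHecke b (x : weightLattice P)) ∧
    IsBasisOf (altFun b) (fun x : strictlyDominant b => aAlt b (x : weightLattice P)) ∧
    IsBasisOf (sandwich b (eps₀ b) (one₀ b))
      (fun x : strictlyDominant b => AHecke b (x : weightLattice P)) ∧
    IsBasisOf (sandwich' b (one₀ b) (one₀ b))
      (fun x : dominant b => MHecke b (x : weightLattice P)) ∧
    IsBasisOf (sandwich' b (eps₀ b) (one₀ b))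
      (fun x : strictlyDominant b => AHecke b (x : weightLattice P)) :=
  ⟨isBasisOf_mSym,
    isBasisOf_of_linearIndependent (linearIndependent_restrict linearIndependent_MHecke)
      sandwich_one₀_eq_span.symm,
    isBasisOf_aAlt,
    isBasisOf_of_linearIndependent (linearIndependent_restrict linearIndependent_AHecke)
      sandwich_eps₀_eq_span.symm,
    isBasisOf_of_linearIndependent linearIndependent_MHecke
      (sandwich'_eq_span_range sandwich_one₀_eq_span).symm,
    isBasisOf_of_linearIndependent linearIndependent_AHecke
      (sandwich'_eq_span_range sandwich_eps₀_eq_span).symm⟩
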